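/- Let $\mathsf{AP}$ be a finite set of atomic propositions. A Kripke structure $\mathcal K=\langle S,s_{\mathit{init}},\delta,L\rangle$ has a finite set $S$ of states, an initial state $s_{\mathit{init}}\in S$, a transition relation $\delta\subseteq S\times S$ such that every state has a successor, and a labelling $L:S\to 2^{\mathsf{AP}}$. It is acyclic if its only loops are self-loops on states that have no other outgoing transition. A repair of $\mathcal K$ for a closed HyperLTL formula $\varphi$ is a Kripke structure $\mathcal K'=\langle S,s_{\mathit{init}},\delta',L\rangle$ with $\delta'\subseteq\delta$ (in which, again, every state has a successor) such that $\mathcal K'\models\varphi$. $\mathrm{E}^*$-HyperLTL is the set of HyperLTL formulas that consist of a (possibly empty) sequence of existential trace quantifiers followed by a quantifier-free formula. Theorem. The repair problem for $\mathrm{E}^*$-HyperLTL on acyclic Kripke structures is NL-complete in the size of the Kripke structure; that is: (1) for every finite $\mathsf{AP}$ and every fixed closed $\mathrm{E}^*$-HyperLTL formula $\varphi$ over $\mathsf{AP}$, the language of the (binary, adjacency-matrix) encodings of the acyclic Kripke structures over $\mathsf{AP}$ that have a repair for $\varphi$ is in NL; (2) there are a finite $\mathsf{AP}$ and a closed $\mathrm{E}^*$-HyperLTL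 formula $\varphi$ over $\mathsf{AP}$ for which this problem is NL-hard: for every language $A\subseteq\{0,1\}^*$ in NL there is a function $f$, computable by a deterministic logarithmic-space transducer, that maps each $w\in\{0,1\}^*$ to the encoding of an acyclic Kripke structure over $\mathsf{AP}$ such that $w\in A$ if and only if the structure encoded by $f(w)$ has a repair for $\varphi$. Moreover, for closed $\mathrm{E}^*$-HyperLTL formulas the repair problem is equivalent to model checking: a Kripke structure $\mathcal K$ has a repair for $\varphi$ if and only if $\mathcal K\models\varphi$. -/

import Mathlib

/-! ### Kripke structures -/

/-- A Kripke structure over the atomic propositions `AP` with set of states `S`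
(finiteness of `S` is imposed where structures are used). -/
structure Kripke (AP S : Type) where
  /-- the initial state -/
  init : S
  /-- the transition relation -/
  δ : S → S → Prop
  /-- the labelling function -/
  label : S → Set AP
  /-- there are no deadlock states -/
  total : ∀ s, ∃ s', δ s s'

/-- A loop `s 0, s 1, …, s n` of a Kripke frame. -/
def IsLoop {S : Type} (δ : S → S → Prop) (n : ℕ) (s : ℕ → S) : Prop :=
  (∀ i < n, δ (s i) (s (i + 1))) ∧ δ (s n) (s 0)

/-- A frame is acyclic if its only loops are self-loops on otherwise terminal states: a loop
stays in a single state, and this state has no outgoing transition other than the self-loop. -/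
def AcyclicFrame {S : Type} (δ : S → S → Prop) : Prop :=
  ∀ (n : ℕ) (s : ℕ → S), IsLoop δ n s →
    (∀ i ≤ n, s i = s 0) ∧ ∀ t, δ (s 0) t → t = s 0

/-- A trace over the alphabet `2^AP`. -/
abbrev HTrace (AP : Type) : Type := ℕ → Set AP

/-- The traces of the paths of `K` that start in the state `s₀`. -/
def Kripke.traces {AP S : Type} (K : Kripke AP S) (s₀ : S) : Set (HTrace AP) :=
  {t | ∃ p : ℕ → S, p 0 = s₀ ∧ (∀ i, K.δ (p i) (p (i + 1))) ∧ ∀ i, t i = K.label (p i)}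

/-! ### HyperLTL -/

/-- Quantifier-free HyperLTL formulas; trace variables are natural numbers. -/
inductive HyperBody (AP : Type) : Type
  | tt : HyperBody AP
  | atom : AP → ℕ → HyperBody AP
  | neg : HyperBody AP → HyperBody AP
  | or : HyperBody AP → HyperBody AP → HyperBody AP
  | until : HyperBody AP → HyperBody AP → HyperBody AP
  | next : HyperBody AP → HyperBody AP

/-- HyperLTL formulas. -/
inductive HyperLTL (AP : Type) : Type
  | ex : ℕ → HyperLTL AP → HyperLTL AP
  | all : ℕ → HyperLTL AP → HyperLTL AP
  | body : HyperBody AP → HyperLTL AP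

/-- Trace assignments: partial maps from trace variables to traces. -/
abbrev Assignment (AP : Type) : Type := ℕ → Option (HTrace AP)

/-- The assignment in which every trace is replaced by its suffix from position `j` on. -/
def Assignment.suffix {AP : Type} (A : Assignment AP) (j : ℕ) : Assignment AP :=
  fun x => (A x).map fun t i => t (j + i)

/-- Satisfaction of quantifier-free formulas (independent of the set of traces). -/
def HyperBody.Sat {AP : Type} : HyperBody AP → Assignment AP → Prop
  | .tt, _ => True
  | .atom a x, A => ∃ t, A x = some t ∧ a ∈ t 0
  | .neg ψ, A => ¬ ψ.Sat A
  | .or ψ χ, A => ψ.Sat A ∨ χ.Sat A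
  | .until ψ χ, A => ∃ i, χ.Sat (A.suffix i) ∧ ∀ j < i, ψ.Sat (A.suffix j)
  | .next ψ, A => ψ.Sat (A.suffix 1)

/-- Satisfaction of a formula by a set `T` of traces and a trace assignment. -/
def HyperLTL.Sat {AP : Type} (T : Set (HTrace AP)) : HyperLTL AP → Assignment AP → Prop
  | .ex x φ, A => ∃ t ∈ T, φ.Sat T (Function.update A x (some t))
  | .all x φ, A => ∀ t ∈ T, φ.Sat T (Function.update A x (some t))
  | .body ψ, A => ψ.Sat A

/-- The trace variables occurring in a quantifier-free formula. -/
def HyperBody.vars {AP : Type} : HyperBody AP → Set ℕ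
  | .tt => ∅
  | .atom _ x => {x}
  | .neg ψ => ψ.vars
  | .or ψ χ => ψ.vars ∪ χ.vars
  | .until ψ χ => ψ.vars ∪ χ.vars
  | .next ψ => ψ.vars

/-- The free trace variables of a formula. -/
def HyperLTL.freeVars {AP : Type} : HyperLTL AP → Set ℕ
  | .ex x φ => φ.freeVars \ {x}
  | .all x φ => φ.freeVars \ {x}
  | .body ψ => ψ.vars

/-- Closed formulas. -/
def HyperLTL.Closed {AP : Type} (φ : HyperLTL AP) : Prop := φ.freeVars = ∅

/-- The fragment E*: a (possibly empty) sequence of existential trace quantifiers, followed by a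
quantifier-free formula. -/
def HyperLTL.IsEStar {AP : Type} : HyperLTL AP → Prop
  | .ex _ φ => φ.IsEStar
  | .all _ _ => False
  | .body _ => True

/-- `K ⊨ φ`. -/
def Kripke.Models {AP S : Type} (K : Kripke AP S) (φ : HyperLTL AP) : Prop :=
  φ.Sat (K.traces K.init) fun _ => none

/-- `K` has a repair for `φ`: a Kripke structure (hence without deadlocks) with the same states,
initial state and labels, whose transitions are among those of `K`, and which satisfies `φ`. -/
def Kripke.HasRepair {AP S : Type} (K : Kripke AP S) (φ : HyperLTL AP) : Prop :=
  ∃ K' : Kripke AP S, K'.init = K.init ∧ (∀ s t, K'.δ s t → K.δ s t) ∧ K'.label = K.label ∧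
    K'.Models φ

/-! ### Logarithmic space -/

/-- Head movements. -/
inductive HeadMove : Type
  | left
  | stay
  | right

/-- Moving a head on a one-way infinite tape; a left move on the first cell has no effect. -/
def HeadMove.apply : HeadMove → ℕ → ℕ
  | .left, i => i - 1
  | .stay, i => i
  | .right, i => i + 1

/-- The symbols on the input tape: the bits of the input between two end markers. -/
inductive InputSymbol : Type
  | leftEnd
  | bit (b : Bool)
  | rightEnd

/-- The input tape carries the left end marker on cell `0`, the input `w` on the cells
`1, …, |w|`, and the right end marker on cell `|w| + 1`. -/
def inputSymbol (w : List Bool) : ℕ → InputSymbol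
  | 0 => .leftEnd
  | i + 1 => match w[i]? with
    | some b => .bit b
    | none => .rightEnd

/-- What a machine does in one step. -/
structure OfflineTM.Action (k : ℕ) (Q Γ O : Type) where
  /-- the next state -/
  state : Q
  /-- the movement of the input head -/
  inMove : HeadMove
  /-- the symbols written on the work tapes -/
  write : Fin k → Γ
  /-- the movements of the work heads -/
  workMove : Fin k → HeadMove
  /-- the symbol, if any, appended to the output tape -/
  output : Option O

/-- Nondeterministic Turing machines with a read-only two-way input tape over `{0, 1}`, `k`
read-write work tapes, and a write-only output tape over the alphabet `O`. -/
structure OfflineTM (O : Type) where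
  /-- the number of work tapes -/
  k : ℕ
  /-- the states -/
  Q : Type
  /-- the work alphabet -/
  Γ : Type
  finiteQ : Finite Q
  finiteΓ : Finite Γ
  /-- the blank symbol -/
  blank : Γ
  /-- the start state -/
  start : Q
  /-- the accepting state -/
  accept : Q
  /-- the actions possible in a given state when reading a given input symbol and given symbols
  on the work tapes -/
  trans : Q → InputSymbol → (Fin k → Γ) → Set (OfflineTM.Action k Q Γ O)

namespace OfflineTM

variable {O : Type} (M : OfflineTM O)

/-- Configurations. -/
structure Config where
  /-- the current state -/
  state : M.Q
  /-- the position of the input head -/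
  inHead : ℕ
  /-- the contents of the work tapes -/
  tape : Fin M.k → ℕ → M.Γ
  /-- the positions of the work heads -/
  head : Fin M.k → ℕ
  /-- the output written so far -/
  out : List O

/-- The initial configuration. -/
def initial : M.Config where
  state := M.start
  inHead := 0
  tape := fun _ _ => M.blank
  head := fun _ => 0
  out := []

/-- Performing an action on input `w`; the input head cannot move past the right end marker. -/
def perform (w : List Bool) (c : M.Config) (α : Action M.k M.Q M.Γ O) : M.Config where
  state := α.state
  inHead := min (α.inMove.apply c.inHead) (w.length + 1)
  tape := fun i => Function.update (c.tape i) (c.head i) (α.write i)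
  head := fun i => (α.workMove i).apply (c.head i)
  out := c.out ++ α.output.toList

/-- One computation step on input `w`. -/
def Step (w : List Bool) (c c' : M.Config) : Prop :=
  ∃ α ∈ M.trans c.state (inputSymbol w c.inHead) (fun i => c.tape i (c.head i)),
    c' = M.perform w c α

/-- The configurations reachable on input `w`. -/
def Reachable (w : List Bool) (c : M.Config) : Prop :=
  Relation.ReflTransGen (M.Step w) M.initial c

/-- Acceptance: some computation reaches the accepting state. -/
def Accepts (w : List Bool) : Prop := ∃ c, M.Reachable w c ∧ c.state = M.accept

/-- On every input of length `n`, every computation uses `O(log n)` cells of each work tape. -/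
def LogSpace : Prop :=
  ∃ C : ℕ, ∀ w c, M.Reachable w c → ∀ i, c.head i < C * (Nat.log 2 w.length + 1)

/-- Deterministic machines. -/
def Deterministic : Prop := ∀ q a g, (M.trans q a g).Subsingleton

/-- On every input `w` the machine (which should be deterministic) halts with output `f w`. -/
def Computes (f : List Bool → List O) : Prop :=
  ∀ w, ∃ c, M.Reachable w c ∧ (¬ ∃ c', M.Step w c c') ∧ c.out = f w

end OfflineTM

/-- The class NL: languages recognized by nondeterministic logarithmic-space Turing machines
(which write no output). -/
def NL : Set (Language Bool) :=
  {A | ∃ M : OfflineTM Empty, M.LogSpace ∧ ∀ w, w ∈ A ↔ M.Accepts w}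

/-- Functions computed by deterministic logarithmic-space transducers. -/
def LogSpaceComputable (f : List Bool → List Bool) : Prop :=
  ∃ M : OfflineTM Bool, M.Deterministic ∧ M.LogSpace ∧ M.Computes f

/-- The decision problem with set of instances `D` and set of yes-instances `Y ⊆ D` is NL-hard:
every language in NL has a logarithmic-space many-one reduction to it. The reduction always
produces an instance, so that recognizing instances does not contribute to the hardness. -/
def NLHard (D Y : Language Bool) : Prop :=
  ∀ A ∈ NL, ∃ f : List Bool → List Bool, LogSpaceComputable f ∧
    (∀ w, f w ∈ D) ∧ ∀ w, w ∈ A ↔ f w ∈ Y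

/-! ### The repair problem as a language -/

open Classical in
/-- The binary encoding of a Kripke structure with `n` states over `a` atomic propositions:
`n` in unary, the initial state as an indicator vector, the `n × a` table of the labels, and the
`n × n` adjacency matrix of the transition relation (both row by row). -/
noncomputable def Kripke.encode {a n : ℕ} (K : Kripke (Fin a) (Fin n)) : List Bool :=
  List.replicate n true ++ [false]
    ++ List.ofFn (fun s : Fin n => decide (s = K.init))
    ++ (List.ofFn fun s : Fin n => List.ofFn fun p : Fin a => decide (p ∈ K.label s)).flatten
    ++ (List.ofFn fun s : Fin n => List.ofFn fun t : Fin n => decide (K.δ s t)).flatten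

/-- The encodings of the acyclic Kripke structures over `a` atomic propositions. -/
def AcyclicStructures (a : ℕ) : Language Bool :=
  {w | ∃ (n : ℕ) (K : Kripke (Fin a) (Fin n)), AcyclicFrame K.δ ∧ w = K.encode}

/-- The repair problem for the formula `φ` on acyclic frames: the encodings of the acyclic Kripke
structures that have a repair for `φ`. -/
def AcyclicRepair {a : ℕ} (φ : HyperLTL (Fin a)) : Language Bool :=
  {w | ∃ (n : ℕ) (K : Kripke (Fin a) (Fin n)),
    AcyclicFrame K.δ ∧ K.HasRepair φ ∧ w = K.encode}

/-! A repair only removes paths, and the truth of an existential formula is monotone in the set of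
traces. Hence a repair exists exactly when the structure itself is a model
(`Kripke.hasRepair_iff_models`), and both complexity claims become claims about model checking.

Membership. In an acyclic structure every path ends in a self-loop, so finitely many chosen paths
together spell an eventually constant word. The truth of a formula at a position is determined by
the labels there and by the truth of its subformulas at the next position
(`HyperBody.wSat_iff_now`), and on a constant word it can be evaluated directly
(`HyperBody.wSat_const`). So model checking is reachability in the product of one copy of the frame
per quantified variable with the truth assignments to the subformulas (`exists_paths_iff`). Since
the run ends in a constant word, no fairness condition for until is needed. Nodes of the product are
tuples of numbers whose length depends on the formula only, so reachability is in NL. The input must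
also be recognized as the encoding of an acyclic structure. With n states, acyclicity means that a
self-loop excludes other transitions and that no walk follows n transitions other than self-loops
(`acyclicFrame_iff`). The latter is non-reachability, which is certified by the inductive counting
of Immerman and Szelepcsényi (`countStep_iff`, `countCert_iff`).

To write such algorithms as Turing machines, a tower of models is built: sweeping machines, which
rewrite a word of logarithmic length letter by letter; structured programs over such passes;
nondeterministic programs over numbers stored on binary tracks; and finally the predicates `NLPred`,
with closure under conjunction, disjunction, bounded quantification, reachability and counting.
Negation is absent: complements are supplied in positive form.

Hardness. A configuration of a logarithmic-space machine is a word of length `wordLength w` over a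
fixed alphabet, and for a given scanned input symbol the step relation is regular on pairs of such
words (`OfflineTM.stepRel_code`). The configuration graph is made acyclic by a clock: a state is a
pair of a time and a word, a transition follows a step and advances the clock, or keeps the word and
jumps to the last time (`Layered`). As there are at least as many times as words, reachability is
unchanged, and ∃π. F p expresses acceptance. A transducer writes the encoding by counting through
all states and pairs of states and running finite automata on them
(`Transducer.logSpaceComputable_encode`). -/

/-! ### Sweeping machines -/

/-- A letter-to-letter rewriting pass over a word, from left to right. -/
inductive Scan {S Δ : Type} (f : S → Δ → Set (S × Δ)) : S → List Δ → S → List Δ → Prop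
  | nil (s : S) : Scan f s [] s []
  | cons {s s₁ s₂ : S} {d d₁ : Δ} {v v₂ : List Δ} :
      (s₁, d₁) ∈ f s d → Scan f s₁ v s₂ v₂ → Scan f s (d :: v) s₂ (d₁ :: v₂)

theorem Scan.length_eq {S Δ : Type} {f : S → Δ → Set (S × Δ)} {s s' : S} {v v' : List Δ}
    (h : Scan f s v s' v') : v'.length = v.length := by
  induction h with
  | nil => rfl
  | cons _ _ ih => simp [ih]

theorem Scan.snoc {S Δ : Type} {f : S → Δ → Set (S × Δ)} {s s₁ s₂ : S} {v v₁ : List Δ} {d d₁ : Δ}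
    (h : Scan f s v s₁ v₁) (h' : (s₂, d₁) ∈ f s₁ d) : Scan f s (v ++ [d]) s₂ (v₁ ++ [d₁]) := by
  induction h with
  | nil => exact .cons h' (.nil _)
  | cons h₁ _ ih => exact .cons h₁ (ih h')

/-- Machines whose work tape holds a word of fixed length: a macro step consists of one action that
sees the input symbol, followed by one rewriting pass over the word. -/
structure SweepMachine (O : Type) where
  Q : Type
  Δ : Type
  finiteQ : Finite Q
  finiteΔ : Finite Δ
  start : Q
  accept : Q
  /-- the letter that fills the initial word -/
  pad : Δ
  act : Q → InputSymbol → Set (Q × HeadMove × Option O)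
  scan : Q → Δ → Set (Q × Δ)

/-- The length of the word on the work tape of a sweeping machine on input `w`. -/
def wordLength (w : List Bool) : ℕ := (w.length + 1).size

/-- Every position of the input head, both end markers included, fits on one binary track. -/
theorem lt_two_pow_wordLength (w : List Bool) : w.length + 1 < 2 ^ wordLength w :=
  Nat.lt_size_self _

theorem wordLength_pos (w : List Bool) : 0 < wordLength w := Nat.size_pos.2 (Nat.succ_pos _)

/-- Used for hardness: blocks of `C` cells, one for each letter of the word, cover a tape of length
`C * (log |w| + 1)`. -/
theorem log_lt_wordLength (w : List Bool) : Nat.log 2 w.length < wordLength w := by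
  apply Nat.log_lt_of_lt_pow' (wordLength_pos w).ne'
  have := lt_two_pow_wordLength w
  omega

/-- Used for the space bound of the simulating machine. -/
theorem wordLength_le (w : List Bool) : wordLength w ≤ Nat.log 2 w.length + 2 := by
  unfold wordLength
  rw [Nat.size_le]
  have : w.length < 2 ^ (Nat.log 2 w.length + 1) := Nat.lt_pow_succ_log_self (by norm_num) _
  rw [pow_succ]
  omega

namespace SweepMachine

variable {O : Type} (M : SweepMachine O)

/-- Configurations of a sweeping machine between two macro steps. -/
structure Cfg where
  state : M.Q
  inHead : ℕ
  word : List M.Δ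
  out : List O

/-- The initial configuration; the input head is on the right end marker. -/
def initial (w : List Bool) : M.Cfg :=
  ⟨M.start, w.length + 1, List.replicate (wordLength w) M.pad, []⟩

/-- One macro step. -/
def Step (w : List Bool) (c c' : M.Cfg) : Prop :=
  ∃ q m o, (q, m, o) ∈ M.act c.state (inputSymbol w c.inHead) ∧
    Scan M.scan q c.word c'.state c'.word ∧
    c'.inHead = min (HeadMove.apply m c.inHead) (w.length + 1) ∧ c'.out = c.out ++ o.toList

def Reachable (w : List Bool) (c : M.Cfg) : Prop :=
  Relation.ReflTransGen (M.Step w) (M.initial w) c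

def Deterministic : Prop :=
  (∀ q a, (M.act q a).Subsingleton) ∧ ∀ q d, (M.scan q d).Subsingleton

variable {M} in
theorem Reachable.bounds {w : List Bool} {c : M.Cfg} (h : M.Reachable w c) :
    c.inHead ≤ w.length + 1 ∧ c.word.length = wordLength w := by
  induction h with
  | refl => simp [initial]
  | tail _ h ih =>
    obtain ⟨q, m, o, -, hs, hh, -⟩ := h
    exact ⟨hh ▸ min_le_right _ _, hs.length_eq.trans ih.2⟩

/-! ### Simulation of sweeping machines -/

/-- The work alphabet of the simulating machine. -/
inductive Sym (Δ : Type) : Type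
  | blank
  | mark
  | bit (b : Bool)
  | data (d : Δ)

/-- The states of the simulating machine. -/
inductive Phase (Q : Type) : Type
  | init
  | count
  | incr
  | countBack
  | conv
  | home (q : Q)
  | scan (q : Q)
  | back (q : Q)

instance {Δ : Type} [Finite Δ] : Finite (Sym Δ) := by
  let f : Bool ⊕ Bool ⊕ Δ → Sym Δ := fun x => match x with
    | .inl true => .blank
    | .inl false => .mark
    | .inr (.inl b) => .bit b
    | .inr (.inr d) => .data d
  refine Finite.of_surjective f ?_
  rintro (_ | _ | b | d)
  exacts [⟨.inl true, rfl⟩, ⟨.inl false, rfl⟩, ⟨.inr (.inl b), rfl⟩, ⟨.inr (.inr d), rfl⟩]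

instance {Q : Type} [Finite Q] : Finite (Phase Q) := by
  let f : Fin 5 ⊕ Q ⊕ Q ⊕ Q → Phase Q := fun x => match x with
    | .inl 0 => .init
    | .inl 1 => .count
    | .inl 2 => .incr
    | .inl 3 => .countBack
    | .inl 4 => .conv
    | .inr (.inl q) => .home q
    | .inr (.inr (.inl q)) => .scan q
    | .inr (.inr (.inr q)) => .back q
  refine Finite.of_surjective f ?_
  rintro (_ | _ | _ | _ | _ | q | q | q)
  exacts [⟨.inl 0, rfl⟩, ⟨.inl 1, rfl⟩, ⟨.inl 2, rfl⟩, ⟨.inl 3, rfl⟩, ⟨.inl 4, rfl⟩,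
    ⟨.inr (.inl q), rfl⟩, ⟨.inr (.inr (.inl q)), rfl⟩, ⟨.inr (.inr (.inr q)), rfl⟩]

/-- The steps of the simulating machine: new state, input move, written symbol, work move,
output. In the first phases it counts the cells of the input in binary, and then replaces the
digits by the padding letter. -/
def micro : Phase M.Q → InputSymbol → Sym M.Δ →
    Set (Phase M.Q × HeadMove × Sym M.Δ × HeadMove × Option O)
  | .init, _, _ => {(.count, .stay, .mark, .stay, none)}
  | .count, .rightEnd, g => {(.conv, .stay, g, .right, none)}
  | .count, _, g => {(.incr, .right, g, .right, none)}
  | .incr, _, .bit true => {(.incr, .stay, .bit false, .right, none)}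
  | .incr, _, _ => {(.countBack, .stay, .bit true, .left, none)}
  | .countBack, _, .mark => {(.count, .stay, .mark, .stay, none)}
  | .countBack, _, g => {(.countBack, .stay, g, .left, none)}
  | .conv, _, .bit _ => {(.conv, .stay, .data M.pad, .right, none)}
  | .conv, _, g => {(.back M.start, .stay, g, .left, none)}
  | .home q, a, g => {x | ∃ y ∈ M.act q a, x = (.scan y.1, y.2.1, g, .right, y.2.2)}
  | .scan q, _, .data d => {x | ∃ y ∈ M.scan q d, x = (.scan y.1, .stay, .data y.2, .right, none)}
  | .scan q, _, g => {(.back q, .stay, g, .left, none)}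
  | .back q, _, .mark => {(.home q, .stay, .mark, .stay, none)}
  | .back q, _, g => {(.back q, .stay, g, .left, none)}

/-- The Turing machine that simulates a sweeping machine. -/
def toTM : OfflineTM O where
  k := 1
  Q := Phase M.Q
  Γ := Sym M.Δ
  finiteQ := by have := M.finiteQ; infer_instance
  finiteΓ := by have := M.finiteΔ; infer_instance
  blank := .blank
  start := .init
  accept := .home M.accept
  trans := fun q a g => {α | ∃ x ∈ M.micro q a (g 0),
    α = ⟨x.1, x.2.1, fun _ => x.2.2.1, fun _ => x.2.2.2.1, x.2.2.2.2⟩}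

theorem toTM_deterministic (h : M.Deterministic) : M.toTM.Deterministic := by
  rintro q a g α ⟨x, hx, rfl⟩ β ⟨y, hy, rfl⟩
  suffices x = y by rw [this]
  change x ∈ M.micro q a (g (0 : Fin 1)) at hx
  change y ∈ M.micro q a (g (0 : Fin 1)) at hy
  generalize g (0 : Fin 1) = s at hx hy
  rcases q with _ | _ | _ | _ | _ | q | q | q
  case home =>
    obtain ⟨x, hx, rfl⟩ := hx
    obtain ⟨y, hy, rfl⟩ := hy
    rw [h.1 q a hx hy]
  case scan =>
    rcases s with _ | _ | b | d
    case data =>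
      obtain ⟨x, hx, rfl⟩ := hx
      obtain ⟨y, hy, rfl⟩ := hy
      rw [h.2 q d hx hy]
    all_goals exact (Set.mem_singleton_iff.1 hx).trans (Set.mem_singleton_iff.1 hy).symm
  all_goals
    rcases a with _ | _ | _ <;> rcases s with _ | _ | (_ | _) | _ <;>
    exact (Set.mem_singleton_iff.1 hx).trans (Set.mem_singleton_iff.1 hy).symm

/-- The tape with given initial cells, followed by blanks. -/
def listTape {Δ : Type} (l : List (Sym Δ)) : ℕ → Sym Δ := fun i => l.getD i .blank

/-- The configurations of the simulating machine. -/
def cfg (q : Phase M.Q) (h : ℕ) (l : List (Sym M.Δ)) (j : ℕ) (out : List O) : M.toTM.Config :=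
  ⟨q, h, fun _ => listTape l, fun _ => j, out⟩

theorem listTape_snoc_blank {Δ : Type} (l : List (Sym Δ)) :
    listTape (l ++ [.blank]) = listTape l := by
  funext i
  rcases lt_trichotomy i l.length with h | rfl | h
  · simp [listTape, List.getD, List.getElem?_append_left h]
  · simp [listTape, List.getD]
  · simp only [listTape, List.getD]
    rw [List.getElem?_eq_none (by simp; omega), List.getElem?_eq_none (by omega)]

theorem update_listTape_mid {Δ : Type} (a r : List (Sym Δ)) (g x : Sym Δ) :
    Function.update (listTape (a ++ g :: r)) a.length x = listTape (a ++ x :: r) := by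
  funext i
  rcases lt_trichotomy i a.length with h | rfl | h
  · simp [listTape, List.getD, Function.update_of_ne h.ne, List.getElem?_append_left h]
  · simp [listTape, List.getD]
  · obtain ⟨k, rfl⟩ := Nat.exists_eq_add_of_lt h
    simp [listTape, List.getD, List.getElem?_append_right, add_assoc]

theorem step_mid {w : List Bool} {q : Phase M.Q} {h : ℕ} {a r : List (Sym M.Δ)} {g : Sym M.Δ}
    {out : List O} {c : M.toTM.Config} :
    M.toTM.Step w (M.cfg q h (a ++ g :: r) a.length out) c ↔
      ∃ x ∈ M.micro q (inputSymbol w h) g, c = M.cfg x.1 (min (x.2.1.apply h) (w.length + 1))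
        (a ++ x.2.2.1 :: r) (x.2.2.2.1.apply a.length) (out ++ x.2.2.2.2.toList) := by
  have hg : listTape (a ++ g :: r) a.length = g := by simp [listTape]
  have key : ∀ x : Phase M.Q × HeadMove × Sym M.Δ × HeadMove × Option O,
      M.toTM.perform w (M.cfg q h (a ++ g :: r) a.length out)
        ⟨x.1, x.2.1, fun _ => x.2.2.1, fun _ => x.2.2.2.1, x.2.2.2.2⟩ =
      M.cfg x.1 (min (x.2.1.apply h) (w.length + 1))
        (a ++ x.2.2.1 :: r) (x.2.2.2.1.apply a.length) (out ++ x.2.2.2.2.toList) := by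
    intro x
    unfold OfflineTM.perform cfg
    congr 1
    funext i
    exact update_listTape_mid _ _ _ _
  constructor
  · rintro ⟨α, ⟨x, hx, rfl⟩, rfl⟩
    refine ⟨x, ?_, key x⟩
    simpa only [cfg, hg] using hx
  · rintro ⟨x, hx, rfl⟩
    refine ⟨_, ⟨x, ?_, rfl⟩, (key x).symm⟩
    simpa only [cfg, hg] using hx

theorem cfg_snoc_blank (q : Phase M.Q) (h : ℕ) (a : List (Sym M.Δ)) (j : ℕ) (out : List O) :
    M.cfg q h (a ++ [.blank]) j out = M.cfg q h a j out := by
  unfold cfg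
  rw [listTape_snoc_blank]

/-- The head stands just behind the list and reads a blank. Appending that blank explicitly does not
change the tape, which reduces the claim to `step_mid`. -/
theorem step_end {w : List Bool} {q : Phase M.Q} {h : ℕ} {a : List (Sym M.Δ)}
    {out : List O} {c : M.toTM.Config} :
    M.toTM.Step w (M.cfg q h a a.length out) c ↔
      ∃ x ∈ M.micro q (inputSymbol w h) .blank, c = M.cfg x.1 (min (x.2.1.apply h) (w.length + 1))
        (a ++ [x.2.2.1]) (x.2.2.2.1.apply a.length) (out ++ x.2.2.2.2.toList) := by
  rw [← M.cfg_snoc_blank, M.step_mid]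

/-- The tape that holds the word `v`. -/
def wordTape {Δ : Type} (v : List Δ) : List (Sym Δ) := .mark :: v.map .data

/-- The tape that holds the binary counter `m`. -/
def counterTape {Δ : Type} (m : ℕ) : List (Sym Δ) := .mark :: m.bits.map .bit

/-- The configuration of the simulating machine that corresponds to a configuration of the
sweeping machine. -/
def homeCfg (c : M.Cfg) : M.toTM.Config := M.cfg (.home c.state) c.inHead (wordTape c.word) 0 c.out

/-- Binary increment, least significant digit first: the carry clears the leading ones and stops at
the first zero. This is the pass of the phase `incr`. -/
theorem bits_succ_of_eq {m j : ℕ} {r : List Bool}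
    (h : m.bits = List.replicate j true ++ false :: r) :
    (m + 1).bits = List.replicate j false ++ true :: r := by
  induction j generalizing m with
  | zero =>
    induction m using Nat.binaryRec' with
    | zero => simp at h
    | bit b n hn _ =>
      rw [Nat.bits_append_bit n b hn] at h
      simp only [List.replicate_zero, List.nil_append, List.cons.injEq] at h ⊢
      obtain ⟨rfl, rfl⟩ := h
      exact Nat.bit1_bits n
  | succ j ih =>
    induction m using Nat.binaryRec' with
    | zero => simp [List.replicate_succ] at h
    | bit b n hn _ =>
      rw [Nat.bits_append_bit n b hn] at h
      simp only [List.replicate_succ, List.cons_append, List.cons.injEq] at h ⊢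
      obtain ⟨rfl, h⟩ := h
      have := Nat.bit0_bits (n + 1) (by omega)
      rw [← ih h, ← this]
      rfl

/-- The carry runs off the end, and the counter grows by one digit, written on a blank. -/
theorem bits_succ_of_eq_replicate {m j : ℕ} (h : m.bits = List.replicate j true) :
    (m + 1).bits = List.replicate j false ++ [true] := by
  induction j generalizing m with
  | zero =>
    induction m using Nat.binaryRec' with
    | zero => simp
    | bit b n hn _ => simp [Nat.bits_append_bit n b hn] at h
  | succ j ih =>
    induction m using Nat.binaryRec' with
    | zero => simp [List.replicate_succ] at h
    | bit b n hn _ =>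
      rw [Nat.bits_append_bit n b hn] at h
      simp only [List.replicate_succ, List.cons_append, List.cons.injEq] at h ⊢
      obtain ⟨rfl, h⟩ := h
      have := Nat.bit0_bits (n + 1) (by omega)
      rw [← ih h, ← this]
      rfl

/-- The configurations that occur in the simulation. -/
inductive Inv (w : List Bool) : M.toTM.Config → Prop
  | init : Inv w (M.cfg .init 0 [] 0 [])
  | count {h : ℕ} (hh : h ≤ w.length + 1) : Inv w (M.cfg .count h (counterTape h) 0 [])
  | incr {h j : ℕ} {r : List Bool} (hh : h ≤ w.length) (hb : h.bits = List.replicate j true ++ r) :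
      Inv w (M.cfg .incr (h + 1) ((.mark :: List.replicate j (.bit false)) ++ r.map .bit) (j + 1) [])
  | countBack {h : ℕ} {a r : List (Sym M.Δ)} {g : Sym M.Δ} (hh : h ≤ w.length + 1)
      (hl : counterTape h = a ++ g :: r) :
      Inv w (M.cfg .countBack h (a ++ g :: r) a.length [])
  | conv {a r : List Bool} (hb : (w.length + 1).bits = a ++ r) :
      Inv w (M.cfg .conv (w.length + 1)
        ((.mark :: List.replicate a.length (.data M.pad)) ++ r.map .bit) (a.length + 1) [])
  | home {c : M.Cfg} (hc : M.Reachable w c) : Inv w (M.homeCfg c)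
  | scan {c : M.Cfg} {q q' : M.Q} {m : HeadMove} {o : Option O} {a a' r : List M.Δ}
      (hc : M.Reachable w c) (ha : (q, m, o) ∈ M.act c.state (inputSymbol w c.inHead))
      (hw : c.word = a ++ r) (hs : Scan M.scan q a q' a') :
      Inv w (M.cfg (.scan q') (min (m.apply c.inHead) (w.length + 1))
        (wordTape a' ++ r.map .data) (a.length + 1) (c.out ++ o.toList))
  | back {c : M.Cfg} {a r : List (Sym M.Δ)} {g : Sym M.Δ} (hc : M.Reachable w c)
      (hl : wordTape c.word = a ++ g :: r) :
      Inv w (M.cfg (.back c.state) c.inHead (a ++ g :: r) a.length c.out)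

theorem inputSymbol_rightEnd {w : List Bool} {h : ℕ} :
    inputSymbol w h = .rightEnd ↔ w.length < h := by
  rcases h with _ | h
  · simp [inputSymbol]
  · simp only [inputSymbol]
    rcases lt_or_ge h w.length with hh | hh
    · simp only [List.getElem?_eq_getElem hh, reduceCtorEq, false_iff, not_lt]
      omega
    · simp only [List.getElem?_eq_none hh, true_iff]
      omega

theorem inputSymbol_bit {w : List Bool} {i : ℕ} {b : Bool} :
    inputSymbol w (i + 1) = .bit b ↔ w[i]? = some b := by
  simp only [inputSymbol]
  cases w[i]? <;> simp

end SweepMachine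

/-! ### Soundness of the simulation: the invariant is preserved -/

namespace SweepMachine

variable {O : Type} (M : SweepMachine O)

/-- The mark occurs only in the first cell, so a head returning to the left recognizes the start of
the tape by the symbol it reads. -/
theorem split_cons_cases {α β : Type} {f : α → β} {x g : β} {v : List α} {a r : List β}
    (h : x :: v.map f = a ++ g :: r) :
    (a = [] ∧ g = x) ∨ (a ≠ [] ∧ ∃ b ∈ v, g = f b) := by
  rcases a with _ | ⟨y, a⟩
  · simp only [List.nil_append, List.cons.injEq] at h
    exact .inl ⟨rfl, h.1.symm⟩
  · simp only [List.cons_append, List.cons.injEq] at h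
    have : g ∈ v.map f := by rw [h.2]; simp
    obtain ⟨b, hb, rfl⟩ := List.mem_map.1 this
    exact .inr ⟨by simp, b, hb, rfl⟩

/-- Moving left means splitting the same list one cell earlier, which restores the shape required by
`step_mid` and `Inv`. -/
theorem exists_step_left {a r : List (Sym M.Δ)} {g : Sym M.Δ} (ha : a ≠ []) :
    ∃ a' g', a ++ g :: r = a' ++ g' :: (g :: r) ∧ HeadMove.left.apply a.length = a'.length := by
  refine ⟨a.dropLast, a.getLast ha, ?_, by simp [HeadMove.apply]⟩
  conv_lhs => rw [← List.dropLast_append_getLast ha]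
  simp

variable {M}

theorem Inv.step_init {w : List Bool} {c' : M.toTM.Config}
    (h : M.toTM.Step w (M.cfg .init 0 [] 0 []) c') : M.Inv w c' := by
  obtain ⟨x, hx, rfl⟩ := (M.step_end (a := [])).1 h
  obtain rfl := Set.mem_singleton_iff.1 hx
  exact Inv.count (Nat.zero_le _)

theorem Inv.step_count {w : List Bool} {h : ℕ} {c' : M.toTM.Config} (hh : h ≤ w.length + 1)
    (hs : M.toTM.Step w (M.cfg .count h (counterTape h) 0 []) c') : M.Inv w c' := by
  obtain ⟨x, hx, rfl⟩ := (M.step_mid (a := [])).1 hs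
  by_cases hr : w.length < h
  · rw [inputSymbol_rightEnd.2 hr] at hx
    obtain rfl := Set.mem_singleton_iff.1 hx
    -- The counter equals the head position, so when the right end marker appears it holds `|w| +
    -- 1`, a number with exactly `wordLength w` digits.
    obtain rfl : h = w.length + 1 := by omega
    have := Inv.conv (M := M) (w := w) (a := []) (r := (w.length + 1).bits) rfl
    simpa [HeadMove.apply] using this
  · have hx' : x = (.incr, .right, .mark, .right, none) := by
      have : inputSymbol w h ≠ .rightEnd := fun e => hr (inputSymbol_rightEnd.1 e)
      revert hx this
      cases inputSymbol w h <;> intro hx this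
      · exact Set.mem_singleton_iff.1 hx
      · exact Set.mem_singleton_iff.1 hx
      · exact absurd rfl this
    subst hx'
    have := Inv.incr (M := M) (w := w) (h := h) (j := 0) (r := h.bits) (by omega) rfl
    have hmin : min (h + 1) (w.length + 1) = h + 1 := by omega
    simpa [HeadMove.apply, hmin] using this

theorem Inv.step_incr {w : List Bool} {h j : ℕ} {r : List Bool} {c' : M.toTM.Config}
    (hh : h ≤ w.length) (hb : h.bits = List.replicate j true ++ r)
    (hs : M.toTM.Step w (M.cfg .incr (h + 1)
      ((.mark :: List.replicate j (.bit false)) ++ r.map .bit) (j + 1) []) c') : M.Inv w c' := by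
  have hl : j + 1 = ((.mark :: List.replicate j (.bit false) : List (Sym M.Δ))).length := by simp
  have hmin : min (h + 1) (w.length + 1) = h + 1 := by omega
  have hback : ∀ (r' : List Bool), (h + 1).bits = List.replicate j false ++ true :: r' →
      M.Inv w (M.cfg .countBack (h + 1)
        ((.mark :: List.replicate j (.bit false)) ++ .bit true :: r'.map .bit) j []) := by
    intro r' hr'
    obtain ⟨a', g', e, ha'⟩ := M.exists_step_left (r := r'.map .bit) (g := .bit true)
      (a := .mark :: List.replicate j (.bit false)) (by simp)
    have : j = a'.length := by rw [← ha']; simp [HeadMove.apply]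
    rw [e, this]
    refine Inv.countBack (by omega) ?_
    rw [← e, counterTape, hr']
    simp
  rw [hl] at hs
  rcases r with _ | ⟨_ | _, r⟩
  · rw [List.map_nil, List.append_nil] at hs
    obtain ⟨x, hx, rfl⟩ := M.step_end.1 hs
    obtain rfl := Set.mem_singleton_iff.1 hx
    have := hback [] (bits_succ_of_eq_replicate (by simpa using hb))
    simpa [HeadMove.apply, hmin] using this
  · rw [List.map_cons] at hs
    obtain ⟨x, hx, rfl⟩ := M.step_mid.1 hs
    obtain rfl := Set.mem_singleton_iff.1 hx
    have := hback r (bits_succ_of_eq hb)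
    simpa [HeadMove.apply, hmin] using this
  · rw [List.map_cons] at hs
    obtain ⟨x, hx, rfl⟩ := M.step_mid.1 hs
    obtain rfl := Set.mem_singleton_iff.1 hx
    have := Inv.incr (M := M) (w := w) (h := h) (j := j + 1) (r := r) hh
      (by rw [hb, List.replicate_succ']; simp)
    rw [List.replicate_succ'] at this
    simpa [HeadMove.apply, hmin] using this

theorem Inv.step_countBack {w : List Bool} {h : ℕ} {a r : List (Sym M.Δ)} {g : Sym M.Δ}
    {c' : M.toTM.Config} (hh : h ≤ w.length + 1) (hl : counterTape h = a ++ g :: r)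
    (hs : M.toTM.Step w (M.cfg .countBack h (a ++ g :: r) a.length []) c') : M.Inv w c' := by
  obtain ⟨x, hx, rfl⟩ := M.step_mid.1 hs
  rcases split_cons_cases hl with ⟨rfl, rfl⟩ | ⟨ha, b, -, rfl⟩
  · obtain rfl := Set.mem_singleton_iff.1 hx
    have := Inv.count (M := M) hh
    rw [hl] at this
    simpa [HeadMove.apply, hh] using this
  · obtain rfl := Set.mem_singleton_iff.1 hx
    obtain ⟨a', g', e, ha'⟩ := M.exists_step_left (r := r) (g := .bit b) ha
    dsimp only
    rw [e, ha']
    have := Inv.countBack (M := M) hh (hl.trans e)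
    simpa [HeadMove.apply, hh] using this

theorem Inv.step_conv {w a r : List Bool} {c' : M.toTM.Config}
    (hb : (w.length + 1).bits = a ++ r)
    (hs : M.toTM.Step w (M.cfg .conv (w.length + 1)
        ((.mark :: List.replicate a.length (.data M.pad)) ++ r.map .bit) (a.length + 1) []) c') :
    M.Inv w c' := by
  have hl : a.length + 1 = ((.mark :: List.replicate a.length (.data M.pad) :
    List (Sym M.Δ))).length := by simp
  rw [hl] at hs
  rcases r with _ | ⟨b, r⟩
  · rw [List.map_nil, List.append_nil] at hs
    obtain ⟨x, hx, rfl⟩ := M.step_end.1 hs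
    obtain rfl := Set.mem_singleton_iff.1 hx
    -- All digits of the counter have become padding letters, so the word has the required length
    -- although that length was never computed explicitly.
    have hwl : wordLength w = a.length := by
      rw [wordLength, ← Nat.size_eq_bits_len, hb, List.append_nil]
    have hw : wordTape (M.initial w).word = .mark :: List.replicate a.length (.data M.pad) := by
      simp [wordTape, initial, hwl]
    dsimp only
    rw [cfg_snoc_blank, ← hw]
    have hne : wordTape (M.initial w).word ≠ [] := by simp [wordTape]
    have := Inv.back (M := M) (w := w) (c := M.initial w) .refl
      (List.dropLast_append_getLast hne).symm
    rw [List.dropLast_append_getLast hne, List.length_dropLast] at this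
    simpa [HeadMove.apply, initial] using this
  · rw [List.map_cons] at hs
    obtain ⟨x, hx, rfl⟩ := M.step_mid.1 hs
    obtain rfl := Set.mem_singleton_iff.1 hx
    have := Inv.conv (M := M) (w := w) (a := a ++ [b]) (r := r) (by simpa using hb)
    rw [List.length_append, List.length_singleton, List.replicate_succ'] at this
    simpa [HeadMove.apply] using this

theorem Inv.step_home {w : List Bool} {c : M.Cfg} {c' : M.toTM.Config} (hc : M.Reachable w c)
    (hs : M.toTM.Step w (M.homeCfg c) c') : M.Inv w c' := by
  obtain ⟨x, ⟨⟨q, m, o⟩, hy, rfl⟩, rfl⟩ := (M.step_mid (a := [])).1 hs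
  have := Inv.scan (M := M) hc hy (a := []) (a' := []) (r := c.word) rfl (.nil _)
  simpa [HeadMove.apply, wordTape] using this

theorem Inv.step_scan {w : List Bool} {c : M.Cfg} {q q' : M.Q} {m : HeadMove} {o : Option O}
    {a a' r : List M.Δ} {c' : M.toTM.Config}
    (hc : M.Reachable w c) (ha : (q, m, o) ∈ M.act c.state (inputSymbol w c.inHead))
    (hw : c.word = a ++ r) (hsc : Scan M.scan q a q' a')
    (hs : M.toTM.Step w (M.cfg (.scan q') (min (m.apply c.inHead) (w.length + 1))
        (wordTape a' ++ r.map .data) (a.length + 1) (c.out ++ o.toList)) c') : M.Inv w c' := by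
  have hl : a.length + 1 = (wordTape a').length := by simp [wordTape, hsc.length_eq]
  rw [hl] at hs
  rcases r with _ | ⟨d, r⟩
  · rw [List.map_nil, List.append_nil] at hs
    obtain ⟨x, hx, rfl⟩ := M.step_end.1 hs
    obtain rfl := Set.mem_singleton_iff.1 hx
    dsimp only
    rw [cfg_snoc_blank]
    have hne : wordTape a' ≠ [] := by simp [wordTape]
    -- The blank ends the pass; only now is the macro step complete, and the invariant moves on to
    -- the next configuration of the sweeping machine.
    have hc' : M.Reachable w ⟨q', min (m.apply c.inHead) (w.length + 1), a', c.out ++ o.toList⟩ :=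
      hc.tail ⟨q, m, o, ha, by rw [hw, List.append_nil]; exact hsc, rfl, rfl⟩
    have := Inv.back hc' (List.dropLast_append_getLast hne).symm
    rw [List.dropLast_append_getLast hne, List.length_dropLast] at this
    simpa [HeadMove.apply] using this
  · rw [List.map_cons] at hs
    obtain ⟨x, ⟨⟨q₂, d₂⟩, hy, rfl⟩, rfl⟩ := M.step_mid.1 hs
    have := Inv.scan (M := M) (r := r) hc ha (by simpa using hw) (hsc.snoc hy)
    simpa [HeadMove.apply, wordTape, hsc.length_eq] using this

theorem Inv.step_back {w : List Bool} {c : M.Cfg} {a r : List (Sym M.Δ)} {g : Sym M.Δ}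
    {c' : M.toTM.Config} (hc : M.Reachable w c) (hl : wordTape c.word = a ++ g :: r)
    (hs : M.toTM.Step w (M.cfg (.back c.state) c.inHead (a ++ g :: r) a.length c.out) c') :
    M.Inv w c' := by
  have hh := hc.bounds.1
  obtain ⟨x, hx, rfl⟩ := M.step_mid.1 hs
  rcases split_cons_cases hl with ⟨rfl, rfl⟩ | ⟨ha, b, -, rfl⟩
  · obtain rfl := Set.mem_singleton_iff.1 hx
    have := Inv.home hc
    rw [homeCfg, hl] at this
    simpa [HeadMove.apply, hh] using this
  · obtain rfl := Set.mem_singleton_iff.1 hx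
    obtain ⟨a', g', e, ha'⟩ := M.exists_step_left (r := r) (g := .data b) ha
    dsimp only
    rw [e, ha']
    have := Inv.back hc (hl.trans e)
    simpa [HeadMove.apply, hh] using this

theorem Inv.of_reachable {w : List Bool} {c : M.toTM.Config} (h : M.toTM.Reachable w c) :
    M.Inv w c := by
  induction h with
  | refl => exact Inv.init
  | tail _ hs ih =>
    cases ih with
    | init => exact Inv.step_init hs
    | count hh => exact Inv.step_count hh hs
    | incr hh hb => exact Inv.step_incr hh hb hs
    | countBack hh hl => exact Inv.step_countBack hh hl hs
    | conv hb => exact Inv.step_conv hb hs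
    | home hc => exact Inv.step_home hc hs
    | scan hc ha hw hsc => exact Inv.step_scan hc ha hw hsc hs
    | back hc hl => exact Inv.step_back hc hl hs

/-- The counter never exceeds `|w| + 1` and the word never changes its length, so the head goes at
most one cell beyond the mark and `wordLength w` further cells. -/
theorem Inv.head_le {w : List Bool} {c : M.toTM.Config} (h : M.Inv w c) (i : Fin 1) :
    c.head i ≤ wordLength w + 1 := by
  have hc : ∀ h ≤ w.length + 1, h.bits.length ≤ wordLength w := by
    intro h hh
    rw [Nat.size_eq_bits_len]
    exact Nat.size_le_size hh
  cases h with
  | init => exact Nat.zero_le _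
  | count hh => exact Nat.zero_le _
  | @incr h j r hh hb =>
    have := hc h (by omega)
    rw [hb] at this
    simp only [List.length_append, List.length_replicate] at this
    change j + 1 ≤ _
    omega
  | @countBack h a r g hh hl =>
    have := hc h (by omega)
    have hl' := congrArg List.length hl
    simp only [counterTape, List.length_append, List.length_cons, List.length_map] at hl'
    change a.length ≤ _
    omega
  | @conv a r hb =>
    have := hc _ le_rfl
    rw [hb, List.length_append] at this
    change a.length + 1 ≤ _
    omega
  | home hc => exact Nat.zero_le _
  | @scan c _ _ _ _ a _ r hc _ hw _ =>
    have := hc.bounds.2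
    rw [hw, List.length_append] at this
    change a.length + 1 ≤ _
    omega
  | @back c a r g hc hl =>
    have hb := hc.bounds.2
    have hl' := congrArg List.length hl
    simp only [wordTape, List.length_append, List.length_cons, List.length_map] at hl'
    change a.length ≤ _
    omega

variable (M) in
theorem toTM_logSpace : M.toTM.LogSpace := by
  -- With ℓ = log |w|, the head is at most `wordLength w + 1 ≤ ℓ + 3`, which is less than `4 * (ℓ +
  -- 1)`.
  refine ⟨4, fun w c hc i => ?_⟩
  have h1 := (Inv.of_reachable hc).head_le i
  have h2 := wordLength_le w
  omega

/-- The accepting state is a `home` phase, and the only configurations of the invariant in such a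
phase are images of reachable configurations of the sweeping machine. -/
theorem exists_reachable_of_accepts {w : List Bool} (h : M.toTM.Accepts w) :
    ∃ c, M.Reachable w c ∧ c.state = M.accept := by
  obtain ⟨c, hc, ha⟩ := h
  have hi := Inv.of_reachable hc
  change c.state = Phase.home M.accept at ha
  cases hi with
  | @home c hr => exact ⟨c, hr, Phase.home.inj ha⟩
  | _ => simp [cfg] at ha

/-! ### Completeness of the simulation -/

open Relation

theorem steps_countBack {w : List Bool} {h : ℕ} (hh : h ≤ w.length + 1) {a r : List (Sym M.Δ)}
    {g : Sym M.Δ} (hl : counterTape h = a ++ g :: r) :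
    ReflTransGen (M.toTM.Step w) (M.cfg .countBack h (a ++ g :: r) a.length [])
      (M.cfg .count h (counterTape h) 0 []) := by
  induction hn : a.length generalizing a g r with
  | zero =>
    obtain rfl := List.length_eq_zero_iff.1 hn
    obtain ⟨-, rfl⟩ | ⟨h', -⟩ := split_cons_cases hl
    · refine .single ((M.step_mid (a := [])).2 ⟨_, rfl, ?_⟩)
      rw [hl]
      simp [HeadMove.apply, hh]
    · simp at h'
  | succ n ih =>
    obtain ⟨rfl, -⟩ | ⟨ha, b, -, rfl⟩ := split_cons_cases hl
    · simp at hn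
    · obtain ⟨a', g', e, ha'⟩ := M.exists_step_left (r := r) (g := .bit b) ha
      rw [← hn]
      refine .head (M.step_mid.2 ⟨_, rfl, rfl⟩) ?_
      have hn' : a'.length = n := by rw [← ha', hn]; rfl
      have := ih (hl.trans e) hn'
      dsimp only
      rw [e, ha', hn']
      simpa [HeadMove.apply, hh] using this

theorem steps_incr {w : List Bool} {h j : ℕ} {r : List Bool}
    (hh : h ≤ w.length) (hb : h.bits = List.replicate j true ++ r) :
    ReflTransGen (M.toTM.Step w) (M.cfg .incr (h + 1)
      ((.mark :: List.replicate j (.bit false)) ++ r.map .bit) (j + 1) [])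
      (M.cfg .count (h + 1) (counterTape (h + 1)) 0 []) := by
  have hmin : min (h + 1) (w.length + 1) = h + 1 := by omega
  have hback : ∀ (r' : List Bool), (h + 1).bits = List.replicate j false ++ true :: r' →
      ReflTransGen (M.toTM.Step w) (M.cfg .countBack (h + 1)
        ((.mark :: List.replicate j (.bit false)) ++ .bit true :: r'.map .bit) j [])
        (M.cfg .count (h + 1) (counterTape (h + 1)) 0 []) := by
    intro r' hr'
    obtain ⟨a', g', e, ha'⟩ := M.exists_step_left (r := r'.map .bit) (g := .bit true)
      (a := .mark :: List.replicate j (.bit false)) (by simp)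
    have : j = a'.length := by rw [← ha']; simp [HeadMove.apply]
    rw [e, this]
    refine steps_countBack (by omega) ?_
    rw [← e, counterTape, hr']
    simp
  induction r generalizing j with
  | nil =>
    have hl : j + 1 = ((.mark :: List.replicate j (.bit false) : List (Sym M.Δ))).length := by simp
    rw [hl, List.map_nil, List.append_nil]
    refine .head (M.step_end.2 ⟨_, rfl, rfl⟩) ?_
    have := hback [] (bits_succ_of_eq_replicate (by simpa using hb))
    simpa [HeadMove.apply, hmin] using this
  | cons b r ih =>
    have hl : j + 1 = ((.mark :: List.replicate j (.bit false) : List (Sym M.Δ))).length := by simp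
    rw [hl, List.map_cons]
    rcases b with _ | _
    · refine .head (M.step_mid.2 ⟨_, rfl, rfl⟩) ?_
      have := hback r (bits_succ_of_eq hb)
      simpa [HeadMove.apply, hmin] using this
    · refine .head (M.step_mid.2 ⟨_, rfl, rfl⟩) ?_
      -- The hypothesis `hback` mentions `j`, so it belongs to the induction hypothesis and has to
      -- be established anew for `j + 1`.
      have := ih (j := j + 1) (by rw [hb, List.replicate_succ']; simp) (by
        intro r' hr'
        obtain ⟨a', g', e, ha'⟩ := M.exists_step_left (r := r'.map .bit) (g := .bit true)
          (a := .mark :: List.replicate (j + 1) (.bit false)) (by simp)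
        have : j + 1 = a'.length := by rw [← ha']; simp [HeadMove.apply]
        rw [e, this]
        refine steps_countBack (by omega) ?_
        rw [← e, counterTape, hr']
        simp)
      rw [List.replicate_succ'] at this
      simpa [HeadMove.apply, hmin] using this

theorem reachable_count {w : List Bool} {h : ℕ} (hh : h ≤ w.length + 1) :
    M.toTM.Reachable w (M.cfg .count h (counterTape h) 0 []) := by
  induction h with
  | zero =>
    refine .single ((M.step_end (a := [])).2 ⟨_, rfl, ?_⟩)
    simp [HeadMove.apply, counterTape]
  | succ h ih =>
    refine (ih (by omega)).trans ?_
    have hn : inputSymbol w h ≠ .rightEnd := fun e => by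
      have := inputSymbol_rightEnd.1 e
      omega
    have hx : ((.incr, .right, .mark, .right, none) :
        Phase M.Q × HeadMove × Sym M.Δ × HeadMove × Option O) ∈
        M.micro .count (inputSymbol w h) .mark := by
      revert hn
      cases inputSymbol w h <;> intro hn
      · rfl
      · rfl
      · exact absurd rfl hn
    refine .head ((M.step_mid (a := [])).2 ⟨_, hx, rfl⟩) ?_
    have := steps_incr (M := M) (w := w) (h := h) (j := 0) (r := h.bits) (by omega) rfl
    have hmin : min (h + 1) (w.length + 1) = h + 1 := by omega
    simpa [HeadMove.apply, hmin] using this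

theorem steps_back {w : List Bool} {c : M.Cfg} (hh : c.inHead ≤ w.length + 1)
    {a r : List (Sym M.Δ)} {g : Sym M.Δ} (hl : wordTape c.word = a ++ g :: r) :
    ReflTransGen (M.toTM.Step w) (M.cfg (.back c.state) c.inHead (a ++ g :: r) a.length c.out)
      (M.homeCfg c) := by
  induction hn : a.length generalizing a g r with
  | zero =>
    obtain rfl := List.length_eq_zero_iff.1 hn
    obtain ⟨-, rfl⟩ | ⟨h', -⟩ := split_cons_cases hl
    · refine .single ((M.step_mid (a := [])).2 ⟨_, rfl, ?_⟩)
      rw [homeCfg, hl]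
      simp [HeadMove.apply, hh]
    · simp at h'
  | succ n ih =>
    obtain ⟨rfl, -⟩ | ⟨ha, b, -, rfl⟩ := split_cons_cases hl
    · simp at hn
    · obtain ⟨a', g', e, ha'⟩ := M.exists_step_left (r := r) (g := .data b) ha
      rw [← hn]
      refine .head (M.step_mid.2 ⟨_, rfl, rfl⟩) ?_
      have hn' : a'.length = n := by rw [← ha', hn]; rfl
      have := ih (hl.trans e) hn'
      dsimp only
      rw [e, ha', hn']
      simpa [HeadMove.apply, hh] using this

theorem steps_back_wordTape {w : List Bool} {c : M.Cfg} (hh : c.inHead ≤ w.length + 1) :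
    ReflTransGen (M.toTM.Step w)
      (M.cfg (.back c.state) c.inHead (wordTape c.word) c.word.length c.out) (M.homeCfg c) := by
  have hne : wordTape c.word ≠ [] := by simp [wordTape]
  have := steps_back hh (List.dropLast_append_getLast hne).symm
  rw [List.dropLast_append_getLast hne, List.length_dropLast] at this
  simpa [wordTape] using this

theorem reachable_homeCfg_initial (w : List Bool) :
    M.toTM.Reachable w (M.homeCfg (M.initial w)) := by
  have key : ∀ r a : List Bool, (w.length + 1).bits = a ++ r →
      ReflTransGen (M.toTM.Step w) (M.cfg .conv (w.length + 1)
        ((.mark :: List.replicate a.length (.data M.pad)) ++ r.map .bit) (a.length + 1) [])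
        (M.homeCfg (M.initial w)) := by
    intro r
    induction r with
    | nil =>
      intro a hb
      have hl : a.length + 1 = ((.mark :: List.replicate a.length (.data M.pad) :
        List (Sym M.Δ))).length := by simp
      rw [hl, List.map_nil, List.append_nil]
      refine .head (M.step_end.2 ⟨_, rfl, rfl⟩) ?_
      have hwl : wordLength w = a.length := by
        rw [wordLength, ← Nat.size_eq_bits_len, hb, List.append_nil]
      have hw : wordTape (M.initial w).word = .mark :: List.replicate a.length (.data M.pad) := by
        simp [wordTape, initial, hwl]
      have := steps_back_wordTape (c := M.initial w) (w := w) le_rfl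
      dsimp only
      rw [cfg_snoc_blank, ← hw]
      simpa [HeadMove.apply, initial, wordTape] using this
    | cons b r ih =>
      intro a hb
      have hl : a.length + 1 = ((.mark :: List.replicate a.length (.data M.pad) :
        List (Sym M.Δ))).length := by simp
      have := ih (a ++ [b]) (by simpa using hb)
      rw [hl, List.map_cons]
      refine .head (M.step_mid.2 ⟨_, rfl, rfl⟩) ?_
      rw [List.length_append, List.length_singleton, List.replicate_succ'] at this
      simpa [HeadMove.apply] using this
  refine (reachable_count le_rfl).trans (.head ((M.step_mid (a := [])).2
    ⟨(.conv, .stay, .mark, .right, none), ?_, rfl⟩) ?_)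
  · rw [inputSymbol_rightEnd.2 (Nat.lt_succ_self _)]
    rfl
  · simpa [HeadMove.apply] using key (w.length + 1).bits [] rfl

theorem steps_scan {w : List Bool} {h : ℕ} (hh : h ≤ w.length + 1) {q q' : M.Q}
    {r r' : List M.Δ} (hs : Scan M.scan q r q' r') (a : List M.Δ) (out : List O) :
    ReflTransGen (M.toTM.Step w)
      (M.cfg (.scan q) h (wordTape a ++ r.map .data) (a.length + 1) out)
      (M.cfg (.back q') h (wordTape (a ++ r')) (a ++ r').length out) := by
  induction hs generalizing a with
  | nil q =>
    have hl : a.length + 1 = (wordTape a).length := by simp [wordTape]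
    rw [hl, List.map_nil, List.append_nil]
    refine .single (M.step_end.2 ⟨_, rfl, ?_⟩)
    rw [cfg_snoc_blank, List.append_nil]
    simp [HeadMove.apply, hh, wordTape]
  | @cons s s₁ s₂ d d₁ v v₂ hd _ ih =>
    have hl : a.length + 1 = (wordTape a).length := by simp [wordTape]
    rw [hl, List.map_cons]
    refine .head (M.step_mid.2 ⟨_, ⟨_, hd, rfl⟩, rfl⟩) ?_
    have := ih (a ++ [d₁])
    simpa [HeadMove.apply, hh, wordTape] using this

/-- A macro step is played as one action on the mark, a rewriting pass to the right up to the first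
blank, and a return to the mark. -/
theorem reachable_homeCfg {w : List Bool} {c : M.Cfg} (h : M.Reachable w c) :
    M.toTM.Reachable w (M.homeCfg c) := by
  induction h with
  | refl => exact reachable_homeCfg_initial w
  | @tail c c' hc hs ih =>
    have hb : c'.inHead ≤ w.length + 1 := (Reachable.bounds (hc.tail hs)).1
    obtain ⟨q, m, o, ha, hs, hh, ho⟩ := hs
    refine ih.trans (.head ((M.step_mid (a := [])).2 ⟨_, ⟨_, ha, rfl⟩, rfl⟩) ?_)
    refine .trans ?_ (steps_back_wordTape hb)
    have := steps_scan hb hs [] c'.out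
    rw [hh, ho] at this ⊢
    simpa [HeadMove.apply, wordTape] using this

theorem accepts_iff {w : List Bool} :
    M.toTM.Accepts w ↔ ∃ c, M.Reachable w c ∧ c.state = M.accept := by
  refine ⟨exists_reachable_of_accepts, ?_⟩
  rintro ⟨c, hc, ha⟩
  exact ⟨_, reachable_homeCfg hc, congrArg Phase.home ha⟩

theorem not_step_homeCfg {w : List Bool} {c : M.Cfg} (h : ∀ a, M.act c.state a = ∅) :
    ¬ ∃ c', M.toTM.Step w (M.homeCfg c) c' := by
  rintro ⟨c', hs⟩
  obtain ⟨x, ⟨y, hy, -⟩, -⟩ := (M.step_mid (a := [])).1 hs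
  rw [h] at hy
  exact hy

end SweepMachine

/-! ### Structured programs -/

/-- A primitive command: one action followed by one pass over the word, with a Boolean result. -/
structure Prim (S Δ O : Type) where
  start : InputSymbol → Set (S × HeadMove × Option O)
  scan : S → Δ → Set (S × Δ)
  res : S → Bool

/-- Structured programs over primitive commands. -/
inductive Cmd (S Δ O : Type) : Type
  | skip : Cmd S Δ O
  | seq : Cmd S Δ O → Cmd S Δ O → Cmd S Δ O
  | ite : Prim S Δ O → Cmd S Δ O → Cmd S Δ O → Cmd S Δ O
  | loop : Prim S Δ O → Cmd S Δ O → Cmd S Δ O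

/-- The states on which programs operate. -/
structure Store (Δ O : Type) where
  pos : ℕ
  word : List Δ
  out : List O

/-- The effect of a primitive command. -/
def Prim.Rel {S Δ O : Type} (w : List Bool) (a : Prim S Δ O) (s : Store Δ O) (b : Bool)
    (s' : Store Δ O) : Prop :=
  ∃ q m o q', (q, m, o) ∈ a.start (inputSymbol w s.pos) ∧ Scan a.scan q s.word q' s'.word ∧
    s'.pos = min (HeadMove.apply m s.pos) (w.length + 1) ∧ s'.out = s.out ++ o.toList ∧
    a.res q' = b

/-- Deterministic primitive commands. -/
def Prim.Det {S Δ O : Type} (a : Prim S Δ O) : Prop :=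
  (∀ x, (a.start x).Subsingleton) ∧ ∀ q d, (a.scan q d).Subsingleton

namespace Cmd

variable {S Δ O : Type}

/-- Natural semantics. -/
inductive Exec (w : List Bool) : Cmd S Δ O → Store Δ O → Store Δ O → Prop
  | skip (s : Store Δ O) : Exec w .skip s s
  | seq {p q : Cmd S Δ O} {s s₁ s₂ : Store Δ O} :
      Exec w p s s₁ → Exec w q s₁ s₂ → Exec w (.seq p q) s s₂
  | iteTrue {a : Prim S Δ O} {p q : Cmd S Δ O} {s s₁ s₂ : Store Δ O} :
      a.Rel w s true s₁ → Exec w p s₁ s₂ → Exec w (.ite a p q) s s₂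
  | iteFalse {a : Prim S Δ O} {p q : Cmd S Δ O} {s s₁ s₂ : Store Δ O} :
      a.Rel w s false s₁ → Exec w q s₁ s₂ → Exec w (.ite a p q) s s₂
  | loopTrue {a : Prim S Δ O} {p : Cmd S Δ O} {s s₁ s₂ s₃ : Store Δ O} :
      a.Rel w s true s₁ → Exec w p s₁ s₂ → Exec w (.loop a p) s₂ s₃ → Exec w (.loop a p) s s₃
  | loopFalse {a : Prim S Δ O} {p : Cmd S Δ O} {s s₁ : Store Δ O} :
      a.Rel w s false s₁ → Exec w (.loop a p) s s₁

/-- Programs with deterministic primitive commands. -/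
def Det : Cmd S Δ O → Prop
  | .skip => True
  | .seq p q => p.Det ∧ q.Det
  | .ite a p q => a.Det ∧ p.Det ∧ q.Det
  | .loop a p => a.Det ∧ p.Det

/-- Control states: a stack of programs to be executed, and the state of a pass of the primitive
command on top of the stack, if there is one under way. -/
abbrev Control (S Δ O : Type) : Type := List (Cmd S Δ O) × Option S

/-- The control stacks that occur in the execution of a program on top of the stack `K`. -/
def ctlStacks : Cmd S Δ O → List (Cmd S Δ O) → Set (List (Cmd S Δ O))
  | .skip, K => {.skip :: K}
  | .seq p q, K => {.seq p q :: K} ∪ (p.ctlStacks (q :: K) ∪ q.ctlStacks K)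
  | .ite a p q, K => {.ite a p q :: K} ∪ (p.ctlStacks K ∪ q.ctlStacks K)
  | .loop a p, K => {.loop a p :: K} ∪ p.ctlStacks (.loop a p :: K)

/-- A loop places itself below its body rather than growing the stack at each round, so the stacks
are indexed by program points. This makes the control of the machine finite. -/
theorem finite_ctlStacks (p : Cmd S Δ O) (K : List (Cmd S Δ O)) : (p.ctlStacks K).Finite := by
  induction p generalizing K with
  | skip => exact Set.finite_singleton _
  | seq p q ihp ihq => exact (Set.finite_singleton _).union ((ihp _).union (ihq _))
  | ite a p q ihp ihq => exact (Set.finite_singleton _).union ((ihp _).union (ihq _))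
  | loop a p ih => exact (Set.finite_singleton _).union (ih _)

theorem cons_mem_ctlStacks (p : Cmd S Δ O) (K : List (Cmd S Δ O)) : p :: K ∈ p.ctlStacks K := by
  cases p <;> simp [ctlStacks]

/-- The actions of the machine that executes programs. -/
def act : Control S Δ O → InputSymbol → Set (Control S Δ O × HeadMove × Option O)
  | ([], _), _ => ∅
  | (.skip :: K, _), _ => {((K, none), .stay, none)}
  | (.seq p q :: K, _), _ => {((p :: q :: K, none), .stay, none)}
  | (.ite a p q :: K, none), x =>
    {y | ∃ z ∈ a.start x, y = ((.ite a p q :: K, some z.1), z.2.1, z.2.2)}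
  | (.ite a p q :: K, some s), _ => {((cond (a.res s) p q :: K, none), .stay, none)}
  | (.loop a p :: K, none), x =>
    {y | ∃ z ∈ a.start x, y = ((.loop a p :: K, some z.1), z.2.1, z.2.2)}
  | (.loop a p :: K, some s), _ =>
    {((cond (a.res s) (p :: .loop a p :: K) K, none), .stay, none)}

/-- The passes of the machine that executes programs. -/
def scan : Control S Δ O → Δ → Set (Control S Δ O × Δ)
  | (K, none), d => {((K, none), d)}
  | (.ite a p q :: K, some s), d =>
    {y | ∃ z ∈ a.scan s d, y = ((.ite a p q :: K, some z.1), z.2)}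
  | (.loop a p :: K, some s), d =>
    {y | ∃ z ∈ a.scan s d, y = ((.loop a p :: K, some z.1), z.2)}
  | (_, some _), _ => ∅

/-- A subprogram either stays among its own stacks or has been popped. What remains then is the top
of a stack of the enclosing program: the second part of a sequence, or the loop itself. -/
theorem stack_mem_of_act {p : Cmd S Δ O} {K : List (Cmd S Δ O)} {X Y : Control S Δ O}
    {x : InputSymbol} {m : HeadMove} {o : Option O} (hX : X.1 ∈ p.ctlStacks K)
    (h : (Y, m, o) ∈ act X x) : Y.1 = K ∨ Y.1 ∈ p.ctlStacks K := by
  induction p generalizing K with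
  | skip =>
    obtain ⟨X, s⟩ := X
    obtain rfl := Set.mem_singleton_iff.1 hX
    simp only [act, Set.mem_singleton_iff, Prod.mk.injEq] at h
    exact .inl (by rw [h.1])
  | seq p q ihp ihq =>
    rcases hX with hX | hX | hX
    · obtain ⟨X, s⟩ := X
      obtain rfl := Set.mem_singleton_iff.1 hX
      simp only [act, Set.mem_singleton_iff, Prod.mk.injEq] at h
      rw [h.1]
      exact .inr (.inr (.inl (cons_mem_ctlStacks _ _)))
    · rcases ihp hX with h | h
      · rw [h]
        exact .inr (.inr (.inr (cons_mem_ctlStacks _ _)))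
      · exact .inr (.inr (.inl h))
    · rcases ihq hX with h | h
      · exact .inl h
      · exact .inr (.inr (.inr h))
  | ite a p q ihp ihq =>
    rcases hX with hX | hX | hX
    · obtain ⟨X, s⟩ := X
      obtain rfl := Set.mem_singleton_iff.1 hX
      rcases s with _ | s
      · obtain ⟨z, -, hz⟩ := h
        simp only [Prod.mk.injEq] at hz
        rw [hz.1]
        exact .inr (.inl rfl)
      · simp only [act, Set.mem_singleton_iff, Prod.mk.injEq] at h
        rw [h.1]
        cases a.res s
        · exact .inr (.inr (.inr (cons_mem_ctlStacks _ _)))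
        · exact .inr (.inr (.inl (cons_mem_ctlStacks _ _)))
    · rcases ihp hX with h | h
      · exact .inl h
      · exact .inr (.inr (.inl h))
    · rcases ihq hX with h | h
      · exact .inl h
      · exact .inr (.inr (.inr h))
  | loop a p ih =>
    rcases hX with hX | hX
    · obtain ⟨X, s⟩ := X
      obtain rfl := Set.mem_singleton_iff.1 hX
      rcases s with _ | s
      · obtain ⟨z, -, hz⟩ := h
        simp only [Prod.mk.injEq] at hz
        rw [hz.1]
        exact .inr (.inl rfl)
      · simp only [act, Set.mem_singleton_iff, Prod.mk.injEq] at h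
        rw [h.1]
        cases a.res s
        · exact .inl rfl
        · exact .inr (.inr (cons_mem_ctlStacks _ _))
    · rcases ih hX with h | h
      · rw [h]
        exact .inr (.inl rfl)
      · exact .inr (.inr h)

theorem stack_eq_of_scan {X Y : Control S Δ O} {d d' : Δ} (h : (Y, d') ∈ scan X d) :
    Y.1 = X.1 := by
  obtain ⟨K, s⟩ := X
  rcases s with _ | s
  · simp only [scan, Set.mem_singleton_iff, Prod.mk.injEq] at h
    rw [h.1]
  · rcases K with _ | ⟨_ | _ | _ | _, K⟩
    case nil => exact absurd h (Set.notMem_empty _)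
    case cons.skip => exact absurd h (Set.notMem_empty _)
    case cons.seq => exact absurd h (Set.notMem_empty _)
    all_goals
      obtain ⟨z, -, hz⟩ := h
      simp only [Prod.mk.injEq] at hz
      rw [hz.1]

theorem act_subsingleton {X : Control S Δ O} (hX : ∀ r ∈ X.1, r.Det) (x : InputSymbol) :
    (act X x).Subsingleton := by
  intro y hy z hz
  obtain ⟨_ | ⟨_ | _ | ⟨a, p, q⟩ | ⟨a, p⟩, K⟩, s⟩ := X
  case nil => exact absurd hy (Set.notMem_empty _)
  case cons.skip => exact (Set.mem_singleton_iff.1 hy).trans (Set.mem_singleton_iff.1 hz).symm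
  case cons.seq => exact (Set.mem_singleton_iff.1 hy).trans (Set.mem_singleton_iff.1 hz).symm
  all_goals
    rcases s with _ | s
    · obtain ⟨y', hy', hy⟩ := hy
      obtain ⟨z', hz', hz⟩ := hz
      rw [hy, hz, (hX _ (List.mem_cons_self ..)).1.1 _ hy' hz']
    · exact (Set.mem_singleton_iff.1 hy).trans (Set.mem_singleton_iff.1 hz).symm

theorem scan_subsingleton {X : Control S Δ O} (hX : ∀ r ∈ X.1, r.Det) (d : Δ) :
    (scan X d).Subsingleton := by
  intro y hy z hz
  obtain ⟨K, _ | s⟩ := X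
  · exact (Set.mem_singleton_iff.1 hy).trans (Set.mem_singleton_iff.1 hz).symm
  rcases K with _ | ⟨_ | _ | ⟨a, p, q⟩ | ⟨a, p⟩, K⟩
  case nil => exact absurd hy (Set.notMem_empty _)
  case cons.skip => exact absurd hy (Set.notMem_empty _)
  case cons.seq => exact absurd hy (Set.notMem_empty _)
  all_goals
    obtain ⟨y', hy', hy⟩ := hy
    obtain ⟨z', hz', hz⟩ := hz
    rw [hy, hz, (hX _ (List.mem_cons_self ..)).1.2 _ _ hy' hz']

/-! ### Compilation of structured programs to sweeping machines -/

/-- The control stacks of the machine that executes `p`. -/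
abbrev Stacks (p : Cmd S Δ O) : Type := {K : List (Cmd S Δ O) // K = [] ∨ K ∈ p.ctlStacks []}

/-- The sweeping machine that executes a program. -/
def machine [hS : Finite S] [hΔ : Finite Δ] (p : Cmd S Δ O) (pad : Δ) : SweepMachine O where
  Q := p.Stacks × Option S
  Δ := Δ
  finiteQ := by
    have : Finite p.Stacks := ((Set.finite_singleton []).union (p.finite_ctlStacks [])).to_subtype
    infer_instance
  finiteΔ := hΔ
  start := (⟨[p], .inr (p.cons_mem_ctlStacks [])⟩, none)
  accept := (⟨[], .inl rfl⟩, none)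
  pad := pad
  act := fun X x => {y | ((y.1.1.1, y.1.2), y.2) ∈ act (X.1.1, X.2) x}
  scan := fun X d => {y | ((y.1.1.1, y.1.2), y.2) ∈ scan (X.1.1, X.2) d}

theorem machine_deterministic [Finite S] [Finite Δ] {p : Cmd S Δ O} (pad : Δ) (h : p.Det) :
    (p.machine pad).Deterministic := by
  have hdet : ∀ (q : Cmd S Δ O), q.Det → ∀ K : List (Cmd S Δ O), (∀ r ∈ K, r.Det) →
      ∀ K' ∈ q.ctlStacks K, ∀ r ∈ K', r.Det := by
    intro q
    induction q with
    | skip =>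
      rintro hq K hK K' rfl r (_ | ⟨_, hr⟩)
      exacts [hq, hK _ hr]
    | seq p q ihp ihq =>
      rintro hq K hK K' (rfl | h | h) r hr
      · rcases hr with _ | ⟨_, hr⟩
        exacts [hq, hK _ hr]
      · refine ihp hq.1 _ ?_ _ h _ hr
        rintro r (_ | ⟨_, hr⟩)
        exacts [hq.2, hK _ hr]
      · exact ihq hq.2 _ hK _ h _ hr
    | ite a p q ihp ihq =>
      rintro hq K hK K' (rfl | h | h) r hr
      · rcases hr with _ | ⟨_, hr⟩
        exacts [hq, hK _ hr]
      · exact ihp hq.2.1 _ hK _ h _ hr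
      · exact ihq hq.2.2 _ hK _ h _ hr
    | loop a p ih =>
      rintro hq K hK K' (rfl | h) r hr
      · rcases hr with _ | ⟨_, hr⟩
        exacts [hq, hK _ hr]
      · refine ih hq.2 _ ?_ _ h _ hr
        rintro r (_ | ⟨_, hr⟩)
        exacts [hq, hK _ hr]
  have hdet' : ∀ K : p.Stacks, ∀ r ∈ K.1, r.Det := by
    rintro ⟨K, rfl | hK⟩ r hr
    · exact absurd hr List.not_mem_nil
    · exact hdet p h [] (fun r hr => absurd hr List.not_mem_nil) K hK r hr
  constructor
  · rintro ⟨K, s⟩ x ⟨⟨⟨y1, _⟩, y2⟩, y3⟩ hy ⟨⟨⟨z1, _⟩, z2⟩, z3⟩ hz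
    have e := act_subsingleton (X := (K.1, s)) (hdet' K) x hy hz
    simp only [Prod.mk.injEq] at e
    obtain ⟨⟨rfl, rfl⟩, rfl⟩ := e
    rfl
  · rintro ⟨K, s⟩ d ⟨⟨⟨y1, _⟩, y2⟩, y3⟩ hy ⟨⟨⟨z1, _⟩, z2⟩, z3⟩ hz
    have e := scan_subsingleton (X := (K.1, s)) (hdet' K) d hy hz
    simp only at e
    obtain ⟨⟨rfl, rfl⟩, rfl⟩ := e
    rfl

/-- The macro steps at the level of control stacks. -/
def CStep (w : List Bool) (c c' : Control S Δ O × Store Δ O) : Prop :=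
  ∃ q m o, (q, m, o) ∈ act c.1 (inputSymbol w c.2.pos) ∧ Scan scan q c.2.word c'.1 c'.2.word ∧
    c'.2.pos = min (HeadMove.apply m c.2.pos) (w.length + 1) ∧ c'.2.out = c.2.out ++ o.toList

theorem scan_none {K : List (Cmd S Δ O)} {X : Control S Δ O} {v v' : List Δ} :
    Scan scan (K, none) v X v' ↔ X = (K, none) ∧ v' = v := by
  constructor
  · intro h
    induction v generalizing v' with
    | nil => cases h; exact ⟨rfl, rfl⟩
    | cons d v ih =>
      cases h with
      | cons h1 h2 =>
        simp only [scan, Set.mem_singleton_iff, Prod.mk.injEq] at h1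
        obtain ⟨rfl, rfl⟩ := h1
        obtain ⟨rfl, rfl⟩ := ih h2
        exact ⟨rfl, rfl⟩
  · rintro ⟨rfl, rfl⟩
    induction v' with
    | nil => exact .nil _
    | cons d v ih => exact .cons rfl ih

theorem scan_some {K : List (Cmd S Δ O)} {a : Prim S Δ O} {s : S}
    (ha : ∀ s d, scan (K, some s) d = {y | ∃ z ∈ a.scan s d, y = ((K, some z.1), z.2)})
    {X : Control S Δ O} {v v' : List Δ} :
    Scan scan (K, some s) v X v' ↔ ∃ s', X = (K, some s') ∧ Scan a.scan s v s' v' := by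
  constructor
  · intro h
    induction v generalizing v' s with
    | nil => cases h; exact ⟨s, rfl, .nil _⟩
    | cons d v ih =>
      cases h with
      | cons h1 h2 =>
        rw [ha] at h1
        obtain ⟨z, hz, h1⟩ := h1
        simp only [Prod.mk.injEq] at h1
        obtain ⟨rfl, rfl⟩ := h1
        obtain ⟨s', rfl, h3⟩ := ih h2
        exact ⟨s', rfl, .cons hz h3⟩
  · rintro ⟨s', rfl, h⟩
    induction h with
    | nil => exact .nil _
    | cons h1 _ ih => exact .cons (by rw [ha]; exact ⟨_, h1, rfl⟩) ih

/-- The bound on the position is essential: each move clips the head to the right end marker, so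
staying is the identity only for positions within the tape. -/
theorem cstep_of_silent {w : List Bool} {X : Control S Δ O} {K : List (Cmd S Δ O)}
    (hX : ∀ x, act X x = {((K, none), .stay, none)}) {s : Store Δ O} (hs : s.pos ≤ w.length + 1)
    {c : Control S Δ O × Store Δ O} : CStep w (X, s) c ↔ c = ((K, none), s) := by
  constructor
  · rintro ⟨q, m, o, h, hsc, hp, ho⟩
    rw [hX] at h
    simp only [Set.mem_singleton_iff, Prod.mk.injEq] at h
    obtain ⟨rfl, rfl, rfl⟩ := h
    obtain ⟨h1, h2⟩ := scan_none.1 hsc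
    obtain ⟨Y, ⟨p, v, o⟩⟩ := c
    obtain ⟨p', v', o'⟩ := s
    simp_all [HeadMove.apply]
  · rintro rfl
    refine ⟨_, _, _, by rw [hX]; rfl, scan_none.2 ⟨rfl, rfl⟩, ?_, ?_⟩
    · simp [HeadMove.apply, hs]
    · simp

theorem cstep_of_prim {w : List Bool} {K : List (Cmd S Δ O)} {a : Prim S Δ O}
    (h1 : ∀ x, act (K, none) x = {y | ∃ z ∈ a.start x, y = ((K, some z.1), z.2.1, z.2.2)})
    (h2 : ∀ s d, scan (K, some s) d = {y | ∃ z ∈ a.scan s d, y = ((K, some z.1), z.2)})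
    {s : Store Δ O} {c : Control S Δ O × Store Δ O} :
    CStep w ((K, none), s) c ↔ ∃ q, c.1 = (K, some q) ∧ ∃ q₀ m o,
      (q₀, m, o) ∈ a.start (inputSymbol w s.pos) ∧ Scan a.scan q₀ s.word q c.2.word ∧
      c.2.pos = min (HeadMove.apply m s.pos) (w.length + 1) ∧ c.2.out = s.out ++ o.toList := by
  constructor
  · rintro ⟨q, m, o, h, hsc, hp, ho⟩
    rw [h1] at h
    obtain ⟨⟨q₀, m', o'⟩, hz, h⟩ := h
    simp only [Prod.mk.injEq] at h
    obtain ⟨rfl, rfl, rfl⟩ := h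
    obtain ⟨s', hc, h3⟩ := (scan_some h2).1 hsc
    exact ⟨s', hc, q₀, m, o, hz, h3, hp, ho⟩
  · rintro ⟨q, hc, q₀, m, o, hz, h3, hp, ho⟩
    refine ⟨(K, some q₀), m, o, ?_, (scan_some h2).2 ⟨q, hc, h3⟩, hp, ho⟩
    rw [h1]
    exact ⟨_, hz, rfl⟩

open Relation

theorem Exec.pos_le {w : List Bool} {p : Cmd S Δ O} {s s' : Store Δ O} (h : Exec w p s s')
    (hs : s.pos ≤ w.length + 1) : s'.pos ≤ w.length + 1 := by
  have hrel : ∀ {a : Prim S Δ O} {s s' : Store Δ O} {b : Bool}, a.Rel w s b s' →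
      s'.pos ≤ w.length + 1 := by
    rintro a s s' b ⟨q, m, o, q', -, -, hp, -⟩
    exact hp ▸ min_le_right _ _
  induction h with
  | skip => exact hs
  | seq _ _ ih1 ih2 => exact ih2 (ih1 hs)
  | iteTrue h _ ih => exact ih (hrel h)
  | iteFalse h _ ih => exact ih (hrel h)
  | loopTrue h _ _ ih1 ih2 => exact ih2 (ih1 (hrel h))
  | loopFalse h => exact hrel h

theorem steps_of_exec {w : List Bool} {p : Cmd S Δ O} {s s' : Store Δ O} (h : Exec w p s s')
    (hs : s.pos ≤ w.length + 1) (K : List (Cmd S Δ O)) :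
    ReflTransGen (CStep w) ((p :: K, none), s) ((K, none), s') := by
  have hrel : ∀ {a : Prim S Δ O} {s s' : Store Δ O} {b : Bool}, a.Rel w s b s' →
      s'.pos ≤ w.length + 1 := by
    rintro a s s' b ⟨q, m, o, q', -, -, hp, -⟩
    exact hp ▸ min_le_right _ _
  -- A primitive command takes two macro steps: the pass itself, which leaves its final state in the
  -- control, and a silent step that branches on its result.
  have hprim : ∀ {K K' : List (Cmd S Δ O)} {a : Prim S Δ O} {b : Bool} {s s' : Store Δ O},
      (∀ x, act (K, none) x = {y | ∃ z ∈ a.start x, y = ((K, some z.1), z.2.1, z.2.2)}) →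
      (∀ s d, scan (K, some s) d = {y | ∃ z ∈ a.scan s d, y = ((K, some z.1), z.2)}) →
      (∀ q, a.res q = b → ∀ x, act (K, some q) x = {((K', none), .stay, none)}) →
      a.Rel w s b s' → ReflTransGen (CStep w) ((K, none), s) ((K', none), s') := by
    intro K K' a b s s' h1 h2 h3 hr
    have hp := hrel hr
    obtain ⟨q₀, m, o, q, ha, hsc, hp', ho, hb⟩ := hr
    refine .head (b := ((K, some q), s')) ((cstep_of_prim h1 h2).2
      ⟨q, rfl, q₀, m, o, ha, hsc, hp', ho⟩) ?_
    exact .single ((cstep_of_silent (h3 q hb) hp).2 rfl)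
  induction h generalizing K with
  | skip => exact .single ((cstep_of_silent (fun _ => rfl) hs).2 rfl)
  | seq h1 h2 ih1 ih2 =>
    exact .head ((cstep_of_silent (fun _ => rfl) hs).2 rfl)
      ((ih1 hs _).trans (ih2 (h1.pos_le hs) _))
  | @iteTrue a p q _ _ _ h _ ih =>
    refine (hprim (K' := p :: K) (fun _ => rfl) (fun _ _ => rfl) (fun r hr x => ?_) h).trans
      (ih (hrel h) K)
    simp [act, hr]
  | @iteFalse a p q _ _ _ h _ ih =>
    refine (hprim (K' := q :: K) (fun _ => rfl) (fun _ _ => rfl) (fun r hr x => ?_) h).trans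
      (ih (hrel h) K)
    simp [act, hr]
  | @loopTrue a p _ _ _ _ h h1 h2 ih1 ih2 =>
    refine (hprim (K' := p :: .loop a p :: K) (fun _ => rfl) (fun _ _ => rfl)
      (fun r hr x => ?_) h).trans ((ih1 (hrel h) _).trans (ih2 (h1.pos_le (hrel h)) K))
    simp [act, hr]
  | @loopFalse a p _ _ h =>
    refine hprim (K' := K) (fun _ => rfl) (fun _ _ => rfl) (fun r hr x => ?_) h
    simp [act, hr]

/-- Natural semantics of a control stack. -/
def ExecStack (w : List Bool) : List (Cmd S Δ O) → Store Δ O → Store Δ O → Prop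
  | [], s, s' => s' = s
  | p :: K, s, s' => ∃ s₁, Exec w p s s₁ ∧ ExecStack w K s₁ s'

/-- Natural semantics of a control state. -/
def ExecControl (w : List Bool) : Control S Δ O → Store Δ O → Store Δ O → Prop
  | (K, none), s, s' => ExecStack w K s s'
  | (.ite a p q :: K, some r), s, s' => ExecStack w (cond (a.res r) p q :: K) s s'
  | (.loop a p :: K, some r), s, s' =>
    ExecStack w (cond (a.res r) (p :: .loop a p :: K) K) s s'
  | (.skip :: K, some _), s, s' => ExecStack w K s s'
  | (.seq p q :: K, some _), s, s' => ExecStack w (p :: q :: K) s s'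
  | ([], some _), _, _ => False

/-- Executions are prolonged backwards over a step. Reading an accepting computation from its end
thus yields a derivation in the natural semantics without any induction over loops. -/
theorem execControl_of_cstep {w : List Bool} {c c' : Control S Δ O × Store Δ O} {s : Store Δ O}
    (hc : c.2.pos ≤ w.length + 1) (h : CStep w c c') (h' : ExecControl w c'.1 c'.2 s) :
    ExecControl w c.1 c.2 s := by
  obtain ⟨⟨K, r⟩, t⟩ := c
  rcases K with _ | ⟨_ | ⟨p, q⟩ | ⟨a, p, q⟩ | ⟨a, p⟩, K⟩
  · obtain ⟨q, m, o, h, -⟩ := h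
    exact absurd h (Set.notMem_empty _)
  · obtain rfl := (cstep_of_silent (fun _ => rfl) hc).1 h
    rcases r with _ | r
    · exact ⟨t, .skip t, h'⟩
    · exact h'
  · obtain rfl := (cstep_of_silent (fun _ => rfl) hc).1 h
    rcases r with _ | r
    · obtain ⟨s₁, h1, s₂, h2, h3⟩ := h'
      exact ⟨s₂, .seq h1 h2, h3⟩
    · exact h'
  · rcases r with _ | r
    · obtain ⟨r, hr, q₀, m, o, h1, h2, h3, h4⟩ :=
        (cstep_of_prim (fun _ => rfl) (fun _ _ => rfl)).1 h
      obtain ⟨c1, c2⟩ := c'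
      simp only at hr
      subst hr
      have hrel : a.Rel w t (a.res r) c2 := ⟨q₀, m, o, r, h1, h2, h3, h4, rfl⟩
      simp only [ExecControl] at h'
      cases hb : a.res r <;> rw [hb] at h' hrel <;> obtain ⟨s₁, h5, h6⟩ := h'
      · exact ⟨s₁, .iteFalse hrel h5, h6⟩
      · exact ⟨s₁, .iteTrue hrel h5, h6⟩
    · obtain rfl := (cstep_of_silent (fun _ => rfl) hc).1 h
      exact h'
  · rcases r with _ | r
    · obtain ⟨r, hr, q₀, m, o, h1, h2, h3, h4⟩ :=
        (cstep_of_prim (fun _ => rfl) (fun _ _ => rfl)).1 h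
      obtain ⟨c1, c2⟩ := c'
      simp only at hr
      subst hr
      have hrel : a.Rel w t (a.res r) c2 := ⟨q₀, m, o, r, h1, h2, h3, h4, rfl⟩
      simp only [ExecControl] at h'
      cases hb : a.res r <;> rw [hb] at h' hrel
      · exact ⟨c2, .loopFalse hrel, h'⟩
      · obtain ⟨s₁, h5, s₂, h6, h7⟩ := h'
        exact ⟨s₂, .loopTrue hrel h5 h6, h7⟩
    · obtain rfl := (cstep_of_silent (fun _ => rfl) hc).1 h
      exact h'

theorem cstep_stack {w : List Bool} {p : Cmd S Δ O} {X : Control S Δ O} {s s' : Store Δ O}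
    {Y : Control S Δ O} (hX : X.1 = [] ∨ X.1 ∈ p.ctlStacks []) (h : CStep w (X, s) (Y, s')) :
    Y.1 = [] ∨ Y.1 ∈ p.ctlStacks [] := by
  obtain ⟨q, m, o, h1, h2, -⟩ := h
  have hq : q.1 = [] ∨ q.1 ∈ p.ctlStacks [] := by
    obtain ⟨K, r⟩ := X
    rcases hX with hX | hX
    · simp only at hX
      subst hX
      exact absurd h1 (Set.notMem_empty _)
    · exact stack_mem_of_act hX h1
  have hY : ∀ {q Y : Control S Δ O} {v v'}, Scan scan q v Y v' → Y.1 = q.1 := by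
    intro q Y v v' h
    induction h with
    | nil => rfl
    | cons h1 _ ih => rw [ih, stack_eq_of_scan h1]
  rw [hY h2]
  exact hq

section Machine

variable [Finite S] [Finite Δ]

/-- The configuration of the machine with given control state. -/
def machineCfg (p : Cmd S Δ O) (pad : Δ) (X : p.Stacks × Option S) (s : Store Δ O) :
    (p.machine pad).Cfg := ⟨X, s.pos, s.word, s.out⟩

theorem step_machineCfg {w : List Bool} {p : Cmd S Δ O} {pad : Δ} {X X' : p.Stacks × Option S}
    {s s' : Store Δ O} : (p.machine pad).Step w (p.machineCfg pad X s) (p.machineCfg pad X' s') ↔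
      CStep w ((X.1.1, X.2), s) ((X'.1.1, X'.2), s') := by
  have hscan : ∀ {Y : p.Stacks × Option S} {v v' : List Δ},
      Scan (p.machine pad).scan Y v X' v' ↔ Scan scan (Y.1.1, Y.2) v (X'.1.1, X'.2) v' := by
    intro Y v v'
    constructor
    · intro h
      induction v generalizing Y v' with
      | nil => cases h; exact .nil _
      | cons d v ih =>
        cases h with
        | cons h1 h2 => exact .cons h1 (ih h2)
    · intro h
      induction v generalizing Y v' with
      | nil =>
        generalize hZ : (X'.1.1, X'.2) = Z at h
        cases h
        obtain ⟨⟨X1, _⟩, X2⟩ := X'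
        obtain ⟨⟨Y1, _⟩, Y2⟩ := Y
        simp only [Prod.mk.injEq] at hZ
        obtain ⟨rfl, rfl⟩ := hZ
        exact .nil _
      | cons d v ih =>
        cases h with
        | @cons _ Z _ _ d₁ _ v₂ h1 h2 =>
          have := stack_eq_of_scan h1
          -- A pass never changes the stack, so the intermediate stack inherits membership in the
          -- finite set of stacks from the first one.
          refine .cons (s₁ := ((⟨Z.1, this ▸ Y.1.2⟩, Z.2) : p.Stacks × Option S)) h1 (ih h2)
  constructor
  · rintro ⟨q, m, o, h1, h2, h3, h4⟩
    exact ⟨(q.1.1, q.2), m, o, h1, hscan.1 h2, h3, h4⟩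
  · rintro ⟨q, m, o, h1, h2, h3, h4⟩
    have hq : q.1 = [] ∨ q.1 ∈ p.ctlStacks [] := by
      rcases X with ⟨⟨K, rfl | hK⟩, r⟩
      · exact absurd h1 (Set.notMem_empty _)
      · exact stack_mem_of_act hK h1
    exact ⟨(⟨q.1, hq⟩, q.2), m, o, h1, hscan.2 h2, h3, h4⟩

/-- The initial store on input `w`. -/
def initStore (O : Type) (pad : Δ) (w : List Bool) : Store Δ O :=
  ⟨w.length + 1, List.replicate (wordLength w) pad, []⟩

theorem reachable_of_exec {w : List Bool} {p : Cmd S Δ O} {pad : Δ} {s : Store Δ O}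
    (h : Exec w p (initStore O pad w) s) :
    (p.machine pad).Reachable w (p.machineCfg pad (⟨[], .inl rfl⟩, none) s) := by
  have h := steps_of_exec h le_rfl []
  have key : ∀ c : Control S Δ O × Store Δ O,
      ReflTransGen (CStep w) (([p], none), initStore O pad w) c →
      ∃ hc : c.1.1 = [] ∨ c.1.1 ∈ p.ctlStacks [],
        (p.machine pad).Reachable w (p.machineCfg pad (⟨c.1.1, hc⟩, c.1.2) c.2) := by
    intro c hc
    induction hc with
    | refl => exact ⟨.inr (p.cons_mem_ctlStacks []), .refl⟩
    | @tail b c _ hs ih =>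
      obtain ⟨hb, ih⟩ := ih
      exact ⟨cstep_stack hb hs, ih.tail (step_machineCfg.2 hs)⟩
  exact (key _ h).2

theorem exec_of_reachable {w : List Bool} {p : Cmd S Δ O} {pad : Δ} {c : (p.machine pad).Cfg}
    (h : (p.machine pad).Reachable w c) (hc : c.state = (p.machine pad).accept) :
    ∃ s, Exec w p (initStore O pad w) s := by
  have key : ∀ d : (p.machine pad).Cfg, (p.machine pad).Reachable w d → ∀ s,
      ExecControl w (d.state.1.1, d.state.2) ⟨d.inHead, d.word, d.out⟩ s →
      Exec w p (initStore O pad w) s := by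
    intro d hd
    induction hd with
    | refl =>
      intro s hs
      obtain ⟨s₁, h1, h2⟩ := hs
      obtain rfl : s = s₁ := h2
      exact h1
    | @tail b d hb hs ih =>
      intro s hd
      refine ih s (execControl_of_cstep (c := ((b.state.1.1, b.state.2), ⟨b.inHead, b.word, b.out⟩))
        (c' := ((d.state.1.1, d.state.2), ⟨d.inHead, d.word, d.out⟩)) ?_ ?_ hd)
      · exact SweepMachine.Reachable.bounds (M := p.machine pad) hb |>.1
      · exact (step_machineCfg (p := p) (pad := pad) (X := b.state) (X' := d.state)
          (s := ⟨b.inHead, b.word, b.out⟩) (s' := ⟨d.inHead, d.word, d.out⟩)).1 hs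
  refine ⟨⟨c.inHead, c.word, c.out⟩, key c h _ ?_⟩
  rw [hc]
  exact rfl

end Machine

end Cmd

/-- Languages recognized by structured programs are in NL. -/
theorem mem_NL_of_cmd {S Δ : Type} [Finite S] [Finite Δ] (p : Cmd S Δ Empty) (pad : Δ)
    (A : Language Bool) (hA : ∀ w, w ∈ A ↔ ∃ s, p.Exec w (Cmd.initStore Empty pad w) s) :
    A ∈ NL := by
  refine ⟨(p.machine pad).toTM, SweepMachine.toTM_logSpace _, fun w => ?_⟩
  rw [hA, SweepMachine.accepts_iff]
  constructor
  · rintro ⟨s, hs⟩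
    exact ⟨_, Cmd.reachable_of_exec hs, rfl⟩
  · rintro ⟨c, hc, ha⟩
    exact Cmd.exec_of_reachable hc ha

/-- Functions computed by deterministic structured programs are computable in logarithmic space. -/
theorem logSpaceComputable_of_cmd {S Δ : Type} [Finite S] [Finite Δ] (p : Cmd S Δ Bool) (pad : Δ)
    (hp : p.Det) (f : List Bool → List Bool)
    (hf : ∀ w, ∃ s, p.Exec w (Cmd.initStore Bool pad w) s ∧ s.out = f w) :
    LogSpaceComputable f := by
  refine ⟨(p.machine pad).toTM, SweepMachine.toTM_deterministic _ (Cmd.machine_deterministic _ hp),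
    SweepMachine.toTM_logSpace _, fun w => ?_⟩
  obtain ⟨s, hs, ho⟩ := hf w
  refine ⟨_, SweepMachine.reachable_homeCfg (Cmd.reachable_of_exec hs),
    SweepMachine.not_step_homeCfg ?_, ho⟩
  -- The final stack is empty and admits no action; this is the halting required of a transducer.
  intro a
  exact Set.eq_empty_iff_forall_notMem.2 fun y hy => absurd hy (Set.notMem_empty _)

/-! ### Words as numbers -/

/-- The number denoted by a word of digits, least significant digit first. -/
def numVal {A : Type} {m : ℕ} (e : A ≃ Fin m) : List A → ℕ
  | [] => 0
  | d :: l => e d + m * numVal e l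

/-- The word of length `L` that denotes a number. -/
def numStr {A : Type} {m : ℕ} [NeZero m] (e : A ≃ Fin m) : ℕ → ℕ → List A
  | 0, _ => []
  | L + 1, i => e.symm (Fin.ofNat m i) :: numStr e L (i / m)

theorem numVal_lt {A : Type} {m : ℕ} (e : A ≃ Fin m) (l : List A) :
    numVal e l < m ^ l.length := by
  induction l with
  | nil => simp [numVal]
  | cons d l ih =>
    have h1 : (e d : ℕ) + 1 ≤ m := (e d).2
    have h2 : m * (numVal e l + 1) ≤ m * m ^ l.length := Nat.mul_le_mul_left _ ih
    rw [List.length_cons, pow_succ', numVal]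
    rw [mul_add] at h2
    omega

theorem length_numStr {A : Type} {m : ℕ} [NeZero m] (e : A ≃ Fin m) (L i : ℕ) :
    (numStr e L i).length = L := by
  induction L generalizing i with
  | zero => rfl
  | succ L ih => simp [numStr, ih]

theorem numVal_numStr {A : Type} {m : ℕ} [NeZero m] (e : A ≃ Fin m) {L i : ℕ} (h : i < m ^ L) :
    numVal e (numStr e L i) = i := by
  induction L generalizing i with
  | zero => simp at h; simp [numStr, numVal, h]
  | succ L ih =>
    have : i / m < m ^ L := Nat.div_lt_of_lt_mul (by rwa [pow_succ'] at h)
    simp only [numStr, numVal, ih this, Equiv.apply_symm_apply, Fin.val_ofNat]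
    exact Nat.mod_add_div i m

theorem numStr_numVal {A : Type} {m : ℕ} [NeZero m] (e : A ≃ Fin m) (l : List A) :
    numStr e l.length (numVal e l) = l := by
  induction l with
  | nil => rfl
  | cons d l ih =>
    have hm : 0 < m := NeZero.pos m
    have h1 : (e d + m * numVal e l) / m = numVal e l := by
      rw [Nat.add_mul_div_left _ _ hm, Nat.div_eq_of_lt (e d).2, zero_add]
    have h2 : Fin.ofNat m (e d + m * numVal e l) = e d := by
      ext
      simp [Nat.mod_eq_of_lt (e d).2]
    simp only [List.length_cons, numStr, numVal, h1, h2, Equiv.symm_apply_apply, ih]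

theorem eq_of_numVal_eq {A : Type} {m : ℕ} [NeZero m] (e : A ≃ Fin m) {l l' : List A}
    (hl : l.length = l'.length) (h : numVal e l = numVal e l') : l = l' := by
  rw [← numStr_numVal e l, hl, h, numStr_numVal]

/-- Binary digits. -/
abbrev boolDigit : Bool ≃ Fin 2 := finTwoEquiv.symm

theorem numVal_bool_cons (b : Bool) (l : List Bool) :
    numVal boolDigit (b :: l) = b.toNat + 2 * numVal boolDigit l := by
  cases b <;> rfl

/-! ### Nondeterministic programs over bounded numbers -/

/-- The bound of the numbers that a sweeping machine represents on a binary track. -/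
def numBound (w : List Bool) : ℕ := 2 ^ wordLength w

/-- Nondeterministic programs with numerical variables and an input head: guessing a number,
tests `x = y` and `x + y + c = z`, tests of the input symbol, and movements of the input head. -/
inductive NProg : Type
  | guess (x : ℕ)
  | eq (x y : ℕ)
  | lin (c : Bool) (x y z : ℕ)
  | sym (f : InputSymbol → Bool)
  | move (m : HeadMove)
  | seq (p q : NProg)
  | alt (p q : NProg)
  | star (p : NProg)

namespace NProg

/-- The semantics of nondeterministic programs; a state consists of the position of the input head
and the values of the variables. -/
def Den (w : List Bool) : NProg → ℕ × (ℕ → ℕ) → ℕ × (ℕ → ℕ) → Prop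
  | guess x, s, s' => ∃ y < numBound w, s' = (s.1, Function.update s.2 x y)
  | eq x y, s, s' => s' = s ∧ s.2 x = s.2 y
  | lin c x y z, s, s' => s' = s ∧ s.2 x + s.2 y + c.toNat = s.2 z
  | sym f, s, s' => s' = s ∧ f (inputSymbol w s.1) = true
  | move m, s, s' => s' = (min (m.apply s.1) (w.length + 1), s.2)
  | seq p q, s, s' => ∃ t, p.Den w s t ∧ q.Den w t s'
  | alt p q, s, s' => p.Den w s s' ∨ q.Den w s s'
  | star p, s, s' => Relation.ReflTransGen (p.Den w) s s'

/-- All variables of a program are at most `K`. -/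
def VarsLE (K : ℕ) : NProg → Prop
  | guess x => x ≤ K
  | eq x y => x ≤ K ∧ y ≤ K
  | lin _ x y z => x ≤ K ∧ y ≤ K ∧ z ≤ K
  | sym _ => True
  | move _ => True
  | seq p q => p.VarsLE K ∧ q.VarsLE K
  | alt p q => p.VarsLE K ∧ q.VarsLE K
  | star p => p.VarsLE K

theorem VarsLE.mono {K K' : ℕ} (h : K ≤ K') {p : NProg} (hp : p.VarsLE K) : p.VarsLE K' := by
  induction p with
  | guess x => exact le_trans hp h
  | eq x y => exact ⟨hp.1.trans h, hp.2.trans h⟩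
  | lin c x y z => exact ⟨hp.1.trans h, hp.2.1.trans h, hp.2.2.trans h⟩
  | sym f => trivial
  | move m => trivial
  | seq p q ihp ihq => exact ⟨ihp hp.1, ihq hp.2⟩
  | alt p q ihp ihq => exact ⟨ihp hp.1, ihq hp.2⟩
  | star p ih => exact ih hp

theorem exists_varsLE (p : NProg) : ∃ K, p.VarsLE K := by
  induction p with
  | guess x => exact ⟨x, le_rfl⟩
  | eq x y => exact ⟨x + y, by constructor <;> omega⟩
  | lin c x y z => exact ⟨x + y + z, by refine ⟨?_, ?_, ?_⟩ <;> omega⟩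
  | sym f => exact ⟨0, trivial⟩
  | move m => exact ⟨0, trivial⟩
  | seq p q ihp ihq =>
    obtain ⟨K, hK⟩ := ihp
    obtain ⟨K', hK'⟩ := ihq
    exact ⟨max K K', hK.mono (le_max_left _ _), hK'.mono (le_max_right _ _)⟩
  | alt p q ihp ihq =>
    obtain ⟨K, hK⟩ := ihp
    obtain ⟨K', hK'⟩ := ihq
    exact ⟨max K K', hK.mono (le_max_left _ _), hK'.mono (le_max_right _ _)⟩
  | star p ih => exact ih

/-! ### Passes over binary tracks -/

section Compile

variable (K : ℕ)

/-- Letters with one binary digit for each variable. -/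
abbrev Letter : Type := Fin (K + 1) → Bool

abbrev track (x : ℕ) : Fin (K + 1) := Fin.ofNat (K + 1) x

variable {K}

theorem track_ne {x y : ℕ} (hx : x ≤ K) (hy : y ≤ K) (h : x ≠ y) : track K x ≠ track K y := by
  intro e
  have := congrArg Fin.val e
  simp only [Fin.val_ofNat] at this
  rw [Nat.mod_eq_of_lt (by omega), Nat.mod_eq_of_lt (by omega)] at this
  exact h this

variable (K)

/-- The initial state of the pass is unconstrained, so either result is possible. -/
def coinPrim : Prim Bool (Letter K) Empty where
  start := fun _ => {y | y.2 = (.stay, none)}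
  scan := fun s d => {(s, d)}
  res := id

/-- There is no action at all: the computation is stuck, which for a nondeterministic machine means
rejection of this branch. -/
def failPrim : Prim Bool (Letter K) Empty where
  start := fun _ => ∅
  scan := fun _ _ => ∅
  res := id

def guessPrim (x : ℕ) : Prim Bool (Letter K) Empty where
  start := fun _ => {(true, .stay, none)}
  scan := fun s d => {y | ∃ b, y = (s, Function.update d (track K x) b)}
  res := id

def eqPrim (x y : ℕ) : Prim Bool (Letter K) Empty where
  start := fun _ => {(true, .stay, none)}
  scan := fun s d => {z | z = (s, d) ∧ d (track K x) = d (track K y)}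
  res := id

/-- School addition from the least significant digit on: the state is the carry, a wrong digit of
`z` blocks the pass, and a final carry makes the result false, so that the sum is exact and not
modulo a power of two. -/
def linPrim (c : Bool) (x y z : ℕ) : Prim Bool (Letter K) Empty where
  start := fun _ => {(c, .stay, none)}
  scan := fun s d => {t | t.2 = d ∧ (d (track K x)).toNat + (d (track K y)).toNat + s.toNat =
    (d (track K z)).toNat + 2 * t.1.toNat}
  res := not

def symPrim (f : InputSymbol → Bool) : Prim Bool (Letter K) Empty where
  start := fun a => {y | y = (true, .stay, none) ∧ f a = true}
  scan := fun s d => {(s, d)}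
  res := id

def movePrim (m : HeadMove) : Prim Bool (Letter K) Empty where
  start := fun _ => {(true, m, none)}
  scan := fun s d => {(s, d)}
  res := id

/-- Executing a primitive command that has to succeed. -/
def must (a : Prim Bool (Letter K) Empty) : Cmd Bool (Letter K) Empty :=
  .ite a .skip (.ite (failPrim K) .skip .skip)

/-- The translation of nondeterministic programs to programs for sweeping machines. -/
def compile : NProg → Cmd Bool (Letter K) Empty
  | guess x => must K (guessPrim K x)
  | eq x y => must K (eqPrim K x y)
  | lin c x y z => must K (linPrim K c x y z)
  | sym f => must K (symPrim K f)
  | move m => must K (movePrim K m)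
  | seq p q => .seq p.compile q.compile
  | alt p q => .ite (coinPrim K) p.compile q.compile
  | star p => .loop (coinPrim K) p.compile

variable {K}

/-- The branch for a negative result runs into `failPrim`, which has no execution. -/
theorem exec_must {w : List Bool} {a : Prim Bool (Letter K) Empty}
    {s s' : Store (Letter K) Empty} : (must K a).Exec w s s' ↔ a.Rel w s true s' := by
  constructor
  · intro h
    cases h with
    | iteTrue h1 h2 => cases h2; exact h1
    | iteFalse _ h2 =>
      cases h2 with
      | iteTrue h3 _ => obtain ⟨q, m, o, q', h3, -⟩ := h3; exact absurd h3 (Set.notMem_empty _)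
      | iteFalse h3 _ => obtain ⟨q, m, o, q', h3, -⟩ := h3; exact absurd h3 (Set.notMem_empty _)
  · exact fun h => .iteTrue h (.skip _)

theorem scan_id {S Δ : Type} {s s' : S} {v v' : List Δ} :
    Scan (fun s d => {(s, d)}) s v s' v' ↔ s' = s ∧ v' = v := by
  constructor
  · intro h
    induction h with
    | nil => exact ⟨rfl, rfl⟩
    | cons h1 _ ih =>
      simp only [Set.mem_singleton_iff, Prod.mk.injEq] at h1
      obtain ⟨rfl, rfl⟩ := h1
      exact ⟨ih.1, by rw [ih.2]⟩
  · rintro ⟨rfl, rfl⟩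
    induction v' with
    | nil => exact .nil _
    | cons d v ih => exact .cons rfl ih

theorem scan_eq {s s' : Bool} {x y : ℕ} {v v' : List (Letter K)} :
    Scan (eqPrim K x y).scan s v s' v' ↔
      s' = s ∧ v' = v ∧ v.map (· (track K x)) = v.map (· (track K y)) := by
  constructor
  · intro h
    induction h with
    | nil => exact ⟨rfl, rfl, rfl⟩
    | cons h1 _ ih =>
      obtain ⟨h1, h2⟩ := h1
      simp only [Prod.mk.injEq] at h1
      obtain ⟨rfl, rfl⟩ := h1
      exact ⟨ih.1, by rw [ih.2.1], by simp only [List.map_cons, ih.2.2, h2]⟩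
  · rintro ⟨rfl, rfl, h⟩
    induction v' with
    | nil => exact .nil _
    | cons d v ih =>
      simp only [List.map_cons, List.cons.injEq] at h
      exact .cons ⟨rfl, h.1⟩ (ih h.2)

/-- The number on the track of a variable. -/
def trackVal (v : List (Letter K)) (x : ℕ) : ℕ := numVal boolDigit (v.map (· (track K x)))

theorem trackVal_cons (d : Letter K) (v : List (Letter K)) (x : ℕ) :
    trackVal (d :: v) x = (d (track K x)).toNat + 2 * trackVal v x := by
  simp only [trackVal, List.map_cons, numVal_bool_cons]

theorem trackVal_lt (v : List (Letter K)) (x : ℕ) : trackVal v x < 2 ^ v.length := by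
  have := numVal_lt boolDigit (v.map (· (track K x)))
  rwa [List.length_map] at this

/-- The invariant of addition with carry: the outgoing carry has the weight of the first digit
beyond the word. -/
theorem scan_lin {s s' : Bool} {c : Bool} {x y z : ℕ} {v v' : List (Letter K)} :
    Scan (linPrim K c x y z).scan s v s' v' ↔
      v' = v ∧ trackVal v x + trackVal v y + s.toNat = trackVal v z + 2 ^ v.length * s'.toNat := by
  constructor
  · intro h
    induction h with
    | nil => exact ⟨rfl, by simp [trackVal, numVal]⟩
    | @cons s s₁ s₂ d d₁ v v₂ h1 _ ih =>
      obtain ⟨h1, h2⟩ := h1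
      simp only at h1 h2
      subst h1
      obtain ⟨rfl, ih⟩ := ih
      refine ⟨rfl, ?_⟩
      simp only [trackVal_cons, List.length_cons, pow_succ', mul_assoc]
      omega
  · rintro ⟨rfl, h⟩
    induction v' generalizing s with
    | nil =>
      have : s' = s := by
        simp [trackVal, numVal] at h
        revert h
        cases s <;> cases s' <;> simp
      rw [this]
      exact .nil _
    | cons d v ih =>
      simp only [trackVal_cons, List.length_cons, pow_succ', mul_assoc] at h
      have h1 := Bool.toNat_le (d (track K x))
      have h2 := Bool.toNat_le (d (track K y))
      have h3 := Bool.toNat_le (d (track K z))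
      have h4 := Bool.toNat_le s
      -- The only possible carry out of this digit. The parity of the digit equation follows from
      -- the equation for the whole numbers.
      let t : Bool := decide (2 ≤ (d (track K x)).toNat + (d (track K y)).toNat + s.toNat)
      have ht : (d (track K x)).toNat + (d (track K y)).toNat + s.toNat =
          (d (track K z)).toNat + 2 * t.toNat := by
        simp only [t]
        by_cases h5 : 2 ≤ (d (track K x)).toNat + (d (track K y)).toNat + s.toNat
        · simp only [h5, decide_true, Bool.toNat_true]
          omega
        · simp only [h5, decide_false, Bool.toNat_false]
          omega
      refine .cons (s₁ := t) ⟨rfl, ht⟩ (ih ?_)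
      omega

theorem trackVal_guess {s s' : Bool} {x : ℕ} (hx : x ≤ K) {v v' : List (Letter K)}
    (h : Scan (guessPrim K x).scan s v s' v') {y : ℕ} (hy : y ≤ K) (hxy : y ≠ x) :
    trackVal v' y = trackVal v y := by
  induction h with
  | nil => rfl
  | cons h1 _ ih =>
    obtain ⟨b, h1⟩ := h1
    simp only [Prod.mk.injEq] at h1
    obtain ⟨rfl, rfl⟩ := h1
    rw [trackVal_cons, trackVal_cons, ih, Function.update_of_ne (track_ne hy hx hxy)]

theorem exists_scan_guess (s : Bool) {x : ℕ} (v : List (Letter K)) {k : ℕ}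
    (hk : k < 2 ^ v.length) :
    ∃ v', Scan (guessPrim K x).scan s v s v' ∧ trackVal v' x = k := by
  have key : ∀ u : List Bool, u.length = v.length →
      ∃ v', Scan (guessPrim K x).scan s v s v' ∧ v'.map (· (track K x)) = u := by
    clear hk
    induction v with
    | nil =>
      intro u hu
      exact ⟨[], .nil _, (List.length_eq_zero_iff.1 hu).symm⟩
    | cons d v ih =>
      intro u hu
      rcases u with _ | ⟨b, u⟩
      · simp at hu
      · obtain ⟨v', h1, h2⟩ := ih u (by simpa using hu)
        exact ⟨Function.update d (track K x) b :: v', .cons ⟨b, rfl⟩ h1, by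
          rw [List.map_cons, h2, Function.update_self]⟩
  obtain ⟨v', h1, h2⟩ := key (numStr boolDigit v.length k) (length_numStr _ _ _)
  exact ⟨v', h1, by rw [trackVal, h2, numVal_numStr _ hk]⟩

/-- A store of the sweeping machine represents a state of a nondeterministic program. -/
structure Represents (w : List Bool) (s : Store (Letter K) Empty) (t : ℕ × (ℕ → ℕ)) : Prop where
  pos_eq : s.pos = t.1
  pos_le : s.pos ≤ w.length + 1
  length_eq : s.word.length = wordLength w
  val_eq : ∀ x ≤ K, trackVal s.word x = t.2 x

theorem coin_rel {w : List Bool} {s s' : Store (Letter K) Empty} (hs : s.pos ≤ w.length + 1)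
    {b : Bool} : (coinPrim K).Rel w s b s' ↔ s' = s := by
  obtain ⟨p, v, o⟩ := s
  obtain ⟨p', v', o'⟩ := s'
  constructor
  · rintro ⟨q, m, o, q', h1, h2, h3, h4, h5⟩
    simp only [coinPrim, Set.mem_ofPred_eq, Prod.mk.injEq] at h1
    obtain ⟨rfl, rfl⟩ := h1
    obtain ⟨-, h2⟩ := scan_id.1 h2
    simp_all [HeadMove.apply]
  · intro h
    simp only [Store.mk.injEq] at h
    obtain ⟨rfl, rfl, rfl⟩ := h
    refine ⟨b, .stay, none, b, rfl, scan_id.2 ⟨rfl, rfl⟩, ?_, by simp, rfl⟩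
    simpa [HeadMove.apply] using hs

/-- A loop guarded by a coin runs its body an arbitrary finite number of times, and the coin itself
leaves the store unchanged. -/
theorem exec_star {w : List Bool} {p : Cmd Bool (Letter K) Empty}
    {s s' : Store (Letter K) Empty} (hs : s.pos ≤ w.length + 1) :
    (Cmd.loop (coinPrim K) p).Exec w s s' ↔ Relation.ReflTransGen (p.Exec w) s s' := by
  constructor
  · intro h
    generalize hq : Cmd.loop (coinPrim K) p = q at h
    induction h with
    | loopTrue h1 h2 _ _ ih =>
      cases hq
      obtain rfl := (coin_rel hs).1 h1
      exact .head h2 (ih (h2.pos_le hs) rfl)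
    | loopFalse h1 =>
      cases hq
      rw [(coin_rel hs).1 h1]
    | _ => cases hq
  · intro h
    induction h using Relation.ReflTransGen.head_induction_on with
    | refl => exact .loopFalse ((coin_rel hs).2 rfl)
    | head h1 _ ih => exact .loopTrue ((coin_rel hs).2 rfl) h1 (ih (h1.pos_le hs))

/-- Together with `exec_of_den` this is a simulation in both directions, by induction on the
program. Only variables up to `K` have a track; the others are never touched. -/
theorem den_of_exec {w : List Bool} {p : NProg} (hp : p.VarsLE K)
    {s s' : Store (Letter K) Empty} {t : ℕ × (ℕ → ℕ)} (hst : Represents w s t)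
    (h : (p.compile K).Exec w s s') : ∃ t', p.Den w t t' ∧ Represents w s' t' := by
  obtain ⟨hs1, hs2, hs3, hs4⟩ := hst
  induction p generalizing s s' t with
  | guess x =>
    obtain ⟨q, m, o, q', h1, h2, h3, h4, h5⟩ := exec_must.1 h
    simp only [guessPrim, Set.mem_singleton_iff, Prod.mk.injEq] at h1
    obtain ⟨rfl, rfl, rfl⟩ := h1
    have hpos : s'.pos = s.pos := by rw [h3]; simpa [HeadMove.apply] using hs2
    refine ⟨_, ⟨trackVal s'.word x, ?_, rfl⟩, hpos.trans hs1, hpos ▸ hs2, h2.length_eq.trans hs3, ?_⟩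
    · rw [numBound, ← hs3, ← h2.length_eq]
      exact trackVal_lt _ _
    · intro y hy
      by_cases hxy : y = x
      · subst hxy
        simp
      · rw [trackVal_guess hp h2 hy hxy, hs4 y hy]
        simp [hxy]
  | eq x y =>
    obtain ⟨q, m, o, q', h1, h2, h3, h4, h5⟩ := exec_must.1 h
    simp only [eqPrim, Set.mem_singleton_iff, Prod.mk.injEq] at h1
    obtain ⟨rfl, rfl, rfl⟩ := h1
    obtain ⟨-, h6, h7⟩ := scan_eq.1 h2
    have hpos : s'.pos = s.pos := by rw [h3]; simpa [HeadMove.apply] using hs2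
    refine ⟨t, ⟨rfl, ?_⟩, hpos.trans hs1, hpos ▸ hs2, h6 ▸ hs3, h6 ▸ hs4⟩
    rw [← hs4 x hp.1, ← hs4 y hp.2, trackVal, trackVal, h7]
  | lin c x y z =>
    obtain ⟨q, m, o, q', h1, h2, h3, h4, h5⟩ := exec_must.1 h
    simp only [linPrim, Set.mem_singleton_iff, Prod.mk.injEq] at h1
    obtain ⟨rfl, rfl, rfl⟩ := h1
    obtain ⟨h6, h7⟩ := scan_lin.1 h2
    obtain rfl : q' = false := by simpa [linPrim] using h5
    have hpos : s'.pos = s.pos := by rw [h3]; simpa [HeadMove.apply] using hs2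
    refine ⟨t, ⟨rfl, ?_⟩, hpos.trans hs1, hpos ▸ hs2, h6 ▸ hs3, h6 ▸ hs4⟩
    rw [← hs4 x hp.1, ← hs4 y hp.2.1, ← hs4 z hp.2.2, h7]
    simp
  | sym f =>
    obtain ⟨q, m, o, q', h1, h2, h3, h4, h5⟩ := exec_must.1 h
    simp only [symPrim, Set.mem_ofPred_eq, Prod.mk.injEq] at h1
    obtain ⟨⟨rfl, rfl, rfl⟩, h1⟩ := h1
    obtain ⟨-, h6⟩ := scan_id.1 h2
    have hpos : s'.pos = s.pos := by rw [h3]; simpa [HeadMove.apply] using hs2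
    exact ⟨t, ⟨rfl, hs1 ▸ h1⟩, hpos.trans hs1, hpos ▸ hs2, h6 ▸ hs3, h6 ▸ hs4⟩
  | move m =>
    obtain ⟨q, m, o, q', h1, h2, h3, h4, h5⟩ := exec_must.1 h
    simp only [movePrim, Set.mem_singleton_iff, Prod.mk.injEq] at h1
    obtain ⟨rfl, rfl, rfl⟩ := h1
    obtain ⟨-, h6⟩ := scan_id.1 h2
    exact ⟨_, rfl, by rw [h3, hs1], h3 ▸ min_le_right _ _, h6 ▸ hs3, h6 ▸ hs4⟩
  | seq p q ihp ihq =>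
    cases h with
    | seq h1 h2 =>
      obtain ⟨t₁, h3, h4⟩ := ihp hp.1 h1 hs1 hs2 hs3 hs4
      obtain ⟨t₂, h5, h6⟩ := ihq hp.2 h2 h4.1 h4.2 h4.3 h4.4
      exact ⟨t₂, ⟨t₁, h3, h5⟩, h6⟩
  | alt p q ihp ihq =>
    cases h with
    | iteTrue h1 h2 =>
      obtain rfl := (coin_rel hs2).1 h1
      obtain ⟨t₁, h3, h4⟩ := ihp hp.1 h2 hs1 hs2 hs3 hs4
      exact ⟨t₁, .inl h3, h4⟩
    | iteFalse h1 h2 =>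
      obtain rfl := (coin_rel hs2).1 h1
      obtain ⟨t₁, h3, h4⟩ := ihq hp.2 h2 hs1 hs2 hs3 hs4
      exact ⟨t₁, .inr h3, h4⟩
  | star p ih =>
    have h := (exec_star hs2).1 h
    induction h with
    | refl => exact ⟨t, .refl, hs1, hs2, hs3, hs4⟩
    | tail _ h1 ih' =>
      obtain ⟨t₁, h2, h3⟩ := ih' ((exec_star hs2).2 ‹_›)
      obtain ⟨t₂, h4, h5⟩ := ih hp h1 h3.1 h3.2 h3.3 h3.4
      exact ⟨t₂, h2.tail h4, h5⟩

theorem exec_of_den {w : List Bool} {p : NProg} (hp : p.VarsLE K)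
    {s : Store (Letter K) Empty} {t t' : ℕ × (ℕ → ℕ)} (hst : Represents w s t)
    (h : p.Den w t t') : ∃ s', (p.compile K).Exec w s s' ∧ Represents w s' t' := by
  obtain ⟨hs1, hs2, hs3, hs4⟩ := hst
  have hstay : min (HeadMove.stay.apply s.pos) (w.length + 1) = s.pos := by
    simpa [HeadMove.apply] using hs2
  induction p generalizing s t t' with
  | guess x =>
    obtain ⟨y, hy, rfl⟩ := h
    obtain ⟨v, h1, h2⟩ := exists_scan_guess (K := K) (x := x) true s.word (k := y)
      (by rwa [hs3])
    refine ⟨⟨s.pos, v, s.out⟩, exec_must.2 ⟨true, .stay, none, true, rfl, h1, hstay.symm,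
      by simp, rfl⟩, hs1, hs2, h1.length_eq.trans hs3, fun z hz => ?_⟩
    by_cases hzx : z = x
    · subst hzx
      simp [h2]
    · simp only [ne_eq, hzx, not_false_eq_true, Function.update_of_ne]
      rw [trackVal_guess hp h1 hz hzx, hs4 z hz]
  | eq x y =>
    obtain ⟨rfl, h⟩ := h
    refine ⟨s, exec_must.2 ⟨true, .stay, none, true, rfl, scan_eq.2 ⟨rfl, rfl, ?_⟩, hstay.symm,
      by simp, rfl⟩, hs1, hs2, hs3, hs4⟩
    refine eq_of_numVal_eq boolDigit (by simp) ?_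
    exact ((hs4 x hp.1).trans h).trans (hs4 y hp.2).symm
  | lin c x y z =>
    obtain ⟨rfl, h⟩ := h
    refine ⟨s, exec_must.2 ⟨c, .stay, none, false, rfl, scan_lin.2 ⟨rfl, ?_⟩, hstay.symm,
      by simp, rfl⟩, hs1, hs2, hs3, hs4⟩
    rw [hs4 x hp.1, hs4 y hp.2.1, hs4 z hp.2.2, h]
    simp
  | sym f =>
    obtain ⟨rfl, h⟩ := h
    exact ⟨s, exec_must.2 ⟨true, .stay, none, true, ⟨rfl, hs1 ▸ h⟩, scan_id.2 ⟨rfl, rfl⟩,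
      hstay.symm, by simp, rfl⟩, hs1, hs2, hs3, hs4⟩
  | move m =>
    obtain rfl := h
    exact ⟨⟨min (m.apply s.pos) (w.length + 1), s.word, s.out⟩, exec_must.2 ⟨true, m, none, true,
      rfl, scan_id.2 ⟨rfl, rfl⟩, rfl, by simp, rfl⟩, by rw [hs1], min_le_right _ _, hs3, hs4⟩
  | seq p q ihp ihq =>
    obtain ⟨t₁, h1, h2⟩ := h
    obtain ⟨s₁, h3, h4⟩ := ihp hp.1 h1 hs1 hs2 hs3 hs4 hstay
    obtain ⟨s₂, h5, h6⟩ := ihq hp.2 h2 h4.1 h4.2 h4.3 h4.4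
      (by simpa [HeadMove.apply] using h4.2)
    exact ⟨s₂, .seq h3 h5, h6⟩
  | alt p q ihp ihq =>
    rcases h with h | h
    · obtain ⟨s₁, h3, h4⟩ := ihp hp.1 h hs1 hs2 hs3 hs4 hstay
      exact ⟨s₁, .iteTrue ((coin_rel hs2).2 rfl) h3, h4⟩
    · obtain ⟨s₁, h3, h4⟩ := ihq hp.2 h hs1 hs2 hs3 hs4 hstay
      exact ⟨s₁, .iteFalse ((coin_rel hs2).2 rfl) h3, h4⟩
  | star p ih =>
    suffices ∃ s', Relation.ReflTransGen ((p.compile K).Exec w) s s' ∧ Represents w s' t' by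
      obtain ⟨s', h1, h2⟩ := this
      exact ⟨s', (exec_star hs2).2 h1, h2⟩
    induction h with
    | refl => exact ⟨s, .refl, hs1, hs2, hs3, hs4⟩
    | tail _ h1 ih' =>
      obtain ⟨s₁, h2, h3⟩ := ih'
      obtain ⟨s₂, h4, h5⟩ := ih hp h1 h3.1 h3.2 h3.3 h3.4 (by simpa [HeadMove.apply] using h3.2)
      exact ⟨s₂, h2.tail h4, h5⟩

end Compile

end NProg

/-- Languages recognized by nondeterministic programs over bounded numbers are in NL. -/
theorem mem_NL_of_nprog (p : NProg) (A : Language Bool)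
    (hA : ∀ w, w ∈ A ↔ ∃ t, p.Den w (w.length + 1, fun _ => 0) t) : A ∈ NL := by
  obtain ⟨K, hK⟩ := p.exists_varsLE
  -- The padding letter has the digit zero on every track, so all variables start with the value 0.
  refine mem_NL_of_cmd (p.compile K) (fun _ => false) A fun w => ?_
  have h0 : NProg.Represents w (Cmd.initStore Empty (fun _ => false : NProg.Letter K) w)
      (w.length + 1, fun _ => 0) := by
    refine ⟨rfl, le_rfl, by simp [Cmd.initStore], fun x _ => ?_⟩
    simp only [Cmd.initStore]
    induction wordLength w with
    | zero => rfl
    | succ n ih => rw [List.replicate_succ, NProg.trackVal_cons, ih]; rfl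
  rw [hA]
  constructor
  · rintro ⟨t, ht⟩
    obtain ⟨s, hs, -⟩ := NProg.exec_of_den hK h0 ht
    exact ⟨s, hs⟩
  · rintro ⟨s, hs⟩
    obtain ⟨t, ht, -⟩ := NProg.den_of_exec hK h0 hs
    exact ⟨t, ht⟩

/-! ### Predicates decidable in nondeterministic logarithmic space -/

theorem NProg.Den.bounded {w : List Bool} {p : NProg} {s s' : ℕ × (ℕ → ℕ)} (h : p.Den w s s')
    (hs : ∀ i, s.2 i < numBound w) : ∀ i, s'.2 i < numBound w := by
  induction p generalizing s s' with
  | guess x =>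
    obtain ⟨y, hy, rfl⟩ := h
    intro i
    by_cases hi : i = x
    · subst hi
      simpa using hy
    · simpa [hi] using hs i
  | eq x y => rw [h.1]; exact hs
  | lin c x y z => rw [h.1]; exact hs
  | sym f => rw [h.1]; exact hs
  | move m => rw [show s' = _ from h]; exact hs
  | seq p q ihp ihq =>
    obtain ⟨t, h1, h2⟩ := h
    exact ihq h2 (ihp h1 hs)
  | alt p q ihp ihq => exact h.elim (fun h => ihp h hs) (fun h => ihq h hs)
  | star p ih =>
    induction h with
    | refl => exact hs
    | tail _ h1 ih' => exact ih h1 ih'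

/-- The program `p` tests the property `Q` of the variables, and changes no variable below `m`. -/
def NProg.Tests (p : NProg) (m : ℕ) (Q : List Bool → (ℕ → ℕ) → Prop) : Prop :=
  ∀ w h σ, (∀ i, σ i < numBound w) →
    (∀ s', p.Den w (h, σ) s' → Q w σ ∧ ∀ i < m, s'.2 i = σ i) ∧
    (Q w σ → ∃ s', p.Den w (h, σ) s')

/-- Predicates of the input and of bounded numbers that can be tested by nondeterministic programs
in logarithmic space, wherever the arguments and the free variables are placed. -/
def NLPred {α : Type} (P : List Bool → (α → ℕ) → Prop) : Prop :=
  ∀ (m : ℕ) (f : α → ℕ), (∀ a, f a < m) →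
    ∃ p : NProg, p.Tests m fun w σ => P w fun a => σ (f a)

namespace NLPred

variable {α β : Type} {P Q : List Bool → (α → ℕ) → Prop}

/-- Equivalence is demanded for arguments below `numBound w` only. This is what justifies searching
for witnesses among bounded numbers. -/
theorem congr (hP : NLPred P)
    (h : ∀ w x, (∀ a, x a < numBound w) → (Q w x ↔ P w x)) : NLPred Q := by
  intro m f hf
  obtain ⟨p, hp⟩ := hP m f hf
  refine ⟨p, fun w h' σ hσ => ?_⟩
  have := h w (fun a => σ (f a)) (fun a => hσ _)
  simp only [this]
  exact hp w h' σ hσ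

theorem rename {P : List Bool → (β → ℕ) → Prop} (hP : NLPred P) (g : β → α) :
    NLPred fun w (x : α → ℕ) => P w fun b => x (g b) :=
  fun m f hf => hP m (fun b => f (g b)) fun b => hf (g b)

theorem const (c : Prop) : NLPred fun _ (_ : α → ℕ) => c := by
  intro m f hf
  refine ⟨.sym fun _ => @decide c (Classical.dec c), fun w h σ hσ => ⟨?_, ?_⟩⟩
  · rintro s' ⟨rfl, h⟩
    exact ⟨by simpa using h, fun _ _ => rfl⟩
  · intro h
    exact ⟨_, rfl, by simpa using h⟩

/-- The first test preserves the variables below `m`, so the second one still sees the same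
arguments, wherever the input head has been left. -/
theorem and (hP : NLPred P) (hQ : NLPred Q) : NLPred fun w x => P w x ∧ Q w x := by
  intro m f hf
  obtain ⟨p, hp⟩ := hP m f hf
  obtain ⟨q, hq⟩ := hQ m f hf
  refine ⟨.seq p q, fun w h σ hσ => ⟨?_, ?_⟩⟩
  · rintro s' ⟨⟨h₁, σ₁⟩, h1, h2⟩
    obtain ⟨h3, h4⟩ := (hp w h σ hσ).1 _ h1
    obtain ⟨h5, h6⟩ := (hq w h₁ σ₁ (h1.bounded hσ)).1 _ h2
    have : (fun a => σ₁ (f a)) = fun a => σ (f a) := funext fun a => h4 _ (hf a)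
    rw [this] at h5
    exact ⟨⟨h3, h5⟩, fun i hi => (h6 i hi).trans (h4 i hi)⟩
  · rintro ⟨h1, h2⟩
    obtain ⟨⟨h₁, σ₁⟩, h3⟩ := (hp w h σ hσ).2 h1
    have h4 := ((hp w h σ hσ).1 _ h3).2
    have : (fun a => σ₁ (f a)) = fun a => σ (f a) := funext fun a => h4 _ (hf a)
    obtain ⟨s', h5⟩ := (hq w h₁ σ₁ (h3.bounded hσ)).2 (by
      dsimp only
      rw [this]
      exact h2)
    exact ⟨s', _, h3, h5⟩

theorem or (hP : NLPred P) (hQ : NLPred Q) : NLPred fun w x => P w x ∨ Q w x := by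
  intro m f hf
  obtain ⟨p, hp⟩ := hP m f hf
  obtain ⟨q, hq⟩ := hQ m f hf
  refine ⟨.alt p q, fun w h σ hσ => ⟨?_, ?_⟩⟩
  · rintro s' (h1 | h1)
    · exact ⟨.inl ((hp w h σ hσ).1 _ h1).1, ((hp w h σ hσ).1 _ h1).2⟩
    · exact ⟨.inr ((hq w h σ hσ).1 _ h1).1, ((hq w h σ hσ).1 _ h1).2⟩
  · rintro (h1 | h1)
    · obtain ⟨s', h2⟩ := (hp w h σ hσ).2 h1
      exact ⟨s', .inl h2⟩
    · obtain ⟨s', h2⟩ := (hq w h σ hσ).2 h1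
      exact ⟨s', .inr h2⟩

/-- The witness is guessed in the variable `m`, and the remaining test is asked to protect one
variable more. -/
theorem ex {P : List Bool → (α → ℕ) → ℕ → Prop}
    (hP : NLPred fun w (x : Option α → ℕ) => P w (fun a => x (some a)) (x none)) :
    NLPred fun w x => ∃ z < numBound w, P w x z := by
  intro m f hf
  obtain ⟨p, hp⟩ := hP (m + 1) (fun a => a.elim m f)
    (by rintro (_ | a); exacts [Nat.lt_succ_self _, (hf a).trans (Nat.lt_succ_self _)])
  have hu : ∀ (σ : ℕ → ℕ) z, (fun a => Function.update σ m z (f a)) = fun a => σ (f a) :=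
    fun σ z => funext fun a => Function.update_of_ne (hf a).ne _ _
  have hb : ∀ (w : List Bool) (σ : ℕ → ℕ) z, (∀ i, σ i < numBound w) → z < numBound w →
      ∀ i, Function.update σ m z i < numBound w := by
    intro w σ z hσ hz i
    by_cases hi : i = m
    · subst hi
      simpa using hz
    · simpa [hi] using hσ i
  refine ⟨.seq (.guess m) p, fun w h σ hσ => ⟨?_, ?_⟩⟩
  · rintro s' ⟨_, ⟨z, hz, rfl⟩, h2⟩
    obtain ⟨h3, h4⟩ := (hp w h _ (hb w σ z hσ hz)).1 _ h2
    simp only [Option.elim, Function.update_self, hu] at h3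
    refine ⟨⟨z, hz, h3⟩, fun i hi => ?_⟩
    rw [h4 i (by omega), Function.update_of_ne hi.ne]
  · rintro ⟨z, hz, h1⟩
    obtain ⟨s', h2⟩ := (hp w h _ (hb w σ z hσ hz)).2 (by
      simpa only [Option.elim, Function.update_self, hu] using h1)
    exact ⟨s', _, ⟨z, hz, rfl⟩, h2⟩

theorem exists_finite {ι : Type} [Finite ι] {P : ι → List Bool → (α → ℕ) → Prop}
    (hP : ∀ i, NLPred (P i)) : NLPred fun w x => ∃ i, P i w x := by
  have := Fintype.ofFinite ι
  have key : ∀ s : Finset ι, NLPred fun w x => ∃ i ∈ s, P i w x := by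
    classical
    intro s
    induction s using Finset.induction with
    | empty => exact (const False).congr fun w x _ => by simp
    | insert i s _ ih =>
      exact ((hP i).or ih).congr fun w x _ => by simp
  exact (key Finset.univ).congr fun w x _ => by simp

theorem forall_finite {ι : Type} [Finite ι] {P : ι → List Bool → (α → ℕ) → Prop}
    (hP : ∀ i, NLPred (P i)) : NLPred fun w x => ∀ i, P i w x := by
  have := Fintype.ofFinite ι
  have key : ∀ s : Finset ι, NLPred fun w x => ∀ i ∈ s, P i w x := by
    classical
    intro s
    induction s using Finset.induction with
    | empty => exact (const True).congr fun w x _ => by simp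
    | insert i s _ ih =>
      exact ((hP i).and ih).congr fun w x _ => by simp
  exact (key Finset.univ).congr fun w x _ => by simp

theorem eq (a b : α) : NLPred fun _ (x : α → ℕ) => x a = x b := by
  intro m f hf
  refine ⟨.eq (f a) (f b), fun w h σ hσ => ⟨?_, fun h => ⟨_, rfl, h⟩⟩⟩
  rintro s' ⟨rfl, h⟩
  exact ⟨h, fun _ _ => rfl⟩

theorem lin (e : Bool) (a b c : α) : NLPred fun _ (x : α → ℕ) => x a + x b + e.toNat = x c := by
  intro m f hf
  refine ⟨.lin e (f a) (f b) (f c), fun w h σ hσ => ⟨?_, fun h => ⟨_, rfl, h⟩⟩⟩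
  rintro s' ⟨rfl, h⟩
  exact ⟨h, fun _ _ => rfl⟩

theorem add (a b c : α) : NLPred fun _ (x : α → ℕ) => x a + x b = x c :=
  (lin false a b c).congr fun w x _ => by simp

/-- Programs have no constants; zero is the only solution of x + x = x, and other constants are
built from it. -/
theorem eq_zero (a : α) : NLPred fun _ (x : α → ℕ) => x a = 0 :=
  (add a a a).congr fun w x _ => by omega

theorem succ (a b : α) : NLPred fun _ (x : α → ℕ) => x b = x a + 1 := by
  refine ((eq_zero (none : Option α)).and (lin true (some a) none (some b))).ex.congr
    (Q := fun _ x => x b = x a + 1) (P := fun w x => ∃ z < numBound w, z = 0 ∧ x a + z + 1 = x b) ?_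
  intro w x _
  constructor
  · exact fun h => ⟨0, by simp [numBound], rfl, h.symm⟩
  · rintro ⟨z, _, rfl, h⟩
    omega

theorem lt (a b : α) : NLPred fun _ (x : α → ℕ) => x a < x b := by
  refine (lin true (some a) none (some b)).ex.congr
    (Q := fun _ x => x a < x b) (P := fun w x => ∃ z < numBound w, x a + z + 1 = x b) ?_
  intro w x hx
  constructor
  · exact fun h => ⟨x b - x a - 1, by have := hx b; omega, by omega⟩
  · rintro ⟨z, _, h⟩
    omega

theorem ne (a b : α) : NLPred fun _ (x : α → ℕ) => x a ≠ x b :=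
  ((lt a b).or (lt b a)).congr fun w x _ => by omega

end NLPred

/-! ### Reading the input -/

namespace NProg

/-- Moves the input head to the first cell of the input. -/
def rewind : NProg :=
  .seq (.star (.move .left)) (.seq (.sym fun a => match a with | .leftEnd => true | _ => false)
    (.move .right))

/-- Moves the input head one cell to the right, and increments the variable `m`. -/
def advance (m : ℕ) : NProg :=
  .seq (.sym fun a => match a with | .rightEnd => false | _ => true)
    (.seq (.move .right) (.seq (.guess (m + 1)) (.seq (.lin true m (m + 2) (m + 1))
      (.seq (.guess m) (.eq m (m + 1))))))

/-- Tests the input symbol at the position given by the variable `x`. -/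
def readAt (m x : ℕ) (f : InputSymbol → Bool) : NProg :=
  .seq rewind (.seq (.guess m) (.seq (.lin false m m m) (.seq (.guess (m + 2))
    (.seq (.lin false (m + 2) (m + 2) (m + 2)) (.seq (.star (advance m))
      (.seq (.eq m x) (.sym f)))))))

theorem inputSymbol_eq_leftEnd {w : List Bool} {h : ℕ} : inputSymbol w h = .leftEnd ↔ h = 0 := by
  rcases h with _ | h
  · simp [inputSymbol]
  · simp only [inputSymbol]
    cases w[h]? <;> simp

/-- The number of left moves is guessed, but the test for the left end marker leaves only the runs
that come to cell 0. -/
theorem den_rewind {w : List Bool} {h : ℕ} {σ : ℕ → ℕ} {s' : ℕ × (ℕ → ℕ)} :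
    rewind.Den w (h, σ) s' ↔ s' = (1, σ) := by
  constructor
  · rintro ⟨⟨h₁, σ₁⟩, h1, ⟨h₂, σ₂⟩, ⟨h2, h3⟩, h4⟩
    have hσ : σ₁ = σ := by
      generalize hs : (h₁, σ₁) = s at h1
      have : s.2 = σ := by
        clear hs
        induction h1 with
        | refl => rfl
        | tail _ h1 ih => rw [show _ = _ from h1]; exact ih
      rw [← this, ← hs]
    obtain ⟨rfl, rfl⟩ := Prod.mk.inj h2
    have h0 : h₂ = 0 := by
      apply (inputSymbol_eq_leftEnd (w := w)).1
      simp only at h3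
      split at h3
      · assumption
      · simp at h3
    rw [show s' = _ from h4, h0, hσ]
    simp [HeadMove.apply]
  · rintro rfl
    refine ⟨(0, σ), ?_, (0, σ), ⟨rfl, by simp [inputSymbol]⟩, by simp [Den, HeadMove.apply]⟩
    have key : ∀ k h, h = k ∨ h ≤ k →
        Relation.ReflTransGen ((NProg.move .left).Den w) (h, σ) (0, σ) := by
      intro k
      induction k with
      | zero => intro h hh; obtain rfl : h = 0 := by omega
                exact .refl
      | succ k ih =>
        intro h hh
        exact .head (b := (min (h - 1) (w.length + 1), σ)) rfl (ih _ (by omega))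
    exact key h h (.inl rfl)

/-- There is no assignment: the successor is guessed in `m + 1`, checked by an addition with the
zero in `m + 2` and the constant carry, and carried back to `m` by a second guess and a comparison.
-/
theorem den_advance {w : List Bool} {m h : ℕ} {σ : ℕ → ℕ} (hσ : σ (m + 2) = 0)
    {s' : ℕ × (ℕ → ℕ)} : (advance m).Den w (h, σ) s' ↔ h ≤ w.length ∧ σ m + 1 < numBound w ∧
      s' = (h + 1, Function.update (Function.update σ (m + 1) (σ m + 1)) m (σ m + 1)) := by
  have hsym : (match inputSymbol w h with | .rightEnd => false | _ => true) = true ↔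
      h ≤ w.length := by
    have := SweepMachine.inputSymbol_rightEnd (w := w) (h := h)
    cases hs : inputSymbol w h <;> rw [hs] at this <;> simp_all
  constructor
  · rintro ⟨_, ⟨rfl, h1⟩, _, rfl, _, ⟨y, hy, rfl⟩, _, ⟨rfl, h2⟩, _, ⟨z, hz, rfl⟩, ⟨rfl, h3⟩⟩
    have h1 := hsym.1 h1
    simp [hσ] at h2 h3
    subst h3
    subst h2
    exact ⟨h1, hy, by simp [HeadMove.apply]; omega⟩
  · rintro ⟨h1, h2, rfl⟩
    refine ⟨_, ⟨rfl, hsym.2 h1⟩, _, rfl, _, ⟨_, h2, rfl⟩, _, ⟨rfl, ?_⟩, _, ⟨_, h2, rfl⟩, ?_, ?_⟩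
    · simp [hσ]
    · simp [HeadMove.apply]; omega
    · simp

theorem readAt_tests {m x : ℕ} (hx : x < m) (f : InputSymbol → Bool) :
    (readAt m x f).Tests m fun w σ => σ x ≤ w.length ∧ f (inputSymbol w (σ x + 1)) = true := by
  intro w h σ hσ
  have hn := lt_two_pow_wordLength w
  constructor
  · rintro s' ⟨_, h1, _, ⟨y, hy, rfl⟩, _, ⟨rfl, h2⟩, _, ⟨z, hz, rfl⟩, _, ⟨rfl, h3⟩, s, h4, _,
      ⟨rfl, h5⟩, ⟨rfl, h6⟩⟩
    obtain rfl := den_rewind.1 h1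
    simp at h2 h3
    subst h2
    subst h3
    -- The head and the counter advance together; the offset is the cell of the left end marker.
    have inv : s'.1 = s'.2 m + 1 ∧ s'.2 (m + 2) = 0 ∧ s'.1 ≤ w.length + 1 ∧
        ∀ i < m, s'.2 i = σ i := by
      clear h5 h6
      induction h4 with
      | refl =>
        refine ⟨by simp, by simp, by simp, fun i hi => ?_⟩
        simp [show i ≠ m by omega, show i ≠ m + 2 by omega]
      | @tail s t _ hst ih =>
        obtain ⟨i1, i2, i3, i4⟩ := ih
        obtain ⟨h7, h8, rfl⟩ := (den_advance i2).1 (show (advance m).Den w (s.1, s.2) t from hst)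
        refine ⟨by simp [i1], by simpa using i2, by simpa using h7, fun i hi => ?_⟩
        simp [show i ≠ m by omega, show i ≠ m + 1 by omega, i4 i hi]
    obtain ⟨i1, i2, i3, i4⟩ := inv
    rw [i4 x hx] at h5
    rw [i1, h5] at h6
    exact ⟨⟨by omega, h6⟩, i4⟩
  · rintro ⟨h1, h2⟩
    have key : ∀ k ≤ w.length, ∃ s, Relation.ReflTransGen ((advance m).Den w)
        (1, Function.update (Function.update σ m 0) (m + 2) 0) s ∧
        s.1 = k + 1 ∧ s.2 m = k ∧ s.2 (m + 2) = 0 ∧ ∀ i < m, s.2 i = σ i := by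
      intro k hk
      induction k with
      | zero =>
        refine ⟨_, .refl, rfl, by simp, by simp, fun i hi => ?_⟩
        simp [show i ≠ m by omega, show i ≠ m + 2 by omega]
      | succ k ih =>
        obtain ⟨s, i1, i2, i3, i4, i5⟩ := ih (by omega)
        refine ⟨_, i1.tail (show (advance m).Den w (s.1, s.2) _ from (den_advance i4).2
          ⟨by omega, ?_, rfl⟩), by simp [i2], by simp [i3], by simpa using i4, fun i hi => ?_⟩
        · rw [i3, numBound]
          omega
        · simp [show i ≠ m by omega, show i ≠ m + 1 by omega, i5 i hi]
    obtain ⟨s, i1, i2, i3, i4, i5⟩ := key (σ x) h1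
    exact ⟨s, _, den_rewind.2 rfl, _, ⟨0, by simp [numBound], rfl⟩, _, ⟨rfl, by simp⟩, _,
      ⟨0, by simp [numBound], rfl⟩, _, ⟨rfl, by simp⟩, s, i1, s,
      ⟨rfl, by rw [i3, i5 x hx]⟩, rfl, by rw [i2]; exact h2⟩

end NProg

namespace NLPred

variable {α : Type}

theorem symbol (f : InputSymbol → Bool) (a : α) : NLPred fun w (x : α → ℕ) =>
    x a ≤ w.length ∧ f (inputSymbol w (x a + 1)) = true :=
  fun m g hg => ⟨_, NProg.readAt_tests (m := m) (x := g a) (hg a) f⟩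

theorem bit (b : Bool) (a : α) : NLPred fun w (x : α → ℕ) => w[x a]? = some b := by
  refine (symbol (fun s => match s with | .bit c => c == b | _ => false) a).congr fun w x _ => ?_
  rw [← SweepMachine.inputSymbol_bit]
  cases h : inputSymbol w (x a + 1)
  · simp
  · have : x a < w.length := by
      obtain ⟨h', -⟩ := List.getElem?_eq_some_iff.1 (SweepMachine.inputSymbol_bit.1 h)
      exact h'
    simp [this.le]
  · simp

theorem length_eq (a : α) : NLPred fun w (x : α → ℕ) => x a = w.length := by
  refine (symbol (fun s => match s with | .rightEnd => true | _ => false) a).congr fun w x _ => ?_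
  have := SweepMachine.inputSymbol_rightEnd (w := w) (h := x a + 1)
  cases h : inputSymbol w (x a + 1) <;> rw [h] at this <;> simp at this ⊢ <;> omega

end NLPred

/-! ### Guessing and copying tuples -/

namespace NProg

def guessAll : List ℕ → NProg
  | [] => .sym fun _ => true
  | x :: l => .seq (.guess x) (guessAll l)

def eqAll : List (ℕ × ℕ) → NProg
  | [] => .sym fun _ => true
  | p :: l => .seq (.eq p.1 p.2) (eqAll l)

theorem den_guessAll {w : List Bool} {l : List ℕ} {s s' : ℕ × (ℕ → ℕ)} :
    (guessAll l).Den w s s' ↔ s'.1 = s.1 ∧ (∀ i, i ∉ l → s'.2 i = s.2 i) ∧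
      ∀ i ∈ l, s'.2 i < numBound w := by
  induction l generalizing s with
  | nil =>
    constructor
    · rintro ⟨rfl, -⟩
      simp
    · rintro ⟨h1, h2, -⟩
      exact ⟨Prod.ext h1 (funext fun i => h2 i (by simp)), rfl⟩
  | cons x l ih =>
    constructor
    · rintro ⟨_, ⟨y, hy, rfl⟩, h⟩
      obtain ⟨h1, h2, h3⟩ := ih.1 h
      refine ⟨h1, fun i hi => ?_, fun i hi => ?_⟩
      · simp only [List.mem_cons, not_or] at hi
        rw [h2 i hi.2]
        exact Function.update_of_ne hi.1 _ _
      · by_cases hil : i ∈ l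
        · exact h3 i hil
        · rw [h2 i hil]
          obtain rfl : i = x := (List.mem_cons.1 hi).resolve_right hil
          simpa using hy
    · rintro ⟨h1, h2, h3⟩
      refine ⟨_, ⟨s'.2 x, h3 x (by simp), rfl⟩, ih.2 ⟨h1, fun i hi => ?_, fun i hi => h3 i
        (List.mem_cons_of_mem _ hi)⟩⟩
      by_cases hix : i = x
      · subst hix
        simp
      · simp only [ne_eq, hix, not_false_eq_true, Function.update_of_ne]
        exact h2 i (by simp [hix, hi])

theorem den_eqAll {w : List Bool} {l : List (ℕ × ℕ)} {s s' : ℕ × (ℕ → ℕ)} :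
    (eqAll l).Den w s s' ↔ s' = s ∧ ∀ p ∈ l, s.2 p.1 = s.2 p.2 := by
  induction l generalizing s with
  | nil => simp [eqAll, Den]
  | cons p l ih =>
    constructor
    · rintro ⟨_, ⟨rfl, h1⟩, h2⟩
      obtain ⟨rfl, h3⟩ := ih.1 h2
      exact ⟨rfl, by simpa using ⟨h1, fun a b h => h3 (a, b) h⟩⟩
    · rintro ⟨rfl, h⟩
      exact ⟨_, ⟨rfl, h p (by simp)⟩, ih.2 ⟨rfl, fun q hq => h q (List.mem_cons_of_mem _ hq)⟩⟩

/-- Sets the variables `x + i`, for `i < d`, to the values of the variables `g i`. -/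
def copyBlock (d x : ℕ) (g : Fin d → ℕ) : NProg :=
  .seq (guessAll ((List.finRange d).map fun i : Fin d => x + i))
    (eqAll ((List.finRange d).map fun i : Fin d => (x + i, g i)))

theorem den_copyBlock {w : List Bool} {d x : ℕ} {g : Fin d → ℕ}
    (hg : ∀ i (j : Fin d), g i ≠ x + j) {s s' : ℕ × (ℕ → ℕ)} (hs : ∀ i, s.2 i < numBound w) :
    (copyBlock d x g).Den w s s' ↔ s'.1 = s.1 ∧
      (∀ i, (∀ j : Fin d, i ≠ x + j) → s'.2 i = s.2 i) ∧ ∀ j : Fin d, s'.2 (x + j) = s.2 (g j) := by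
  constructor
  · rintro ⟨t, h1, h2⟩
    obtain ⟨rfl, h2⟩ := den_eqAll.1 h2
    obtain ⟨h1, h3, h4⟩ := den_guessAll.1 h1
    have h3' : ∀ i, (∀ j : Fin d, i ≠ x + j) → s'.2 i = s.2 i := by
      intro i hi
      refine h3 i fun h => ?_
      obtain ⟨j, -, hj⟩ := List.mem_map.1 h
      exact hi j hj.symm
    refine ⟨h1, h3', fun j => ?_⟩
    rw [← h3' (g j) (hg j)]
    exact h2 _ (List.mem_map.2 ⟨j, List.mem_finRange j, rfl⟩)
  · rintro ⟨h1, h2, h3⟩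
    refine ⟨s', den_guessAll.2 ⟨h1, fun i hi => h2 i fun j hj => hi ?_, fun i hi => ?_⟩,
      den_eqAll.2 ⟨rfl, ?_⟩⟩
    · exact List.mem_map.2 ⟨j, List.mem_finRange j, hj.symm⟩
    · obtain ⟨j, -, rfl⟩ := List.mem_map.1 hi
      rw [h3]
      exact hs _
    · intro p hp
      obtain ⟨j, -, rfl⟩ := List.mem_map.1 hp
      rw [h3, h2 _ (hg j)]

end NProg

namespace NLPred

variable {α : Type}

/-- Reachability in a graph whose nodes are tuples of numbers. -/
theorem tc {d : ℕ} {R : List Bool → (α → ℕ) → (Fin d → ℕ) → (Fin d → ℕ) → Prop}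
    (hR : NLPred (α := α ⊕ Fin d ⊕ Fin d) fun w x => R w (fun a => x (.inl a))
      (fun i => x (.inr (.inl i))) fun i => x (.inr (.inr i))) (src tgt : Fin d → α) :
    NLPred fun w (x : α → ℕ) => Relation.ReflTransGen
      (fun g g' => R w x g g' ∧ ∀ i, g' i < numBound w) (fun i => x (src i)) fun i => x (tgt i) := by
  intro m f hf
  -- Layout of the variables: arguments below `m`, the current node from `m` on, the next node from
  -- `m + d` on, and the scratch space of the edge test from `m + 2 * d` on. One round guesses the
  -- next node, tests the edge, and copies the next node over the current one.
  obtain ⟨p, hp⟩ := hR (m + 2 * d)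
    (Sum.elim f (Sum.elim (fun i => m + i) fun i => m + d + i)) (by
      rintro (a | i | i)
      · exact (hf a).trans_le (by omega)
      · have := i.2
        simp only [Sum.elim_inr, Sum.elim_inl]
        omega
      · have := i.2
        simp only [Sum.elim_inr]
        omega)
  simp only [Sum.elim_inl, Sum.elim_inr] at hp
  let body : NProg := .seq (NProg.guessAll ((List.finRange d).map fun i : Fin d => m + d + i))
    (.seq p (NProg.copyBlock d m fun i => m + d + i))
  have hsound : ∀ w s s', (∀ i, s.2 i < numBound w) → body.Den w s s' →
      (∀ i < m, s'.2 i = s.2 i) ∧ R w (fun a => s.2 (f a)) (fun i : Fin d => s.2 (m + i))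
        (fun i : Fin d => s'.2 (m + i)) := by
    rintro w s s' hs ⟨t, h1, u, h2, h3⟩
    have ht := h1.bounded hs
    have hu := h2.bounded ht
    obtain ⟨-, h1, -⟩ := NProg.den_guessAll.1 h1
    obtain ⟨h4, h5⟩ := (hp w t.1 t.2 ht).1 u h2
    obtain ⟨-, h6, h7⟩ := (NProg.den_copyBlock (by intro i j; have := j.2; omega) hu).1 h3
    have h1' : ∀ i < m + d, t.2 i = s.2 i := by
      intro i hi
      refine h1 i fun h => ?_
      obtain ⟨j, -, hj⟩ := List.mem_map.1 h
      omega
    refine ⟨fun i hi => ?_, ?_⟩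
    · rw [h6 i (by omega), h5 i (by omega), h1' i (by omega)]
    · have e1 : (fun a => s.2 (f a)) = fun a => t.2 (f a) :=
        funext fun a => (h1' _ (by have := hf a; omega)).symm
      have e2 : (fun i : Fin d => s.2 (m + i)) = fun i : Fin d => t.2 (m + i) :=
        funext fun i => (h1' _ (by have := i.2; omega)).symm
      have e3 : (fun i : Fin d => s'.2 (m + i)) = fun i : Fin d => t.2 (m + d + i) :=
        funext fun i => by rw [h7, h5 _ (by have := i.2; omega)]
      rw [e1, e2, e3]
      exact h4
  have hcomplete : ∀ w s (g : Fin d → ℕ), (∀ i, s.2 i < numBound w) → (∀ i, g i < numBound w) →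
      R w (fun a => s.2 (f a)) (fun i : Fin d => s.2 (m + i)) g →
      ∃ s', body.Den w s s' ∧ ∀ i : Fin d, s'.2 (m + i) = g i := by
    intro w s g hs hg hr
    -- The store after the correct guess: the block of the next node holds `g`.
    let τ : ℕ → ℕ := fun i => if h : m + d ≤ i ∧ i < m + 2 * d then g ⟨i - (m + d), by omega⟩
      else s.2 i
    have hτ1 : ∀ i : Fin d, τ (m + d + i) = g i := by
      intro i
      have : m + d ≤ m + d + i ∧ m + d + i < m + 2 * d := by have := i.2; omega
      simp only [τ, this, and_self, dite_true]
      congr 1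
      ext
      simp
    have hτ2 : ∀ i < m + d, τ i = s.2 i := by
      intro i hi
      have : ¬ (m + d ≤ i ∧ i < m + 2 * d) := by omega
      simp only [τ, this, dite_false]
    have h1 : (NProg.guessAll ((List.finRange d).map fun i : Fin d => m + d + i)).Den w s (s.1, τ) := by
      refine NProg.den_guessAll.2 ⟨rfl, fun i hi => ?_, fun i hi => ?_⟩
      · have : ¬ (m + d ≤ i ∧ i < m + 2 * d) := fun h => hi
          (List.mem_map.2 ⟨⟨i - (m + d), by omega⟩, List.mem_finRange _, by simp; omega⟩)
        simp only [τ, this, dite_false]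
      · obtain ⟨j, -, rfl⟩ := List.mem_map.1 hi
        simp only [hτ1]
        exact hg j
    have ht := h1.bounded hs
    have e1 : (fun a => s.2 (f a)) = fun a => τ (f a) :=
      funext fun a => (hτ2 _ (by have := hf a; omega)).symm
    have e2 : (fun i : Fin d => s.2 (m + i)) = fun i : Fin d => τ (m + i) :=
      funext fun i => (hτ2 _ (by have := i.2; omega)).symm
    have e3 : g = fun i : Fin d => τ (m + d + i) := funext fun i => (hτ1 i).symm
    obtain ⟨u, h2⟩ := (hp w s.1 τ ht).2 (by rw [e1, e2, e3] at hr; exact hr)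
    have h5 := ((hp w s.1 τ ht).1 u h2).2
    -- The store after copying: `g` has become the current node, and the edge test may have changed
    -- the scratch space.
    let σ' : ℕ → ℕ := fun i => if h : m ≤ i ∧ i < m + d then g ⟨i - m, by omega⟩ else u.2 i
    have hσ : ∀ i : Fin d, σ' (m + i) = g i := by
      intro i
      have : m ≤ m + i ∧ m + i < m + d := by have := i.2; omega
      simp only [σ', this, and_self, dite_true]
      congr 1
      ext
      simp
    refine ⟨(u.1, σ'), ⟨_, h1, u, h2, ?_⟩, hσ⟩
    refine (NProg.den_copyBlock (by intro i j; have := j.2; omega) (h2.bounded ht)).2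
      ⟨rfl, fun i hi => ?_, fun j => ?_⟩
    · have : ¬ (m ≤ i ∧ i < m + d) := fun h => hi ⟨i - m, by omega⟩ (by simp; omega)
      simp only [σ', this, dite_false]
    · rw [h5 _ (by have := j.2; omega)]
      simp only [hσ, hτ1]
  refine ⟨.seq (NProg.copyBlock d m fun i => f (src i)) (.seq (.star body)
    (NProg.eqAll ((List.finRange d).map fun i : Fin d => (m + i, f (tgt i))))), fun w h σ hσ => ⟨?_, ?_⟩⟩
  · rintro s' ⟨t, h1, u, h2, h3₀⟩
    have ht := h1.bounded hσ
    obtain ⟨rfl, h3⟩ := NProg.den_eqAll.1 h3₀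
    obtain ⟨-, h4, h5⟩ := (NProg.den_copyBlock (by
      intro i j; have := hf (src i); omega) hσ).1 h1
    have key : (∀ i, s'.2 i < numBound w) ∧ (∀ i < m, s'.2 i = σ i) ∧ Relation.ReflTransGen
        (fun g g' => R w (fun a => σ (f a)) g g' ∧ ∀ i, g' i < numBound w)
        (fun i => σ (f (src i))) (fun i : Fin d => s'.2 (m + i)) := by
      clear h3 h3₀
      induction h2 with
      | refl =>
        refine ⟨ht, fun i hi => h4 i (by omega), ?_⟩
        rw [show (fun i : Fin d => t.2 (m + i)) = fun i => σ (f (src i)) from funext h5]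
      | @tail b c _ hbc ih =>
        obtain ⟨i1, i2, i3⟩ := ih
        obtain ⟨h6, h7⟩ := hsound w b c i1 hbc
        have hc := hbc.bounded i1
        refine ⟨hc, fun i hi => (h6 i hi).trans (i2 i hi), i3.tail ⟨?_, fun i => hc _⟩⟩
        rwa [show (fun a => σ (f a)) = fun a => b.2 (f a) from
          funext fun a => (i2 _ (hf a)).symm]
    obtain ⟨-, i2, i3⟩ := key
    refine ⟨?_, i2⟩
    rwa [show (fun i : Fin d => s'.2 (m + i)) = fun i => σ (f (tgt i)) from funext fun i => by
      rw [← i2 _ (hf _)]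
      exact h3 _ (List.mem_map.2 ⟨i, List.mem_finRange i, rfl⟩)] at i3
  · intro hr
    dsimp only at hr
    let τ : ℕ → ℕ := fun i => if h : m ≤ i ∧ i < m + d then σ (f (src ⟨i - m, by omega⟩)) else σ i
    have hτ : ∀ i : Fin d, τ (m + i) = σ (f (src i)) := by
      intro i
      have : m ≤ m + i ∧ m + i < m + d := by have := i.2; omega
      simp only [τ, this, and_self, dite_true]
      congr 3
      ext
      simp
    have h1 : (NProg.copyBlock d m fun i => f (src i)).Den w (h, σ) (h, τ) := by
      refine (NProg.den_copyBlock (by intro i j; have := hf (src i); omega) hσ).2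
        ⟨rfl, fun i hi => ?_, hτ⟩
      have : ¬ (m ≤ i ∧ i < m + d) := fun h => hi ⟨i - m, by omega⟩ (by simp; omega)
      simp only [τ, this, dite_false]
    have hτ' : ∀ i < m, τ i = σ i := by
      intro i hi
      have : ¬ (m ≤ i ∧ i < m + d) := by omega
      simp only [τ, this, dite_false]
    have key : ∃ s, Relation.ReflTransGen (body.Den w) (h, τ) s ∧ (∀ i < m, s.2 i = σ i) ∧
        (∀ i, s.2 i < numBound w) ∧ ∀ i : Fin d, s.2 (m + i) = σ (f (tgt i)) := by
      generalize hG : (fun i => σ (f (tgt i))) = G at hr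
      have hG' : ∀ i, σ (f (tgt i)) = G i := fun i => congrFun hG i
      simp only [hG']
      clear hG hG'
      induction hr with
      | refl => exact ⟨_, .refl, hτ', h1.bounded hσ, hτ⟩
      | @tail b c _ hbc ih =>
        obtain ⟨s, i1, i2, i3, i4⟩ := ih
        have e1 : (fun a => s.2 (f a)) = fun a => σ (f a) := funext fun a => i2 _ (hf a)
        have e2 : (fun i : Fin d => s.2 (m + i)) = b := funext i4
        obtain ⟨s', h2, h3⟩ := hcomplete w s c i3 hbc.2 (by rw [e1, e2]; exact hbc.1)
        exact ⟨s', i1.tail h2, fun i hi => ((hsound w s s' i3 h2).1 i hi).trans (i2 i hi),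
          h2.bounded i3, h3⟩
    obtain ⟨s, i1, i2, -, i4⟩ := key
    refine ⟨s, _, h1, s, i1, NProg.den_eqAll.2 ⟨rfl, fun q hq => ?_⟩⟩
    obtain ⟨i, -, rfl⟩ := List.mem_map.1 hq
    simp only [i4]
    exact (i2 _ (hf _)).symm

/-- Reachability in a graph whose nodes are pairs of numbers. -/
theorem tcPair {R : List Bool → (α → ℕ) → ℕ × ℕ → ℕ × ℕ → Prop}
    (hR : NLPred (α := α ⊕ Fin 2 ⊕ Fin 2) fun w x => R w (fun a => x (.inl a))
      (x (.inr (.inl 0)), x (.inr (.inl 1))) (x (.inr (.inr 0)), x (.inr (.inr 1)))) (a b c d : α) :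
    NLPred fun w (x : α → ℕ) => Relation.ReflTransGen
      (fun g g' => R w x g g' ∧ g'.1 < numBound w ∧ g'.2 < numBound w) (x a, x b) (x c, x d) := by
  refine (tc (R := fun w x g g' => R w x (g 0, g 1) (g' 0, g' 1)) hR ![a, b] ![c, d]).congr
    fun w x _ => ?_
  constructor
  · intro h
    have := h.lift (p := fun g g' => R w x (g 0, g 1) (g' 0, g' 1) ∧ ∀ i, g' i < numBound w)
      (fun g : ℕ × ℕ => (![g.1, g.2] : Fin 2 → ℕ)) (fun g g' h => ⟨h.1, fun i => by
        fin_cases i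
        exacts [h.2.1, h.2.2]⟩)
    convert this using 2 with i i
    · fin_cases i <;> rfl
    · fin_cases i <;> rfl
  · intro h
    have := h.lift (p := fun g g' => R w x g g' ∧ g'.1 < numBound w ∧ g'.2 < numBound w)
      (fun g : Fin 2 → ℕ => (g 0, g 1)) (fun g g' h => ⟨h.1, h.2 0, h.2 1⟩)
    exact this

end NLPred

/-! ### Counting -/

open Classical in
/-- The number of `k < n` with the property `p`. -/
noncomputable def propCount (p : ℕ → Prop) (n : ℕ) : ℕ := Nat.count p n

open Classical in
theorem propCount_zero (p : ℕ → Prop) : propCount p 0 = 0 := Nat.count_zero _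

open Classical in
theorem propCount_succ (p : ℕ → Prop) (n : ℕ) :
    propCount p (n + 1) = propCount p n + if p n then 1 else 0 := Nat.count_succ _ _

open Classical in
theorem propCount_le (p : ℕ → Prop) (n : ℕ) : propCount p n ≤ n := Nat.count_le _

open Classical in
theorem propCount_eq_self {p : ℕ → Prop} {n : ℕ} : propCount p n = n ↔ ∀ k < n, p k :=
  Nat.count_iff_forall

open Classical in
theorem propCount_eq_card (p : ℕ → Prop) (n : ℕ) :
    propCount p n = ((Finset.range n).filter p).card := Nat.count_eq_card_filter_range _ _

theorem propCount_congr {p q : ℕ → Prop} {n : ℕ} (h : ∀ k < n, p k ↔ q k) :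
    propCount p n = propCount q n := by
  induction n with
  | zero => rw [propCount_zero, propCount_zero]
  | succ n ih =>
    rw [propCount_succ, propCount_succ, ih fun k hk => h k (by omega)]
    have := h n (Nat.lt_succ_self n)
    congr 1
    split_ifs <;> tauto

/-! ### Terms -/

/-- Numerical functions with graphs decidable in nondeterministic logarithmic space. -/
def NLTerm {α : Type} (t : List Bool → (α → ℕ) → ℕ) : Prop :=
  NLPred fun w (x : Option α → ℕ) => x none = t w fun a => x (some a)

namespace NLTerm

variable {α : Type}

theorem var (a : α) : NLTerm fun _ (x : α → ℕ) => x a := NLPred.eq none (some a)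

/-- Both summands are at most the sum, which is the value of a bounded variable; so guessing them
among bounded numbers loses nothing. -/
theorem add {t u : List Bool → (α → ℕ) → ℕ} (ht : NLTerm t) (hu : NLTerm u) :
    NLTerm fun w x => t w x + u w x := by
  refine NLPred.congr (NLPred.ex (P := fun w (x : Option α → ℕ) z => ∃ y < numBound w,
    z = t w (fun a => x (some a)) ∧ y = u w (fun a => x (some a)) ∧ z + y = x none) (NLPred.ex ?_))
    (fun w x hx => ?_)
  · exact (NLPred.rename ht fun a => a.elim (some none) fun a => some (some (some a))).and
      ((NLPred.rename hu fun a => a.elim none fun a => some (some (some a))).and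
        (NLPred.add (some none) none (some (some none))))
  · dsimp only
    constructor
    · intro h
      have := hx none
      exact ⟨_, by omega, _, by omega, rfl, rfl, h.symm⟩
    · rintro ⟨z, -, y, -, rfl, rfl, h⟩
      exact h.symm

theorem const (k : ℕ) : NLTerm fun _ (_ : α → ℕ) => k := by
  induction k with
  | zero => exact NLPred.eq_zero none
  | succ k ih =>
    refine NLPred.congr (NLPred.ex (P := fun w (x : Option α → ℕ) z => z = k ∧ x none = z + 1) ?_)
      (fun w x hx => ?_)
    · exact (NLPred.rename ih fun a => a.elim none fun a => some (some a)).and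
        (NLPred.succ none (some none))
    · have := hx none
      dsimp only
      exact ⟨fun h => ⟨k, by omega, rfl, h⟩, fun ⟨z, _, h1, h2⟩ => by omega⟩

theorem mul_const {t : List Bool → (α → ℕ) → ℕ} (ht : NLTerm t) (k : ℕ) :
    NLTerm fun w x => t w x * k := by
  induction k with
  | zero => exact const 0
  | succ k ih => exact ih.add ht

/-- Multiplication is iterated addition, that is, reachability along the pairs (i, i * x b).
Intermediate products do not exceed the final one and hence stay bounded. -/
theorem mul_var (a b : α) : NLTerm fun _ (x : α → ℕ) => x a * x b := by
  refine NLPred.congr (NLPred.ex (P := fun w (x : Option α → ℕ) z => z = 0 ∧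
    Relation.ReflTransGen (fun g g' => (g'.1 = g.1 + 1 ∧ g.2 + x (some b) = g'.2) ∧
      g'.1 < numBound w ∧ g'.2 < numBound w) (z, z) (x (some a), x none)) ?_) fun w x hx => ?_
  · exact (NLPred.eq_zero none).and (NLPred.tcPair
      (R := fun w (x : Option (Option α) → ℕ) g g' =>
        g'.1 = g.1 + 1 ∧ g.2 + x (some (some b)) = g'.2)
      ((NLPred.succ _ _).and (NLPred.add _ _ _)) none none (some (some a)) (some none))
  · constructor
    · intro h
      refine ⟨0, by simp [numBound], rfl, ?_⟩
      dsimp only at h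
      rw [h]
      have key : ∀ i ≤ x (some a), Relation.ReflTransGen (fun g g' : ℕ × ℕ =>
          (g'.1 = g.1 + 1 ∧ g.2 + x (some b) = g'.2) ∧
          g'.1 < numBound w ∧ g'.2 < numBound w) (0, 0) (i, i * x (some b)) := by
        intro i hi
        induction i with
        | zero => simpa using .refl
        | succ i ih =>
          refine (ih (by omega)).tail ⟨⟨rfl, (add_one_mul _ _).symm⟩, ?_, ?_⟩
          · exact lt_of_le_of_lt hi (hx _)
          · refine lt_of_le_of_lt (Nat.mul_le_mul_right _ hi) ?_
            rw [← h]
            exact hx _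
      exact key _ le_rfl
    · rintro ⟨z, -, rfl, h⟩
      have key : ∀ g : ℕ × ℕ, Relation.ReflTransGen (fun g g' : ℕ × ℕ =>
          (g'.1 = g.1 + 1 ∧ g.2 + x (some b) = g'.2) ∧
          g'.1 < numBound w ∧ g'.2 < numBound w) (0, 0) g → g.2 = g.1 * x (some b) := by
        intro g hg
        induction hg with
        | refl => simp
        | tail _ h1 ih => rw [h1.1.1, ← h1.1.2, ih, add_one_mul]
      exact key _ h

end NLTerm

namespace NLPred

variable {α : Type}

theorem bit_term (b : Bool) {t : List Bool → (α → ℕ) → ℕ} (ht : NLTerm t) :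
    NLPred fun w x => w[t w x]? = some b := by
  refine NLPred.congr (NLPred.ex (P := fun w (x : α → ℕ) z => z = t w x ∧ w[z]? = some b)
    (NLPred.and ht (bit b none))) fun w x _ => ?_
  constructor
  · intro h
    obtain ⟨h', -⟩ := List.getElem?_eq_some_iff.1 h
    have := lt_two_pow_wordLength w
    exact ⟨_, by rw [numBound]; omega, rfl, h⟩
  · rintro ⟨z, -, rfl, h⟩
    exact h

theorem length_eq_term {t : List Bool → (α → ℕ) → ℕ} (ht : NLTerm t) :
    NLPred fun w x => w.length = t w x := by
  refine NLPred.congr (NLPred.ex (P := fun w (x : α → ℕ) z => z = t w x ∧ z = w.length)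
    (NLPred.and ht (length_eq none))) fun w x _ => ?_
  constructor
  · intro h
    have := lt_two_pow_wordLength w
    exact ⟨_, by rw [numBound, ← h]; omega, rfl, h.symm⟩
  · rintro ⟨z, -, rfl, h⟩
    exact h.symm

/-- A walk over all candidates increments a counter whenever it chooses to verify `Q`. It may skip a
candidate but cannot count a wrong one, so exactly the lower bounds on the count are certified. -/
theorem count_ge {Q : List Bool → (α → ℕ) → ℕ → Prop}
    (hQ : NLPred fun w (x : Option α → ℕ) => Q w (fun a => x (some a)) (x none)) (N c : α) :
    NLPred fun w (x : α → ℕ) => x c ≤ propCount (Q w x) (x N) := by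
  refine NLPred.congr (NLPred.ex (P := fun w (x : α → ℕ) z => z = 0 ∧
    Relation.ReflTransGen (fun g g' => (g'.1 = g.1 + 1 ∧ (g'.2 = g.2 ∨ g'.2 = g.2 + 1 ∧ Q w x g.1)) ∧
      g'.1 < numBound w ∧ g'.2 < numBound w) (z, z) (x N, x c)) ?_) fun w x hx => ?_
  · refine (NLPred.eq_zero none).and (NLPred.tcPair
      (R := fun w (x : Option α → ℕ) g g' => g'.1 = g.1 + 1 ∧
        (g'.2 = g.2 ∨ g'.2 = g.2 + 1 ∧ Q w (fun a => x (some a)) g.1)) ?_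
      none none (some N) (some c))
    exact (NLPred.succ _ _).and ((NLPred.eq _ _).or ((NLPred.succ _ _).and
      (NLPred.rename (α := Option α ⊕ Fin 2 ⊕ Fin 2) hQ fun a =>
        a.elim (.inr (.inl 0)) fun a => .inl (some a))))
  · constructor
    · intro h
      refine ⟨0, by simp [numBound], rfl, ?_⟩
      have key : ∀ i ≤ x N, ∀ k ≤ propCount (Q w x) i, k < numBound w →
          Relation.ReflTransGen (fun g g' : ℕ × ℕ =>
          (g'.1 = g.1 + 1 ∧ (g'.2 = g.2 ∨ g'.2 = g.2 + 1 ∧ Q w x g.1)) ∧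
          g'.1 < numBound w ∧ g'.2 < numBound w) (0, 0) (i, k) := by
        intro i
        induction i with
        | zero =>
          intro _ k hk _
          rw [propCount_zero, Nat.le_zero] at hk
          rw [hk]
        | succ i ih =>
          intro hi k hk hkB
          have hiB : i + 1 < numBound w := lt_of_le_of_lt hi (hx _)
          by_cases hk' : k ≤ propCount (Q w x) i
          · exact (ih (by omega) k hk' hkB).tail ⟨⟨rfl, .inl rfl⟩, hiB, hkB⟩
          · rw [propCount_succ] at hk
            split at hk
            · obtain ⟨k, rfl⟩ : ∃ k', k = k' + 1 := ⟨k - 1, by omega⟩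
              exact (ih (by omega) k (by omega) (by omega)).tail
                ⟨⟨rfl, .inr ⟨rfl, ‹_›⟩⟩, hiB, hkB⟩
            · omega
      exact key _ le_rfl _ h (hx _)
    · rintro ⟨z, -, rfl, h⟩
      have key : ∀ g : ℕ × ℕ, Relation.ReflTransGen (fun g g' : ℕ × ℕ =>
          (g'.1 = g.1 + 1 ∧ (g'.2 = g.2 ∨ g'.2 = g.2 + 1 ∧ Q w x g.1)) ∧
          g'.1 < numBound w ∧ g'.2 < numBound w) (0, 0) g → g.2 ≤ propCount (Q w x) g.1 := by
        intro g hg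
        induction hg with
        | refl => exact Nat.zero_le _
        | tail _ h1 ih =>
          rw [h1.1.1, propCount_succ]
          rcases h1.1.2 with h2 | ⟨h2, h3⟩
          · omega
          · rw [if_pos h3]
            omega
      exact key _ h

/-- All numbers below the bound satisfy `Q` if and only if their count reaches the bound; no
negation is needed. -/
theorem forall_lt {Q : List Bool → (α → ℕ) → ℕ → Prop}
    (hQ : NLPred fun w (x : Option α → ℕ) => Q w (fun a => x (some a)) (x none)) (N : α) :
    NLPred fun w (x : α → ℕ) => ∀ u < x N, Q w x u := by
  refine (count_ge hQ N N).congr fun w x _ => ?_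
  rw [← propCount_eq_self]
  exact ⟨fun h => h.ge, fun h => le_antisymm (propCount_le _ _) h⟩

theorem exists_lt {Q : List Bool → (α → ℕ) → ℕ → Prop}
    (hQ : NLPred fun w (x : Option α → ℕ) => Q w (fun a => x (some a)) (x none)) (N : α) :
    NLPred fun w (x : α → ℕ) => ∃ u < x N, Q w x u := by
  refine (NLPred.ex (P := fun w x z => z < x N ∧ Q w x z) ((lt none (some N)).and hQ)).congr
    fun w x hx => ?_
  exact ⟨fun ⟨u, h1, h2⟩ => ⟨u, h1.trans (hx N), h1, h2⟩, fun ⟨u, _, h1, h2⟩ => ⟨u, h1, h2⟩⟩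

end NLPred

/-- Languages defined by predicates decidable in nondeterministic logarithmic space are in NL. -/
theorem NLPred.mem_NL {P : List Bool → (Empty → ℕ) → Prop} (hP : NLPred P) (A : Language Bool)
    (hA : ∀ w, w ∈ A ↔ P w Empty.elim) : A ∈ NL := by
  obtain ⟨p, hp⟩ := hP 0 Empty.elim (fun a => a.elim)
  refine mem_NL_of_nprog p A fun w => ?_
  have := hp w (w.length + 1) (fun _ => 0) (by simp [numBound])
  rw [hA, show (Empty.elim : Empty → ℕ) = fun a => 0 from funext fun a => a.elim]
  exact ⟨this.2, fun ⟨t, ht⟩ => (this.1 t ht).1⟩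

/-! ### Inductive counting -/

/-- There is a walk of length `d` in the graph `R` on `{0, …, n - 1}` that ends in `v`. -/
def WalkTo (n : ℕ) (R : ℕ → ℕ → Prop) : ℕ → ℕ → Prop
  | 0, v => v < n
  | d + 1, v => ∃ u < n, WalkTo n R d u ∧ R u v

theorem NLPred.rename_pair {α β : Type} {R : List Bool → (α → ℕ) → ℕ → ℕ → Prop}
    (hR : NLPred fun w (x : Option (Option α) → ℕ) =>
      R w (fun a => x (some (some a))) (x (some none)) (x none)) (f : α → β) (u v : β) :
    NLPred fun w (x : β → ℕ) => R w (fun a => x (f a)) (x u) (x v) :=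
  NLPred.rename hR fun o => o.elim v fun o => o.elim u f

section Counting

variable {α : Type}

/-- The length travels along as a first component, so that walks of a prescribed length become plain
reachability. The hypothesis `hN` keeps all vertices bounded. -/
theorem NLPred.walkTo {R : List Bool → (α → ℕ) → ℕ → ℕ → Prop} {N : α}
    (hR : NLPred fun w (x : Option (Option α) → ℕ) =>
      R w (fun a => x (some (some a))) (x (some none)) (x none))
    (hN : ∀ w x u v, R w x u v → u < x N ∧ v < x N) :
    NLPred fun w (x : Option (Option α) → ℕ) => WalkTo (x (some (some N)))
      (R w fun a => x (some (some a))) (x (some none)) (x none) := by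
  refine NLPred.congr (NLPred.ex (P := fun w (x : Option (Option α) → ℕ) z => z = 0 ∧
    ∃ s < x (some (some N)), Relation.ReflTransGen (fun g g' => (g'.1 = g.1 + 1 ∧
      R w (fun a => x (some (some a))) g.2 g'.2) ∧ g'.1 < numBound w ∧ g'.2 < numBound w)
      (z, s) (x (some none), x none)) ?_) fun w x hx => ?_
  · refine (NLPred.eq_zero none).and (NLPred.exists_lt ?_ _)
    refine NLPred.tcPair (R := fun w (x : Option (Option (Option (Option α))) → ℕ) g g' =>
      g'.1 = g.1 + 1 ∧ R w (fun a => x (some (some (some (some a))))) g.2 g'.2) ?_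
      (some none) none (some (some (some none))) (some (some none))
    exact (NLPred.succ _ _).and (NLPred.rename_pair hR _ _ _)
  · have hR' := hN w fun a => x (some (some a))
    have hNB := hx (some (some N))
    generalize R w (fun a => x (some (some a))) = r at *
    generalize x (some (some N)) = n at *
    have hd := hx (some none)
    generalize x (some none) = d at *
    generalize x none = v at *
    constructor
    · intro h
      refine ⟨0, by simp [numBound], rfl, ?_⟩
      induction d generalizing v with
      | zero => exact ⟨v, h, .refl⟩
      | succ d ih =>
        obtain ⟨u, hu, h1, h2⟩ := h
        obtain ⟨s, hs, h3⟩ := ih (by omega) u h1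
        exact ⟨s, hs, h3.tail ⟨⟨rfl, h2⟩, hd, (hR' _ _ h2).2.trans hNB⟩⟩
    · rintro ⟨z, -, rfl, s, hs, h⟩
      have key : ∀ g : ℕ × ℕ, Relation.ReflTransGen (fun g g' : ℕ × ℕ => (g'.1 = g.1 + 1 ∧
          r g.2 g'.2) ∧ g'.1 < numBound w ∧ g'.2 < numBound w) (0, s) g → WalkTo n r g.1 g.2 := by
        intro g hg
        induction hg with
        | refl => exact hs
        | tail _ h1 ih =>
          rw [h1.1.1]
          exact ⟨_, (hR' _ _ h1.1.2).1, ih, h1.1.2⟩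
      exact key _ h

/-- If `c` is the number of ends of walks of length `d`, then this certifies that `c'` is the number
of ends of walks of length `d + 1`; here `R'` is the complement of `R`. -/
def CountStep (B n : ℕ) (R R' : ℕ → ℕ → Prop) (d c c' : ℕ) : Prop :=
  c' ≤ propCount (fun v => ∃ u < n, WalkTo n R d u ∧ R u v) n ∧
    ∃ k < B, c' + k = n ∧
      k ≤ propCount (fun v => c ≤ propCount (fun u => WalkTo n R d u ∧ R' u v) n) n

/-- A certificate for the absence of walks of length `n`. -/
def CountCert (B n : ℕ) (R R' : ℕ → ℕ → Prop) : Prop :=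
  Relation.ReflTransGen (fun g g' : ℕ × ℕ => (g'.1 = g.1 + 1 ∧ CountStep B n R R' g.1 g.2 g'.2) ∧
    g'.1 < B ∧ g'.2 < B) (0, n) (n, 0)

-- The core of inductive counting. If `c` is the exact number of ends at distance `d`, then finding
-- `c` such ends without an edge to `v` exhausts them all, and so proves that `v` is not an end at
-- distance `d + 1`. Thus both membership and non-membership have positive certificates, and these
-- pin down the next count.
open Classical in
theorem countStep_iff {B n : ℕ} {R R' : ℕ → ℕ → Prop} (hn : n < B)
    (hR : ∀ u < n, ∀ v < n, R' u v ↔ ¬ R u v) {d c' : ℕ} :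
    CountStep B n R R' d (propCount (WalkTo n R d) n) c' ↔
      c' = propCount (WalkTo n R (d + 1)) n := by
  have h1 : propCount (fun v => ∃ u < n, WalkTo n R d u ∧ R u v) n =
      propCount (WalkTo n R (d + 1)) n := rfl
  have h2 : ∀ v < n, (propCount (WalkTo n R d) n ≤ propCount (fun u => WalkTo n R d u ∧ R' u v) n ↔
      ¬ WalkTo n R (d + 1) v) := by
    intro v hv
    constructor
    · rintro h ⟨u, hu, h3, h4⟩
      have : propCount (fun u => WalkTo n R d u ∧ R' u v) n < propCount (WalkTo n R d) n := by
        rw [propCount_eq_card, propCount_eq_card]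
        refine Finset.card_lt_card (Finset.ssubset_iff_of_subset ?_ |>.2 ⟨u, ?_, ?_⟩)
        · intro u hu
          simp only [Finset.mem_filter, Finset.mem_range] at hu ⊢
          exact ⟨hu.1, hu.2.1⟩
        · simpa using ⟨hu, h3⟩
        · simp only [Finset.mem_filter, Finset.mem_range, not_and]
          intro _ _
          rw [hR u hu v hv]
          exact not_not.2 h4
      omega
    · intro h
      refine le_of_eq ?_
      refine propCount_congr fun u hu => ?_
      refine ⟨fun h3 => ⟨h3, (hR u hu v hv).2 fun h4 => h ⟨u, hu, h3, h4⟩⟩, fun h3 => h3.1⟩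
  have h3 : propCount (fun v => propCount (WalkTo n R d) n ≤
      propCount (fun u => WalkTo n R d u ∧ R' u v) n) n =
      propCount (fun v => ¬ WalkTo n R (d + 1) v) n := propCount_congr h2
  have h4 : propCount (WalkTo n R (d + 1)) n + propCount (fun v => ¬ WalkTo n R (d + 1) v) n = n := by
    rw [propCount_eq_card, propCount_eq_card,
      Finset.card_filter_add_card_filter_not, Finset.card_range]
  unfold CountStep
  rw [h1, h3]
  constructor
  · rintro ⟨h5, k, _, h6, h7⟩
    -- The two lower bounds `c'` and `k` add up to `n`, and so do the two counts by `h4`; hence both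
    -- bounds are attained.
    omega
  · intro h
    exact ⟨h.le, _, lt_of_le_of_lt (by omega) hn, by rw [h]; exact h4, le_rfl⟩

-- The count starts exactly, with all `n` vertices as ends of walks of length 0, and each step keeps
-- it exact. Reaching the count 0 at length `n` is therefore a proof that there is no such walk.
open Classical in
theorem countCert_iff {B n : ℕ} {R R' : ℕ → ℕ → Prop} (hn : n < B)
    (hR : ∀ u < n, ∀ v < n, R' u v ↔ ¬ R u v) :
    CountCert B n R R' ↔ ∀ v < n, ¬ WalkTo n R n v := by
  have h0 : propCount (WalkTo n R 0) n = n := by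
    rw [propCount_eq_self]
    exact fun v hv => hv
  have h1 : (∀ v < n, ¬ WalkTo n R n v) ↔ propCount (WalkTo n R n) n = 0 := by
    rw [propCount_eq_card, Finset.card_eq_zero, Finset.filter_eq_empty_iff]
    simp
  rw [h1]
  constructor
  · intro h
    have key : ∀ g : ℕ × ℕ, Relation.ReflTransGen (fun g g' : ℕ × ℕ =>
        (g'.1 = g.1 + 1 ∧ CountStep B n R R' g.1 g.2 g'.2) ∧ g'.1 < B ∧ g'.2 < B) (0, n) g →
        g.2 = propCount (WalkTo n R g.1) n := by
      intro g hg
      induction hg with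
      | refl => exact h0.symm
      | tail _ h2 ih =>
        have := h2.1.2
        rw [ih, countStep_iff hn hR] at this
        rw [this, h2.1.1]
    exact (key _ h).symm
  · intro h
    have key : ∀ d ≤ n, Relation.ReflTransGen (fun g g' : ℕ × ℕ =>
        (g'.1 = g.1 + 1 ∧ CountStep B n R R' g.1 g.2 g'.2) ∧ g'.1 < B ∧ g'.2 < B) (0, n)
        (d, propCount (WalkTo n R d) n) := by
      intro d hd
      induction d with
      | zero => rw [h0]
      | succ d ih =>
        refine (ih (by omega)).tail ⟨⟨rfl, (countStep_iff hn hR).2 rfl⟩, by dsimp only; omega, ?_⟩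
        exact lt_of_le_of_lt (propCount_le _ _) hn
    have := key n le_rfl
    rwa [h] at this

theorem NLPred.countCert {R R' : List Bool → (α → ℕ) → ℕ → ℕ → Prop} {N : α}
    (hR : NLPred fun w (x : Option (Option α) → ℕ) =>
      R w (fun a => x (some (some a))) (x (some none)) (x none))
    (hR' : NLPred fun w (x : Option (Option α) → ℕ) =>
      R' w (fun a => x (some (some a))) (x (some none)) (x none))
    (hN : ∀ w x u v, R w x u v → u < x N ∧ v < x N) :
    NLPred fun w (x : α → ℕ) => CountCert (numBound w) (x N) (R w x) (R' w x) := by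
  have hW := NLPred.walkTo hR hN
  refine NLPred.congr (NLPred.ex (P := fun w (x : α → ℕ) z => z = 0 ∧ Relation.ReflTransGen
    (fun g g' : ℕ × ℕ => (g'.1 = g.1 + 1 ∧
      CountStep (numBound w) (x N) (R w x) (R' w x) g.1 g.2 g'.2) ∧
      g'.1 < numBound w ∧ g'.2 < numBound w) (z, x N) (x N, z)) ?_) fun w x hx => ?_
  · refine (NLPred.eq_zero none).and (NLPred.tcPair (R := fun w (x : Option α → ℕ) g g' =>
      g'.1 = g.1 + 1 ∧ CountStep (numBound w) (x (some N)) (R w fun a => x (some a))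
        (R' w fun a => x (some a)) g.1 g.2 g'.2) ?_ none (some N) (some N) none)
    refine (NLPred.succ _ _).and (NLPred.and ?_ ?_)
    · refine NLPred.count_ge (Q := fun w (x : Option α ⊕ Fin 2 ⊕ Fin 2 → ℕ) v =>
        ∃ u < x (.inl (some N)), WalkTo (x (.inl (some N))) (R w fun a => x (.inl (some a)))
          (x (.inr (.inl 0))) u ∧ R w (fun a => x (.inl (some a))) u v) ?_ _ _
      refine NLPred.exists_lt ?_ _
      exact (NLPred.rename_pair (R := fun w x => WalkTo (x N) (R w x)) hW
        (fun a => some (some (Sum.inl (some a)))) (some (some (Sum.inr (Sum.inl 0)))) none).and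
        (NLPred.rename_pair hR (fun a => some (some (Sum.inl (some a)))) none (some none))
    · refine NLPred.ex ((NLPred.add _ _ _).and ?_)
      refine NLPred.count_ge (Q := fun w (x : Option (Option α ⊕ Fin 2 ⊕ Fin 2) → ℕ) v =>
        x (some (Sum.inr (Sum.inl 1))) ≤ propCount (fun u => WalkTo (x (some (Sum.inl (some N))))
          (R w fun a => x (some (Sum.inl (some a)))) (x (some (Sum.inr (Sum.inl 0)))) u ∧
          R' w (fun a => x (some (Sum.inl (some a)))) u v)
          (x (some (Sum.inl (some N))))) ?_ _ _
      refine NLPred.count_ge (Q := fun w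
        (x : Option (Option (Option α ⊕ Fin 2 ⊕ Fin 2)) → ℕ) u =>
        WalkTo (x (some (some (Sum.inl (some N))))) (R w fun a => x (some (some (Sum.inl (some a)))))
          (x (some (some (Sum.inr (Sum.inl 0))))) u ∧
          R' w (fun a => x (some (some (Sum.inl (some a))))) u (x none)) ?_ _ _
      exact (NLPred.rename_pair (R := fun w x => WalkTo (x N) (R w x)) hW
        (fun a => some (some (some (Sum.inl (some a))))) (some (some (some (Sum.inr (Sum.inl 0))))) none).and
        (NLPred.rename_pair hR' (fun a => some (some (some (Sum.inl (some a))))) none (some none))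
  · exact ⟨fun h => ⟨0, by simp [numBound], rfl, h⟩, fun ⟨z, _, h1, h2⟩ => by
      rw [h1] at h2; exact h2⟩

end Counting

/-! ### Acyclic frames -/

/-- `WalkTo` bounds the vertices from which an edge departs, and the end of a walk only when its
length is 0. The extra disjunct accounts for an unbounded last vertex. -/
theorem walkTo_iff_exists {n : ℕ} {R : ℕ → ℕ → Prop} {d v : ℕ} :
    WalkTo n R d v ↔ ∃ p : ℕ → ℕ, (∀ i ≤ d, p i < n ∨ (i = d ∧ 0 < d)) ∧
      (∀ i < d, R (p i) (p (i + 1))) ∧ p d = v := by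
  induction d generalizing v with
  | zero =>
    constructor
    · intro h
      exact ⟨fun _ => v, fun _ _ => .inl h, fun i hi => by omega, rfl⟩
    · rintro ⟨p, h1, -, rfl⟩
      exact (h1 0 le_rfl).resolve_right (by omega)
  | succ d ih =>
    constructor
    · rintro ⟨u, hu, h1, h2⟩
      obtain ⟨p, h3, h4, rfl⟩ := ih.1 h1
      refine ⟨Function.update p (d + 1) v, fun i hi => ?_, fun i hi => ?_, by simp⟩
      · rcases Nat.lt_or_ge d i with h | h
        · exact .inr ⟨by omega, by omega⟩
        · rw [Function.update_of_ne (by omega)]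
          rcases h3 i h with h | ⟨rfl, -⟩
          exacts [.inl h, .inl hu]
      · rw [Function.update_of_ne (by omega)]
        rcases Nat.lt_or_ge i d with h | h
        · rw [Function.update_of_ne (by omega)]
          exact h4 i h
        · obtain rfl : i = d := by omega
          simpa using h2
    · rintro ⟨p, h1, h2, rfl⟩
      refine ⟨p d, (h1 d (by omega)).resolve_right (by omega), ih.2 ⟨p, fun i hi => ?_,
        fun i hi => h2 i (by omega), rfl⟩, h2 d (by omega)⟩
      exact .inl ((h1 i (by omega)).resolve_right (by omega))

/-- A finite frame is acyclic if and only if states with a self-loop have no other outgoing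
transition, and there is no long walk without self-loops. -/
theorem acyclicFrame_iff {n : ℕ} (δ : Fin n → Fin n → Prop) :
    AcyclicFrame δ ↔ (∀ s, δ s s → ∀ t, δ s t → t = s) ∧
      ¬ ∃ p : ℕ → Fin n, ∀ i < n, δ (p i) (p (i + 1)) ∧ p i ≠ p (i + 1) := by
  constructor
  · intro h
    constructor
    · intro s hs
      exact (h 0 (fun _ => s) ⟨fun i hi => by omega, hs⟩).2
    · rintro ⟨p, hp⟩
      -- The walk visits `n + 1` positions among `n` states, so a state recurs. The segment between
      -- the two visits is a loop, hence constant by acyclicity, although its transitions are not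
      -- self-loops.
      obtain ⟨i, j, hij, hp'⟩ := Fintype.exists_ne_map_eq_of_card_lt
        (fun i : Fin (n + 1) => p i) (by simp)
      have key : ∀ i j : ℕ, i < j → j ≤ n → p i = p j → False := by
        intro i j hij hj he
        obtain ⟨k, rfl⟩ : ∃ k, j = i + k + 1 := ⟨j - i - 1, by omega⟩
        have hl : IsLoop δ k fun l => p (i + l) := by
          refine ⟨fun l hl => (hp (i + l) (by omega)).1, ?_⟩
          have := (hp (i + k) (by omega)).1
          rw [← he] at this
          exact this
        have := (h k _ hl).1
        refine (hp i (by omega)).2 ?_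
        rcases k with _ | k
        · exact he
        · exact (this 1 (by omega)).symm
      rcases lt_trichotomy i.1 j.1 with h1 | h1 | h1
      · exact key i j h1 (by omega) hp'
      · exact hij (Fin.ext h1)
      · exact key j i h1 (by omega) hp'.symm
  · rintro ⟨h1, h2⟩ m s ⟨h3, h4⟩
    -- The loop is run forever. Among its first `n` transitions there must be a self-loop, and from
    -- there on the run cannot leave the state.
    let p : ℕ → Fin n := fun i => s (i % (m + 1))
    have hp : ∀ i, δ (p i) (p (i + 1)) := by
      intro i
      have hi : i % (m + 1) < m + 1 := Nat.mod_lt i (Nat.succ_pos m)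
      simp only [p]
      rcases Nat.lt_or_ge (i % (m + 1)) m with h | h
      · have : (i + 1) % (m + 1) = i % (m + 1) + 1 := by
          rw [Nat.add_mod, Nat.mod_eq_of_lt (a := i % (m + 1) + 1 % (m + 1))]
          · rw [Nat.mod_eq_of_lt (a := 1) (by omega)]
          · rw [Nat.mod_eq_of_lt (a := 1) (by omega)]
            omega
        rw [this]
        exact h3 _ h
      · have hm : i % (m + 1) = m := by omega
        have : (i + 1) % (m + 1) = 0 := by
          rw [← Nat.dvd_iff_mod_eq_zero]
          refine ⟨i / (m + 1) + 1, ?_⟩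
          have := Nat.mod_add_div i (m + 1)
          rw [mul_add, mul_one]
          omega
        rw [hm, this]
        exact h4
    obtain ⟨i, hi⟩ : ∃ i, p i = p (i + 1) := by
      by_contra hne
      exact h2 ⟨p, fun i _ => ⟨hp i, fun h => hne ⟨i, h⟩⟩⟩
    have hloop : δ (p i) (p i) := by
      have := hp i
      rwa [← hi] at this
    have hconst : ∀ k, p (i + k) = p i := by
      intro k
      induction k with
      | zero => rfl
      | succ k ih =>
        have := hp (i + k)
        rw [ih] at this
        exact h1 _ hloop _ this
    have hall : ∀ j ≤ m, s j = p i := by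
      intro j hj
      -- Adding enough periods to `j` gives an index after `i`, where the run is already constant.
      have : p (i + (j + (m + 1) * (i + 1) - i)) = s j := by
        simp only [p]
        have : i ≤ j + (m + 1) * (i + 1) := by nlinarith
        rw [Nat.add_sub_cancel' this, Nat.add_mul_mod_self_left, Nat.mod_eq_of_lt (by omega)]
      rw [← this, hconst]
    have h0 := hall 0 (Nat.zero_le _)
    refine ⟨fun j hj => (hall j hj).trans h0.symm, fun t ht => ?_⟩
    rw [h0] at ht ⊢
    exact h1 _ hloop _ ht

/-! ### Existential formulas -/

namespace HyperLTL

variable {AP : Type}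

/-- The quantifier-free part of a formula. -/
def matrix : HyperLTL AP → HyperBody AP
  | .ex _ φ => φ.matrix
  | .all _ φ => φ.matrix
  | .body ψ => ψ

/-- The quantified variables. -/
def boundVars : HyperLTL AP → Set ℕ
  | .ex x φ => insert x φ.boundVars
  | .all x φ => insert x φ.boundVars
  | .body _ => ∅

theorem finite_boundVars (φ : HyperLTL AP) : φ.boundVars.Finite := by
  induction φ with
  | ex x φ ih => exact ih.insert x
  | all x φ ih => exact ih.insert x
  | body ψ => exact Set.finite_empty

instance (φ : HyperLTL AP) : Finite φ.boundVars := φ.finite_boundVars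

/-- An existential prefix amounts to one simultaneous choice of traces for the bound variables. If a
variable is quantified repeatedly the innermost choice counts, which explains the case distinction
in the proof. -/
theorem IsEStar.sat_iff {φ : HyperLTL AP} (h : φ.IsEStar) {T : Set (HTrace AP)}
    {A : Assignment AP} : φ.Sat T A ↔ ∃ A' : Assignment AP, (∀ x ∉ φ.boundVars, A' x = A x) ∧
      (∀ x ∈ φ.boundVars, ∃ t ∈ T, A' x = some t) ∧ φ.matrix.Sat A' := by
  induction φ generalizing A with
  | ex x φ ih =>
    constructor
    · rintro ⟨t, ht, h'⟩
      obtain ⟨A', h1, h2, h3⟩ := (ih h).1 h'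
      refine ⟨A', fun y hy => ?_, fun y hy => ?_, h3⟩
      · rw [h1 y fun hy' => hy (.inr hy'), Function.update_of_ne fun h => hy (.inl h)]
      · by_cases hy' : y ∈ φ.boundVars
        · exact h2 y hy'
        · obtain rfl := hy.resolve_right hy'
          exact ⟨t, ht, by rw [h1 y hy', Function.update_self]⟩
    · rintro ⟨A', h1, h2, h3⟩
      obtain ⟨t, ht, hx⟩ := h2 x (.inl rfl)
      refine ⟨t, ht, (ih h).2 ⟨A', fun y hy => ?_, fun y hy => h2 y (.inr hy), h3⟩⟩
      by_cases hyx : y = x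
      · rw [hyx, hx, Function.update_self]
      · rw [Function.update_of_ne hyx, h1 y fun h => h.elim hyx hy]
  | all x φ ih => exact h.elim
  | body ψ =>
    constructor
    · exact fun h => ⟨A, fun _ _ => rfl, fun x hx => hx.elim, h⟩
    · rintro ⟨A', h1, -, h3⟩
      have : A' = A := funext fun x => h1 x id
      exact this ▸ h3

/-- The witnesses remain available in the larger set, and the quantifier-free part does not refer to
the set. -/
theorem IsEStar.sat_mono {φ : HyperLTL AP} (h : φ.IsEStar) {T T' : Set (HTrace AP)} (hT : T ⊆ T')
    {A : Assignment AP} (hs : φ.Sat T A) : φ.Sat T' A := by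
  obtain ⟨A', h1, h2, h3⟩ := h.sat_iff.1 hs
  exact h.sat_iff.2 ⟨A', h1, fun x hx => (h2 x hx).imp fun t ht => ⟨hT ht.1, ht.2⟩, h3⟩

end HyperLTL

/-- For existential formulas, having a repair is equivalent to satisfaction. -/
theorem Kripke.hasRepair_iff_models {AP S : Type} (K : Kripke AP S) {φ : HyperLTL AP}
    (h : φ.IsEStar) : K.HasRepair φ ↔ K.Models φ := by
  constructor
  · rintro ⟨K', h1, h2, h3, h4⟩
    refine h.sat_mono ?_ h4
    rintro t ⟨p, hp, hδ, ht⟩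
    exact ⟨p, hp.trans h1, fun i => h2 _ _ (hδ i), fun i => by rw [ht, h3]⟩
  · exact fun h => ⟨K, rfl, fun _ _ => id, rfl, h⟩

namespace HyperBody

variable {AP : Type} {V : Set ℕ}

open Classical in
/-- The assignment of the variables in `V` given by a word of tuples of labels. -/
noncomputable def wordAssignment (σ : ℕ → V → Set AP) : Assignment AP :=
  fun x => if h : x ∈ V then some fun i => σ i ⟨x, h⟩ else none

/-- Satisfaction by a word of tuples of labels. -/
def WSat (σ : ℕ → V → Set AP) (ψ : HyperBody AP) : Prop := ψ.Sat (wordAssignment σ)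

theorem suffix_wordAssignment (σ : ℕ → V → Set AP) (j : ℕ) :
    (wordAssignment σ).suffix j = wordAssignment fun i => σ (j + i) := by
  funext x
  unfold Assignment.suffix wordAssignment
  split <;> rfl

/-- Satisfaction of a formula at a position, given the tuple of labels there and the formulas
satisfied at the next position. -/
def Now (ℓ : V → Set AP) (N : HyperBody AP → Prop) : HyperBody AP → Prop
  | .tt => True
  | .atom a x => ∃ h : x ∈ V, a ∈ ℓ ⟨x, h⟩
  | .neg ψ => ¬ Now ℓ N ψ
  | .or ψ χ => Now ℓ N ψ ∨ Now ℓ N χ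
  | .until ψ χ => Now ℓ N χ ∨ Now ℓ N ψ ∧ N (.until ψ χ)
  | .next ψ => N ψ

/-- Satisfaction of a formula by a constant word. -/
def Always (ℓ : V → Set AP) : HyperBody AP → Prop
  | .tt => True
  | .atom a x => ∃ h : x ∈ V, a ∈ ℓ ⟨x, h⟩
  | .neg ψ => ¬ Always ℓ ψ
  | .or ψ χ => Always ℓ ψ ∨ Always ℓ χ
  | .until _ χ => Always ℓ χ
  | .next ψ => Always ℓ ψ

theorem wSat_atom (σ : ℕ → V → Set AP) (a : AP) (x : ℕ) :
    WSat σ (.atom a x) ↔ ∃ h : x ∈ V, a ∈ σ 0 ⟨x, h⟩ := by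
  unfold WSat HyperBody.Sat wordAssignment
  by_cases h : x ∈ V <;> simp [h]

theorem wSat_until (σ : ℕ → V → Set AP) (ψ χ : HyperBody AP) : WSat σ (.until ψ χ) ↔
    ∃ i, WSat (fun k => σ (i + k)) χ ∧ ∀ j < i, WSat (fun k => σ (j + k)) ψ := by
  unfold WSat
  simp only [← suffix_wordAssignment]
  rfl

theorem wSat_next (σ : ℕ → V → Set AP) (ψ : HyperBody AP) :
    WSat σ (.next ψ) ↔ WSat (fun k => σ (1 + k)) ψ := by
  unfold WSat
  rw [← suffix_wordAssignment]
  rfl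

/-- The expansion law of until: ψ U χ holds if χ holds now, or ψ holds now and ψ U χ holds at the
next position. It lets an automaton check truth with one step of lookahead. -/
theorem wSat_iff_now (σ : ℕ → V → Set AP) (ψ : HyperBody AP) :
    WSat σ ψ ↔ Now (σ 0) (WSat fun k => σ (1 + k)) ψ := by
  induction ψ with
  | tt => exact Iff.rfl
  | atom a x => exact wSat_atom σ a x
  | neg ψ ih => exact not_congr ih
  | or ψ χ ih1 ih2 => exact or_congr ih1 ih2
  | next ψ ih => exact wSat_next σ ψ
  | _ ψ χ ih1 ih2 =>
    rw [Now, ← ih1, ← ih2, wSat_until, wSat_until]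
    constructor
    · rintro ⟨i, h1, h2⟩
      rcases i with _ | i
      · left
        simpa using h1
      · refine .inr ⟨by simpa using h2 0 (by omega), i, ?_, fun j hj => ?_⟩
        · simpa only [← add_assoc, add_comm 1 i] using h1
        · simpa only [← add_assoc, add_comm 1 j] using h2 (j + 1) (by omega)
    · rintro (h | ⟨h, i, h1, h2⟩)
      · exact ⟨0, by simpa using h, fun j hj => by omega⟩
      · refine ⟨i + 1, ?_, fun j hj => ?_⟩
        · simpa only [← add_assoc, add_comm 1 i] using h1
        · rcases j with _ | j
          · simpa using h
          · simpa only [← add_assoc, add_comm 1 j] using h2 j (by omega)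

/-- All suffixes of a constant word coincide, so next has no effect and until reduces to its second
argument. -/
theorem wSat_const (ℓ : V → Set AP) (ψ : HyperBody AP) : WSat (fun _ => ℓ) ψ ↔ Always ℓ ψ := by
  induction ψ with
  | tt => exact Iff.rfl
  | atom a x => exact wSat_atom _ a x
  | neg ψ ih => exact not_congr ih
  | or ψ χ ih1 ih2 => exact or_congr ih1 ih2
  | next ψ ih => exact (wSat_next _ ψ).trans ih
  | _ ψ χ ih1 ih2 =>
    rw [wSat_until, Always, ← ih2]
    exact ⟨fun ⟨_, h, _⟩ => h, fun h => ⟨0, h, fun j hj => by omega⟩⟩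

/-- The subformulas. -/
def subs : HyperBody AP → Set (HyperBody AP)
  | .tt => {.tt}
  | .atom a x => {.atom a x}
  | .neg ψ => insert (.neg ψ) ψ.subs
  | .or ψ χ => insert (.or ψ χ) (ψ.subs ∪ χ.subs)
  | .until ψ χ => insert (.until ψ χ) (ψ.subs ∪ χ.subs)
  | .next ψ => insert (.next ψ) ψ.subs

theorem finite_subs (ψ : HyperBody AP) : ψ.subs.Finite := by
  induction ψ with
  | tt => exact Set.finite_singleton _
  | atom a x => exact Set.finite_singleton _
  | neg ψ ih => exact ih.insert _
  | or ψ χ ih1 ih2 => exact (ih1.union ih2).insert _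
  | next ψ ih => exact ih.insert _
  | _ ψ χ ih1 ih2 => exact (ih1.union ih2).insert _

instance (ψ : HyperBody AP) : Finite ψ.subs := ψ.finite_subs

theorem self_mem_subs (ψ : HyperBody AP) : ψ ∈ ψ.subs := by
  cases ψ <;> simp [subs]

theorem subs_subset {ψ χ : HyperBody AP} (h : χ ∈ ψ.subs) : χ.subs ⊆ ψ.subs := by
  induction ψ with
  | tt => rw [show χ = _ from h]
  | atom a x => rw [show χ = _ from h]
  | neg ψ ih =>
    rcases h with rfl | h
    exacts [subset_rfl, (ih h).trans (Set.subset_insert _ _)]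
  | or ψ₁ ψ₂ ih1 ih2 =>
    rcases h with rfl | h | h
    exacts [subset_rfl, ((ih1 h).trans Set.subset_union_left).trans (Set.subset_insert _ _),
      ((ih2 h).trans Set.subset_union_right).trans (Set.subset_insert _ _)]
  | next ψ ih =>
    rcases h with rfl | h
    exacts [subset_rfl, (ih h).trans (Set.subset_insert _ _)]
  | _ ψ₁ ψ₂ ih1 ih2 =>
    rcases h with rfl | h | h
    exacts [subset_rfl, ((ih1 h).trans Set.subset_union_left).trans (Set.subset_insert _ _),
      ((ih2 h).trans Set.subset_union_right).trans (Set.subset_insert _ _)]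

/-- Only finitely many truth values at the next position matter, so a configuration of the product
is a finite tuple. -/
theorem now_congr {ℓ : V → Set AP} {N N' : HyperBody AP → Prop} {ψ : HyperBody AP}
    (h : ∀ χ ∈ ψ.subs, N χ ↔ N' χ) : Now ℓ N ψ ↔ Now ℓ N' ψ := by
  induction ψ with
  | tt => exact Iff.rfl
  | atom a x => exact Iff.rfl
  | neg ψ ih => exact not_congr (ih fun χ hχ => h χ (.inr hχ))
  | or ψ χ ih1 ih2 =>
    exact or_congr (ih1 fun χ hχ => h χ (.inr (.inl hχ))) (ih2 fun χ hχ => h χ (.inr (.inr hχ)))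
  | next ψ ih => exact h ψ (.inr ψ.self_mem_subs)
  | _ ψ χ ih1 ih2 =>
    exact or_congr (ih2 fun χ hχ => h χ (.inr (.inr hχ)))
      (and_congr (ih1 fun χ hχ => h χ (.inr (.inl hχ))) (h _ (.inl rfl)))

end HyperBody

/-! ### Product with the subformula automaton -/

section Product

variable {AP : Type} {V : Set ℕ} {ψ : HyperBody AP}

/-- The subformulas of `ψ` that a configuration declares satisfied. -/
def Claims (g : V ⊕ ψ.subs → ℕ) (χ : HyperBody AP) : Prop := ∃ h : χ ∈ ψ.subs, g (.inr ⟨χ, h⟩) = 0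

/-- Steps of the product of copies of a labelled graph with the subformula automaton. -/
def ProductStep (δ : ℕ → ℕ → Prop) (label : ℕ → Set AP) (g g' : V ⊕ ψ.subs → ℕ) : Prop :=
  (∀ x, δ (g (.inl x)) (g' (.inl x))) ∧
    ∀ χ : ψ.subs, g (.inr χ) = 0 ↔ HyperBody.Now (fun x => label (g (.inl x))) (Claims g') χ

/-- Configurations of the product that can be repeated forever. -/
def ProductFinal (δ : ℕ → ℕ → Prop) (label : ℕ → Set AP) (g : V ⊕ ψ.subs → ℕ) : Prop :=
  (∀ x, δ (g (.inl x)) (g (.inl x))) ∧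
    ∀ χ : ψ.subs, g (.inr χ) = 0 ↔ HyperBody.Always (fun x => label (g (.inl x))) χ

-- Claims about subformulas are propagated backwards by equivalences, so they are correct throughout
-- as soon as they are correct in the last configuration; and there the word is constant and they
-- are evaluated outright. Conversely, paths that become constant reach such a configuration after
-- finitely many steps.
open Classical in
theorem exists_paths_iff [Finite V] {δ : ℕ → ℕ → Prop} {label : ℕ → Set AP} {s₀ B : ℕ}
    (hδ : ∀ p : ℕ → ℕ, (∀ i, δ (p i) (p (i + 1))) → ∃ m, ∀ i ≥ m, p i = p m)
    (hB : 2 ≤ B) (hs : ∀ s t, δ s t → s < B) :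
    (∃ p : V → ℕ → ℕ, (∀ x, p x 0 = s₀ ∧ ∀ i, δ (p x i) (p x (i + 1))) ∧
      HyperBody.WSat (fun i x => label (p x i)) ψ) ↔
    ∃ g₀ g₁ : V ⊕ ψ.subs → ℕ, (∀ c, g₀ c < B) ∧ (∀ c, g₁ c < B) ∧ (∀ x, g₀ (.inl x) = s₀) ∧
      g₀ (.inr ⟨ψ, ψ.self_mem_subs⟩) = 0 ∧ ProductFinal δ label g₁ ∧
      Relation.ReflTransGen (fun g g' => ProductStep δ label g g' ∧ ∀ c, g' c < B) g₀ g₁ := by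
  constructor
  · rintro ⟨p, hp, hψ⟩
    choose m hm using fun x => hδ (p x) (hp x).2
    -- A common time from which all of the finitely many paths are constant.
    obtain ⟨M, hM⟩ := (Set.finite_range m).bddAbove
    have hM' : ∀ x, ∀ i ≥ M, p x i = p x M := fun x i hi => by
      have := hM ⟨x, rfl⟩
      rw [hm x i (by omega), hm x M (by omega)]
    -- The canonical run: states of the paths and truth values of the subformulas, with 0 for true
    -- and 1 for false; hence the assumption `2 ≤ B`.
    let g : ℕ → V ⊕ ψ.subs → ℕ := fun i => Sum.elim (fun x => p x i) fun χ =>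
      if HyperBody.WSat (fun j x => label (p x (i + j))) χ.1 then 0 else 1
    have hgB : ∀ i c, g i c < B := by
      rintro i (x | χ)
      · exact hs _ _ ((hp x).2 i)
      · simp only [g, Sum.elim_inr]
        split_ifs <;> omega
    have hg : ∀ i (χ : ψ.subs), g i (.inr χ) = 0 ↔
        HyperBody.WSat (fun j x => label (p x (i + j))) χ.1 := by
      intro i χ
      simp [g]
    refine ⟨g 0, g M, hgB 0, hgB M, fun x => (hp x).1, ?_, ⟨fun x => ?_, fun χ => ?_⟩, ?_⟩
    · rw [hg]
      simpa using hψ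
    · have := (hp x).2 M
      rw [hM' x (M + 1) (by omega)] at this
      exact this
    · rw [hg, ← HyperBody.wSat_const]
      have : (fun j x => label (p x (M + j))) = fun _ (x : V) => label (g M (.inl x)) := by
        funext j x
        rw [hM' x _ (by omega)]
        rfl
      rw [this]
    · have key : ∀ i, Relation.ReflTransGen
          (fun g g' => ProductStep δ label g g' ∧ ∀ c, g' c < B) (g 0) (g i) := by
        intro i
        induction i with
        | zero => exact .refl
        | succ i ih =>
          refine ih.tail ⟨⟨fun x => (hp x).2 i, fun χ => ?_⟩, hgB _⟩
          rw [hg, HyperBody.wSat_iff_now]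
          refine HyperBody.now_congr fun ξ hξ => ?_
          have hξ' := HyperBody.subs_subset χ.2 hξ
          rw [Claims, exists_prop_of_true hξ', hg (i + 1) ⟨ξ, hξ'⟩]
          simp only [← add_assoc]
      exact key M
  · rintro ⟨g₀, g₁, -, -, h0, h1, h2, h3⟩
    suffices ∃ p : V → ℕ → ℕ, (∀ x, p x 0 = g₀ (.inl x) ∧ ∀ i, δ (p x i) (p x (i + 1))) ∧
        ∀ χ : ψ.subs, g₀ (.inr χ) = 0 ↔ HyperBody.WSat (fun i x => label (p x i)) χ.1 by
      obtain ⟨p, h4, h5⟩ := this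
      exact ⟨p, fun x => ⟨(h4 x).1.trans (h0 x), (h4 x).2⟩, (h5 _).1 h1⟩
    clear h0 h1
    -- The paths are built from the end of the run: first the self-loops, then one transition put in
    -- front at a time.
    induction h3 using Relation.ReflTransGen.head_induction_on with
    | refl =>
      refine ⟨fun x _ => g₁ (.inl x), fun x => ⟨rfl, fun _ => h2.1 x⟩, fun χ => ?_⟩
      rw [HyperBody.wSat_const]
      exact h2.2 χ
    | @head g g' h4 _ ih =>
      obtain ⟨p, h5, h6⟩ := ih
      refine ⟨fun x i => Nat.casesOn i (g (.inl x)) (p x), fun x => ⟨rfl, fun i => ?_⟩, fun χ => ?_⟩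
      · cases i with
        | zero =>
          have := h4.1.1 x
          rw [← (h5 x).1] at this
          exact this
        | succ i => exact (h5 x).2 i
      · rw [HyperBody.wSat_iff_now, h4.1.2]
        refine HyperBody.now_congr fun ξ hξ => ?_
        have hξ' := HyperBody.subs_subset χ.2 hξ
        rw [Claims, exists_prop_of_true hξ', h6 ⟨ξ, hξ'⟩]
        simp only [add_comm 1]

end Product

/-! ### Encodings of Kripke structures -/

theorem List.getElem?_flatten_ofFn {α : Type*} {n m : ℕ} (f : Fin n → Fin m → α) (s : Fin n)
    (t : Fin m) :
    (List.ofFn fun s : Fin n => List.ofFn fun t : Fin m => f s t).flatten[(s * m + t : ℕ)]? =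
      some (f s t) := by
  have hm : ∀ (i : Fin n) (j : Fin m), (i * m + j : ℕ) < n * m := fun i j => calc
    (i * m + j : ℕ) < (i + 1) * m := by rw [add_one_mul]; have := j.2; omega
    _ ≤ n * m := Nat.mul_le_mul_right _ i.2
  have h : (List.ofFn fun s : Fin n => List.ofFn fun t : Fin m => f s t).flatten =
      List.ofFn fun k : Fin (n * m) => f k.divNat k.modNat := by
    rw [List.ofFn_mul]
    congr 2
    funext i
    congr 1
    funext j
    congr 1
    · refine Fin.ext ?_
      rw [Fin.coe_divNat]
      dsimp only
      rw [add_comm, Nat.add_mul_div_right _ _ j.pos, Nat.div_eq_of_lt j.2, zero_add]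
    · refine Fin.ext ?_
      rw [Fin.coe_modNat]
      dsimp only
      rw [add_comm, Nat.add_mul_mod_self_right, Nat.mod_eq_of_lt j.2]
  rw [h, List.getElem?_ofFn, dif_pos (hm s t)]
  congr 2
  · refine Fin.ext ?_
    rw [Fin.coe_divNat]
    dsimp only
    rw [add_comm, Nat.add_mul_div_right _ _ t.pos, Nat.div_eq_of_lt t.2, zero_add]
  · refine Fin.ext ?_
    rw [Fin.coe_modNat]
    dsimp only
    rw [add_comm, Nat.add_mul_mod_self_right, Nat.mod_eq_of_lt t.2]

theorem List.length_flatten_ofFn {α : Type*} {n m : ℕ} (f : Fin n → Fin m → α) :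
    (List.ofFn fun s : Fin n => List.ofFn fun t : Fin m => f s t).flatten.length = n * m := by
  simp [List.length_flatten, List.map_ofFn, Function.comp_def]

/-- The transitions coded in a word. -/
def CodedEdge (a n : ℕ) (w : List Bool) (s t : ℕ) : Prop :=
  s < n ∧ t < n ∧ w[n + 1 + n + n * a + (s * n + t)]? = some true

/-- The labels coded in a word. -/
def codedLabel (a n : ℕ) (w : List Bool) (s : ℕ) : Set (Fin a) :=
  {p | w[n + 1 + n + (s * a + p)]? = some true}

/-- The word codes a structure with `n` states and initial state `s₀`. -/
def Codes (a n : ℕ) (w : List Bool) (s₀ : ℕ) : Prop :=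
  w.length = n + 1 + n + n * a + n * n ∧ (∀ i < n, w[i]? = some true) ∧ w[n]? = some false ∧
    (∀ s < n, (s = s₀ ∧ w[n + 1 + s]? = some true) ∨ (s ≠ s₀ ∧ w[n + 1 + s]? = some false)) ∧
    s₀ < n ∧ ∀ s < n, ∃ t < n, CodedEdge a n w s t

namespace Kripke

variable {a n : ℕ} (K : Kripke (Fin a) (Fin n))

theorem length_encode : K.encode.length = n + 1 + n + n * a + n * n := by
  unfold encode
  simp only [List.length_append, List.length_flatten_ofFn, List.length_ofFn, List.length_replicate,
    List.length_singleton]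

theorem encode_getElem?_unary {i : ℕ} (h : i < n) : K.encode[i]? = some true := by
  unfold encode
  rw [List.getElem?_append_left (by simp; omega), List.getElem?_append_left (by simp; omega),
    List.getElem?_append_left (by simp; omega), List.getElem?_append_left (by simpa),
    List.getElem?_replicate, if_pos h]

theorem encode_getElem?_sep : K.encode[n]? = some false := by
  unfold encode
  rw [List.getElem?_append_left (by simp), List.getElem?_append_left (by simp),
    List.getElem?_append_left (by simp), List.getElem?_append_right (by simp)]
  simp

open Classical in
theorem encode_getElem?_init (s : Fin n) :
    K.encode[(n + 1 + s : ℕ)]? = some (decide (s = K.init)) := by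
  have := s.2
  unfold encode
  rw [List.getElem?_append_left (by simp; omega), List.getElem?_append_left (by simp; omega),
    List.getElem?_append_right (by simp)]
  simp

open Classical in
theorem encode_getElem?_label (s : Fin n) (p : Fin a) :
    K.encode[(n + 1 + n + (s * a + p) : ℕ)]? = some (decide (p ∈ K.label s)) := by
  have h : (s * a + p : ℕ) < n * a := calc
    (s * a + p : ℕ) < (s + 1) * a := by rw [add_one_mul]; have := p.2; omega
    _ ≤ n * a := Nat.mul_le_mul_right _ s.2
  unfold encode
  rw [List.getElem?_append_left (by
    simp only [List.length_append, List.length_flatten_ofFn, List.length_ofFn,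
      List.length_replicate, List.length_singleton]; omega),
    List.getElem?_append_right (by simp; omega)]
  rw [← List.getElem?_flatten_ofFn (fun s p => decide (p ∈ K.label s)) s p]
  congr 1
  simp
  omega

open Classical in
theorem encode_getElem?_edge (s t : Fin n) :
    K.encode[(n + 1 + n + n * a + (s * n + t) : ℕ)]? = some (decide (K.δ s t)) := by
  unfold encode
  rw [List.getElem?_append_right (by
    simp only [List.length_append, List.length_flatten_ofFn, List.length_ofFn,
      List.length_replicate, List.length_singleton]; omega),
    ← List.getElem?_flatten_ofFn (fun s t => decide (K.δ s t)) s t]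
  congr 1
  simp only [List.length_append, List.length_flatten_ofFn, List.length_ofFn,
      List.length_replicate, List.length_singleton]
  omega

theorem codedEdge_encode (s t : Fin n) : CodedEdge a n K.encode s t ↔ K.δ s t := by
  unfold CodedEdge
  rw [encode_getElem?_edge]
  simp

theorem codedLabel_encode (s : Fin n) : codedLabel a n K.encode s = K.label s := by
  ext p
  unfold codedLabel
  rw [Set.mem_ofPred_eq, encode_getElem?_label]
  simp

theorem codes_encode : Codes a n K.encode K.init := by
  refine ⟨K.length_encode, fun i hi => K.encode_getElem?_unary hi, K.encode_getElem?_sep,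
    fun s hs => ?_, K.init.2, fun s hs => ?_⟩
  · have := K.encode_getElem?_init ⟨s, hs⟩
    dsimp only at this
    rw [this]
    by_cases h : (⟨s, hs⟩ : Fin n) = K.init
    · exact .inl ⟨congrArg Fin.val h, by simpa using h⟩
    · exact .inr ⟨fun h' => h (Fin.ext h'), by simpa using h⟩
  · obtain ⟨t, ht⟩ := K.total ⟨s, hs⟩
    exact ⟨t, t.2, (K.codedEdge_encode ⟨s, hs⟩ t).2 ht⟩

-- The conditions in `Codes` fix the unary part, the separator and the initial indicator; label and
-- edge bits are read off freely. Since every position of the word lies in one of these segments,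
-- the structure read off encodes back to the word.
open Classical in
theorem exists_eq_encode {w : List Bool} {s₀ : ℕ} (h : Codes a n w s₀) :
    ∃ K : Kripke (Fin a) (Fin n), w = K.encode := by
  obtain ⟨h1, h2, h3, h4, h5, h6⟩ := h
  let K : Kripke (Fin a) (Fin n) :=
    { init := ⟨s₀, h5⟩
      δ := fun s t => CodedEdge a n w s t
      label := fun s => codedLabel a n w s
      total := fun s => by
        obtain ⟨t, ht, h7⟩ := h6 s s.2
        exact ⟨⟨t, ht⟩, h7⟩ }
  have hdec : ∀ {i} {p : Prop} [Decidable p], i < w.length → (p ↔ w[i]? = some true) →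
      w[i]? = some (decide p) := by
    intro i p _ hi hp
    rw [List.getElem?_eq_getElem hi] at hp ⊢
    by_cases hp' : p
    · simpa [hp'] using hp
    · simpa [hp'] using hp
  refine ⟨K, List.ext_getElem? fun i => ?_⟩
  rcases Nat.lt_or_ge i n with hi | hi
  · rw [h2 i hi, K.encode_getElem?_unary hi]
  obtain ⟨j, rfl⟩ := Nat.exists_eq_add_of_le hi
  rcases j with _ | j
  · rw [add_zero, h3, K.encode_getElem?_sep]
  rw [show n + (j + 1) = n + 1 + j by omega]
  rcases Nat.lt_or_ge j n with hj | hj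
  · have := K.encode_getElem?_init ⟨j, hj⟩
    dsimp only at this
    rw [this]
    rcases h4 j hj with ⟨h7, h8⟩ | ⟨h7, h8⟩
    · rw [h8]
      simp [K, h7]
    · rw [h8]
      simp [K, h7]
  obtain ⟨k, rfl⟩ := Nat.exists_eq_add_of_le hj
  rw [show n + 1 + (n + k) = n + 1 + n + k by omega]
  rcases Nat.lt_or_ge k (n * a) with hk | hk
  · have ha : 0 < a := Nat.pos_of_ne_zero fun h => by simp [h] at hk
    have := K.encode_getElem?_label ⟨k / a, Nat.div_lt_of_lt_mul (by rwa [mul_comm])⟩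
      ⟨k % a, Nat.mod_lt _ ha⟩
    dsimp only at this
    rw [Nat.div_add_mod'] at this
    rw [this]
    refine hdec (by omega) ?_
    simp only [K, codedLabel, Set.mem_ofPred_eq]
    rw [Nat.div_add_mod']
  obtain ⟨l, rfl⟩ := Nat.exists_eq_add_of_le hk
  rw [← add_assoc]
  rcases Nat.lt_or_ge l (n * n) with hl | hl
  · have hn : 0 < n := by omega
    have := K.encode_getElem?_edge ⟨l / n, Nat.div_lt_of_lt_mul hl⟩ ⟨l % n, Nat.mod_lt _ hn⟩
    dsimp only at this
    rw [Nat.div_add_mod'] at this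
    rw [this]
    refine hdec (by omega) ?_
    simp only [K, CodedEdge]
    rw [Nat.div_add_mod']
    exact ⟨fun h => h.2.2, fun h => ⟨Nat.div_lt_of_lt_mul hl, Nat.mod_lt _ hn, h⟩⟩
  · rw [List.getElem?_eq_none (by omega), List.getElem?_eq_none (by rw [K.length_encode]; omega)]

/-- The transitions other than self-loops. -/
theorem acyclicFrame_iff_countCert {w : List Bool} (hw : w = K.encode) {R' : ℕ → ℕ → Prop}
    (hR' : ∀ u < n, ∀ v < n, R' u v ↔ ¬ (CodedEdge a n w u v ∧ u ≠ v)) {B : ℕ} (hB : n < B) :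
    AcyclicFrame K.δ ↔
      (∀ s < n, ¬ CodedEdge a n w s s ∨ ∀ t < n, ¬ CodedEdge a n w s t ∨ t = s) ∧
      CountCert B n (fun u v => CodedEdge a n w u v ∧ u ≠ v) R' := by
  subst hw
  rw [acyclicFrame_iff, countCert_iff hB hR']
  refine and_congr ?_ ?_
  · constructor
    · intro h s hs
      by_cases h' : CodedEdge a n K.encode s s
      · refine .inr fun t ht => ?_
        by_cases h'' : CodedEdge a n K.encode s t
        · refine .inr (congrArg Fin.val (h ⟨s, hs⟩ ((K.codedEdge_encode ⟨s, hs⟩ ⟨s, hs⟩).1 h')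
            ⟨t, ht⟩ ((K.codedEdge_encode ⟨s, hs⟩ ⟨t, ht⟩).1 h'')))
        · exact .inl h''
      · exact .inl h'
    · intro h s hs t ht
      rw [← codedEdge_encode] at hs ht
      exact Fin.ext (((h s s.2).resolve_left (not_not.2 hs) t t.2).resolve_left (not_not.2 ht))
  · constructor
    · intro h v hv h'
      obtain ⟨p, h1, h2, rfl⟩ := walkTo_iff_exists.1 h'
      have h3 : ∀ i ≤ n, p i < n := fun i hi => by
        rcases h1 i hi with h | ⟨rfl, -⟩
        exacts [h, hv]
      -- Nothing is known of `p` beyond `n`, so the index is clamped to obtain an infinite sequence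
      -- of states.
      refine h ⟨fun i => ⟨p (min i n), h3 _ (min_le_right _ _)⟩, fun i hi => ?_⟩
      have := h2 i hi
      rw [← codedEdge_encode, Ne, Fin.ext_iff]
      dsimp only
      rw [min_eq_left hi.le, min_eq_left hi]
      exact this
    · rintro h ⟨p, hp⟩
      refine h (p n) (p n).2 (walkTo_iff_exists.2 ⟨fun i => p i, fun i _ => .inl (p i).2,
        fun i hi => ?_, rfl⟩)
      exact ⟨(K.codedEdge_encode _ _).2 (hp i hi).1, fun h => (hp i hi).2 (Fin.ext h)⟩

-- An infinite path cannot avoid self-loops for `n` steps, and a state with a self-loop is never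
-- left.
variable {K} in
theorem eventually_constant (hK : AcyclicFrame K.δ) (p : ℕ → ℕ)
    (hp : ∀ i, CodedEdge a n K.encode (p i) (p (i + 1))) : ∃ m, ∀ i ≥ m, p i = p m := by
  obtain ⟨h1, h2⟩ := (acyclicFrame_iff K.δ).1 hK
  let q : ℕ → Fin n := fun i => ⟨p i, (hp i).1⟩
  have hq : ∀ i, K.δ (q i) (q (i + 1)) := fun i => (K.codedEdge_encode _ _).1 (hp i)
  obtain ⟨m, hm⟩ : ∃ m, q m = q (m + 1) := by
    by_contra h
    exact h2 ⟨q, fun i _ => ⟨hq i, fun h' => h ⟨i, h'⟩⟩⟩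
  have hloop : K.δ (q m) (q m) := by
    have := hq m
    rwa [← hm] at this
  have : ∀ k, q (m + k) = q m := by
    intro k
    induction k with
    | zero => rfl
    | succ k ih =>
      have := hq (m + k)
      rw [ih] at this
      exact h1 _ hloop _ this
  refine ⟨m, fun i hi => ?_⟩
  obtain ⟨k, rfl⟩ := Nat.exists_eq_add_of_le hi
  exact congrArg Fin.val (this k)

open Classical in
theorem models_iff_exists_paths {φ : HyperLTL (Fin a)} (hφ : φ.IsEStar) : K.Models φ ↔
    ∃ p : φ.boundVars → ℕ → ℕ, (∀ x, p x 0 = K.init ∧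
      ∀ i, CodedEdge a n K.encode (p x i) (p x (i + 1))) ∧
      HyperBody.WSat (fun i x => codedLabel a n K.encode (p x i)) φ.matrix := by
  unfold Models
  rw [hφ.sat_iff]
  constructor
  · rintro ⟨A, h1, h2, h3⟩
    have h4 : ∀ x : φ.boundVars, ∃ p : ℕ → Fin n, p 0 = K.init ∧ (∀ i, K.δ (p i) (p (i + 1))) ∧
        A x = some fun i => K.label (p i) := by
      rintro ⟨x, hx⟩
      obtain ⟨t, ⟨p, h5, h6, h7⟩, h8⟩ := h2 x hx
      exact ⟨p, h5, h6, by rw [h8]; exact congrArg _ (funext h7)⟩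
    choose p h5 h6 h7 using h4
    refine ⟨fun x i => p x i, fun x => ⟨congrArg Fin.val (h5 x), fun i =>
      (K.codedEdge_encode _ _).2 (h6 x i)⟩, ?_⟩
    have : A = HyperBody.wordAssignment fun i (x : φ.boundVars) =>
        codedLabel a n K.encode (p x i) := by
      funext x
      unfold HyperBody.wordAssignment
      split
      · rename_i hx
        simp only [codedLabel_encode]
        exact h7 ⟨x, hx⟩
      · exact h1 x ‹_›
    unfold HyperBody.WSat
    rwa [← this]
  · rintro ⟨p, h1, h2⟩
    refine ⟨_, fun x hx => ?_, fun x hx => ?_, h2⟩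
    · exact dif_neg hx
    · refine ⟨_, ⟨fun i => ⟨p ⟨x, hx⟩ i, ((h1 ⟨x, hx⟩).2 i).1⟩, Fin.ext (h1 ⟨x, hx⟩).1,
        fun i => (K.codedEdge_encode _ _).1 ((h1 ⟨x, hx⟩).2 i), fun i => ?_⟩, dif_pos hx⟩
      exact K.codedLabel_encode ⟨p ⟨x, hx⟩ i, _⟩

end Kripke

/-! ### The repair problem in nondeterministic logarithmic space -/

namespace NLPred

variable {α γ : Type}

theorem ne_zero (c : α) : NLPred fun _ (x : α → ℕ) => x c ≠ 0 := by
  refine (NLPred.ex (P := fun _ (x : α → ℕ) z => z = 0 ∧ x c ≠ z)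
    ((NLPred.eq_zero none).and (NLPred.ne (some c) none))).congr fun w x _ => ?_
  exact ⟨fun h => ⟨0, by simp [numBound], rfl, h⟩, fun ⟨z, _, h1, h2⟩ => by rwa [h1] at h2⟩

/-- Here `p` depends neither on the input nor on the variables, so the distinction is made when the
program is chosen and not while it runs. -/
theorem eq_zero_iff (c : α) (p : Prop) : NLPred fun _ (x : α → ℕ) => x c = 0 ↔ p := by
  by_cases hp : p
  · simpa only [hp, iff_true] using NLPred.eq_zero c
  · simpa only [hp, iff_false] using ne_zero c

/-- An enumeration of the index type reduces to tuples over `Fin d`, whose entries are guessed one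
by one. -/
theorem exTuple [Finite γ] {P : List Bool → (α → ℕ) → (γ → ℕ) → Prop}
    (hP : NLPred fun w (x : α ⊕ γ → ℕ) => P w (fun a => x (.inl a)) fun c => x (.inr c)) :
    NLPred fun w x => ∃ g : γ → ℕ, (∀ c, g c < numBound w) ∧ P w x g := by
  obtain ⟨d, ⟨e⟩⟩ := Finite.exists_equiv_fin γ
  have key : ∀ (d : ℕ) (α : Type) (P : List Bool → (α → ℕ) → (Fin d → ℕ) → Prop),
      (NLPred fun w (x : α ⊕ Fin d → ℕ) => P w (fun a => x (.inl a)) fun c => x (.inr c)) →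
      NLPred fun w x => ∃ g : Fin d → ℕ, (∀ c, g c < numBound w) ∧ P w x g := by
    intro d
    induction d with
    | zero =>
      intro α P hP
      refine (NLPred.rename hP (Sum.elim id fun c => c.elim0)).congr fun w x _ => ?_
      constructor
      · rintro ⟨g, -, h⟩
        exact (congrArg (P w x) (Subsingleton.elim _ _)).mp h
      · intro h
        exact ⟨_, fun c => c.elim0, h⟩
    | succ d ih =>
      intro α P hP
      refine (NLPred.ex (P := fun w x z => ∃ g : Fin d → ℕ, (∀ c, g c < numBound w) ∧
        P w x (Fin.cons z g)) (ih (Option α) (fun w x g =>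
          P w (fun a => x (some a)) (Fin.cons (x none) g)) ?_)).congr fun w x _ => ?_
      · refine (NLPred.rename hP (Sum.elim (fun a => .inl (some a))
          (Fin.cons (.inl none) fun c => .inr c))).congr fun w x _ => ?_
        refine iff_of_eq (congrArg _ (funext fun c => ?_))
        refine Fin.cases ?_ (fun c => ?_) c <;> simp
      · constructor
        · rintro ⟨g, hg, h⟩
          refine ⟨g 0, hg 0, fun c => g c.succ, fun c => hg _, ?_⟩
          rwa [show (Fin.cons (g 0) fun c => g c.succ : Fin (d + 1) → ℕ) = g from
            Fin.cons_self_tail g]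
        · rintro ⟨z, hz, g, hg, h⟩
          exact ⟨Fin.cons z g, Fin.cases hz hg, h⟩
  refine (key d α (fun w x g => P w x fun c => g (e c)) (NLPred.rename hP
    (Sum.elim Sum.inl fun c => Sum.inr (e c)))).congr fun w x _ => ?_
  constructor
  · rintro ⟨g, hg, h⟩
    exact ⟨fun i => g (e.symm i), fun i => hg _, by simpa using h⟩
  · rintro ⟨g, hg, h⟩
    exact ⟨_, fun c => hg _, h⟩

theorem tcTuple [Finite γ] {R : List Bool → (α → ℕ) → (γ → ℕ) → (γ → ℕ) → Prop}
    (hR : NLPred (α := α ⊕ γ ⊕ γ) fun w x => R w (fun a => x (.inl a))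
      (fun i => x (.inr (.inl i))) fun i => x (.inr (.inr i))) (src tgt : γ → α) :
    NLPred fun w (x : α → ℕ) => Relation.ReflTransGen
      (fun g g' => R w x g g' ∧ ∀ i, g' i < numBound w) (fun i => x (src i)) fun i => x (tgt i) := by
  obtain ⟨d, ⟨e⟩⟩ := Finite.exists_equiv_fin γ
  refine (tc (R := fun w x g g' => R w x (fun c => g (e c)) fun c => g' (e c)) (NLPred.rename hR
    (Sum.elim Sum.inl (Sum.elim (fun c => Sum.inr (Sum.inl (e c)))
      fun c => Sum.inr (Sum.inr (e c)))))
    (fun i => src (e.symm i)) fun i => tgt (e.symm i)).congr fun w x _ => ?_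
  constructor
  · intro h
    refine h.lift (fun (g : γ → ℕ) (i : Fin d) => g (e.symm i)) fun g g' h => ?_
    exact ⟨by simpa using h.1, fun i => h.2 _⟩
  · intro h
    have := h.lift (p := fun g g' => R w x g g' ∧ ∀ i, g' i < numBound w)
      (fun (g : Fin d → ℕ) (c : γ) => g (e c)) fun g g' h => ⟨h.1, fun i => h.2 _⟩
    simpa [Function.onFun] using this

end NLPred

section Membership

variable {α : Type} (a : ℕ)

theorem NLTerm.initPos (N s : α) : NLTerm fun _ (x : α → ℕ) => x N + 1 + x s :=
  ((NLTerm.var N).add (NLTerm.const 1)).add (NLTerm.var s)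

theorem NLTerm.labelPos (N s : α) (p : ℕ) :
    NLTerm fun _ (x : α → ℕ) => x N + 1 + x N + (x s * a + p) :=
  (((NLTerm.var N).add (NLTerm.const 1)).add (NLTerm.var N)).add
    (((NLTerm.var s).mul_const a).add (NLTerm.const p))

theorem NLTerm.edgePos (N s t : α) :
    NLTerm fun _ (x : α → ℕ) => x N + 1 + x N + x N * a + (x s * x N + x t) :=
  ((((NLTerm.var N).add (NLTerm.const 1)).add (NLTerm.var N)).add
    ((NLTerm.var N).mul_const a)).add ((NLTerm.mul_var s N).add (NLTerm.var t))

/-- Non-transitions coded in a word. -/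
def CodedNonEdge (a n : ℕ) (w : List Bool) (s t : ℕ) : Prop :=
  w[n + 1 + n + n * a + (s * n + t)]? = some false

theorem NLPred.codedNonEdge (N s t : α) :
    NLPred fun w (x : α → ℕ) => CodedNonEdge a (x N) w (x s) (x t) :=
  NLPred.bit_term false (NLTerm.edgePos a N s t)

theorem NLPred.codedEdge (N s t : α) :
    NLPred fun w (x : α → ℕ) => CodedEdge a (x N) w (x s) (x t) :=
  (NLPred.lt s N).and ((NLPred.lt t N).and (NLPred.bit_term true (NLTerm.edgePos a N s t)))

theorem NLPred.codes (N s : α) : NLPred fun w (x : α → ℕ) => Codes a (x N) w (x s) := by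
  refine NLPred.and (NLPred.length_eq_term ?_) (NLPred.and (NLPred.forall_lt ?_ N)
    (NLPred.and (NLPred.bit false N) (NLPred.and (NLPred.forall_lt (Q := fun w x u =>
      (u = x s ∧ w[x N + 1 + u]? = some true) ∨ (u ≠ x s ∧ w[x N + 1 + u]? = some false)) ?_ N)
      ((NLPred.lt s N).and
      (NLPred.forall_lt (Q := fun w x u => ∃ t < x N, CodedEdge a (x N) w u t)
      (NLPred.exists_lt ?_ (some N)) N)))))
  · exact ((((NLTerm.var N).add (NLTerm.const 1)).add (NLTerm.var N)).add
      ((NLTerm.var N).mul_const a)).add (NLTerm.mul_var N N)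
  · exact NLPred.bit true none
  · exact ((NLPred.eq none (some s)).and (NLPred.bit_term true (NLTerm.initPos (some N) none))).or
      ((NLPred.ne none (some s)).and (NLPred.bit_term false (NLTerm.initPos (some N) none)))
  · exact NLPred.codedEdge a (some (some N)) (some none) none

/-- The labels coded for a tuple of states. -/
def CodedTuple (a n : ℕ) (w : List Bool) {V : Type} (ℓ : V → Set (Fin a)) (g : V → ℕ) : Prop :=
  ∀ v p, (p ∈ ℓ v ∧ w[n + 1 + n + (g v * a + p)]? = some true) ∨
    (p ∉ ℓ v ∧ w[n + 1 + n + (g v * a + p)]? = some false)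

theorem Codes.codedTuple_iff {a n : ℕ} {w : List Bool} {s₀ : ℕ} (h : Codes a n w s₀) {V : Type}
    {ℓ : V → Set (Fin a)} {g : V → ℕ} (hg : ∀ v, g v < n) :
    CodedTuple a n w ℓ g ↔ ℓ = fun v => codedLabel a n w (g v) := by
  constructor
  · intro h'
    funext v
    ext p
    rcases h' v p with ⟨h1, h2⟩ | ⟨h1, h2⟩
    · exact iff_of_true h1 h2
    · refine iff_of_false h1 fun h3 => ?_
      rw [codedLabel, Set.mem_ofPred_eq, h2] at h3
      simp at h3
  · rintro rfl v p
    have h1 : n + 1 + n + (g v * a + p) < w.length := by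
      have : (g v * a + p : ℕ) < n * a := calc
        (g v * a + p : ℕ) < (g v + 1) * a := by rw [add_one_mul]; have := p.2; omega
        _ ≤ n * a := Nat.mul_le_mul_right _ (hg v)
      rw [h.1]
      omega
    simp only [codedLabel, Set.mem_ofPred_eq, List.getElem?_eq_getElem h1]
    cases w[n + 1 + n + (g v * a + p)] <;> simp

theorem Codes.codedNonEdge_iff {a n : ℕ} {w : List Bool} {s₀ : ℕ} (h : Codes a n w s₀) {s t : ℕ}
    (hs : s < n) (ht : t < n) : CodedNonEdge a n w s t ↔ ¬ CodedEdge a n w s t := by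
  have h1 : n + 1 + n + n * a + (s * n + t) < w.length := by
    have : s * n + t < n * n := calc
      s * n + t < (s + 1) * n := by rw [add_one_mul]; omega
      _ ≤ n * n := Nat.mul_le_mul_right _ hs
    rw [h.1]
    omega
  simp only [CodedNonEdge, CodedEdge, List.getElem?_eq_getElem h1, hs, ht, true_and]
  cases w[n + 1 + n + n * a + (s * n + t)] <;> simp

theorem NLPred.codedTuple {V : Type} [Finite V] (N : α) (ℓ : V → Set (Fin a)) (g : V → α) :
    NLPred fun w (x : α → ℕ) => CodedTuple a (x N) w ℓ fun v => x (g v) :=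
  NLPred.forall_finite fun v => NLPred.forall_finite fun p =>
    ((NLPred.const _).and (NLPred.bit_term true (NLTerm.labelPos a N (g v) p))).or
      ((NLPred.const _).and (NLPred.bit_term false (NLTerm.labelPos a N (g v) p)))

variable {V : Set ℕ} {ψ : HyperBody (Fin a)}

/-- Steps of the product, in terms of the coding word. -/
def CodedStep (n : ℕ) (w : List Bool) (g g' : V ⊕ ψ.subs → ℕ) : Prop :=
  (∀ x, CodedEdge a n w (g (.inl x)) (g' (.inl x))) ∧ ∃ ℓ : V → Set (Fin a),
    CodedTuple a n w ℓ (fun x => g (.inl x)) ∧ ∃ τ : ψ.subs → Prop,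
      (∀ χ, g' (.inr χ) = 0 ↔ τ χ) ∧
      ∀ χ : ψ.subs, g (.inr χ) = 0 ↔ HyperBody.Now ℓ (fun ξ => ∃ h, τ ⟨ξ, h⟩) χ.1

/-- Final configurations of the product, in terms of the coding word. -/
def CodedFinal (n : ℕ) (w : List Bool) (g : V ⊕ ψ.subs → ℕ) : Prop :=
  (∀ x, CodedEdge a n w (g (.inl x)) (g (.inl x))) ∧ ∃ ℓ : V → Set (Fin a),
    CodedTuple a n w ℓ (fun x => g (.inl x)) ∧
      ∀ χ : ψ.subs, g (.inr χ) = 0 ↔ HyperBody.Always ℓ χ.1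

variable {a}

/-- The label tuple `ℓ` and the claims `τ` range over finite types. Quantifying over them outside
replaces the recursively defined `Now`, which depends on the input, by a finite disjunction over
constant propositions; exactly one choice fits the coded labels and the next configuration. -/
theorem Codes.codedStep_iff {n : ℕ} {w : List Bool} {s₀ : ℕ} (h : Codes a n w s₀)
    {g g' : V ⊕ ψ.subs → ℕ} : CodedStep a n w g g' ↔
      ProductStep (CodedEdge a n w) (codedLabel a n w) g g' := by
  refine and_congr_right fun h1 => ?_
  simp only [h.codedTuple_iff fun v => (h1 v).1, exists_eq_left]
  constructor
  · rintro ⟨τ, h2, h3⟩ χ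
    rw [h3]
    refine iff_of_eq (congrArg (fun N => HyperBody.Now _ N _) (funext fun ξ => ?_))
    exact propext (exists_congr fun h => (h2 _).symm)
  · exact fun h2 => ⟨fun χ => g' (.inr χ) = 0, fun χ => Iff.rfl, h2⟩

theorem Codes.codedFinal_iff {n : ℕ} {w : List Bool} {s₀ : ℕ} (h : Codes a n w s₀)
    {g : V ⊕ ψ.subs → ℕ} : CodedFinal a n w g ↔
      ProductFinal (CodedEdge a n w) (codedLabel a n w) g := by
  refine and_congr_right fun h1 => ?_
  simp only [h.codedTuple_iff fun v => (h1 v).1, exists_eq_left]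

theorem NLPred.codedStep [Finite V] (N : α) (g g' : V ⊕ ψ.subs → α) :
    NLPred fun w (x : α → ℕ) => CodedStep a (x N) w (fun c => x (g c)) fun c => x (g' c) :=
  (NLPred.forall_finite fun v => NLPred.codedEdge a N (g (.inl v)) (g' (.inl v))).and
    (NLPred.exists_finite fun ℓ => (NLPred.codedTuple a N ℓ fun v => g (.inl v)).and
      (NLPred.exists_finite fun _ =>
        (NLPred.forall_finite fun χ => NLPred.eq_zero_iff (g' (.inr χ)) _).and
          (NLPred.forall_finite fun χ => NLPred.eq_zero_iff (g (.inr χ)) _)))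

theorem NLPred.codedFinal [Finite V] (N : α) (g : V ⊕ ψ.subs → α) :
    NLPred fun w (x : α → ℕ) => CodedFinal a (x N) w fun c => x (g c) :=
  (NLPred.forall_finite fun v => NLPred.codedEdge a N (g (.inl v)) (g (.inl v))).and
    (NLPred.exists_finite fun ℓ => (NLPred.codedTuple a N ℓ fun v => g (.inl v)).and
      (NLPred.forall_finite fun χ => NLPred.eq_zero_iff (g (.inr χ)) _))

/-- An accepting run of the product from the initial state `s₀`. -/
def CodedRun (V : Set ℕ) (ψ : HyperBody (Fin a)) (n : ℕ) (w : List Bool) (s₀ : ℕ) : Prop :=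
  ∃ g₀ : V ⊕ ψ.subs → ℕ, (∀ c, g₀ c < numBound w) ∧ ∃ g₁ : V ⊕ ψ.subs → ℕ,
    (∀ c, g₁ c < numBound w) ∧ (∀ x, g₀ (.inl x) = s₀) ∧
      g₀ (.inr ⟨ψ, ψ.self_mem_subs⟩) = 0 ∧ CodedFinal a n w g₁ ∧
      Relation.ReflTransGen (fun g g' => CodedStep a n w g g' ∧ ∀ c, g' c < numBound w) g₀ g₁

theorem NLPred.codedRun [Finite V] (N s : α) :
    NLPred fun w (x : α → ℕ) => CodedRun V ψ (x N) w (x s) := by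
  refine NLPred.exTuple (P := fun w x (g₀ : V ⊕ ψ.subs → ℕ) => ∃ g₁ : V ⊕ ψ.subs → ℕ,
    (∀ c, g₁ c < numBound w) ∧ (∀ v, g₀ (.inl v) = x s) ∧
      g₀ (.inr ⟨ψ, ψ.self_mem_subs⟩) = 0 ∧ CodedFinal a (x N) w g₁ ∧
      Relation.ReflTransGen (fun g g' => CodedStep a (x N) w g g' ∧ ∀ c, g' c < numBound w) g₀ g₁)
    (NLPred.exTuple (P := fun w (x : α ⊕ (V ⊕ ψ.subs) → ℕ) (g₁ : V ⊕ ψ.subs → ℕ) =>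
      (∀ v : V, x (.inr (.inl v)) = x (.inl s)) ∧
      x (.inr (.inr ⟨ψ, ψ.self_mem_subs⟩)) = 0 ∧ CodedFinal a (x (.inl N)) w g₁ ∧
      Relation.ReflTransGen (fun g g' => CodedStep a (x (.inl N)) w g g' ∧ ∀ c, g' c < numBound w)
        (fun c => x (.inr c)) g₁) ?_)
  refine (NLPred.forall_finite fun v => NLPred.eq _ _).and ((NLPred.eq_zero _).and
    ((NLPred.codedFinal _ _).and (NLPred.tcTuple
      (R := fun w (x : (α ⊕ (V ⊕ ψ.subs)) ⊕ (V ⊕ ψ.subs) → ℕ) g g' =>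
        CodedStep a (x (.inl (.inl N))) w g g') ?_ (fun c => .inl (.inr c)) fun c => .inr c)))
  exact NLPred.codedStep _ _ _

end Membership

/-- The number of states and the initial state are guessed; then the format of the word, acyclicity
and an accepting run of the product are verified. -/
theorem acyclicRepair_mem_NL {a : ℕ} {φ : HyperLTL (Fin a)} (hφ : φ.IsEStar) :
    AcyclicRepair φ ∈ NL := by
  refine NLPred.mem_NL (P := fun w _ => ∃ n < numBound w, ∃ s₀ < numBound w, Codes a n w s₀ ∧
    ((∀ s < n, CodedNonEdge a n w s s ∨ ∀ t < n, CodedNonEdge a n w s t ∨ t = s) ∧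
    CountCert (numBound w) n (fun u v => CodedEdge a n w u v ∧ u ≠ v)
      (fun u v => CodedNonEdge a n w u v ∨ u = v)) ∧ CodedRun φ.boundVars φ.matrix n w s₀) ?_ _ ?_
  · refine NLPred.ex (P := fun w _ n => ∃ s₀ < numBound w, Codes a n w s₀ ∧
      ((∀ s < n, CodedNonEdge a n w s s ∨ ∀ t < n, CodedNonEdge a n w s t ∨ t = s) ∧
      CountCert (numBound w) n (fun u v => CodedEdge a n w u v ∧ u ≠ v)
      (fun u v => CodedNonEdge a n w u v ∨ u = v)) ∧ CodedRun φ.boundVars φ.matrix n w s₀)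
      (NLPred.ex (P := fun w (x : Option Empty → ℕ) s₀ => Codes a (x none) w s₀ ∧
      ((∀ s < x none, CodedNonEdge a (x none) w s s ∨ ∀ t < x none,
        CodedNonEdge a (x none) w s t ∨ t = s) ∧
      CountCert (numBound w) (x none) (fun u v => CodedEdge a (x none) w u v ∧ u ≠ v)
      (fun u v => CodedNonEdge a (x none) w u v ∨ u = v)) ∧
      CodedRun φ.boundVars φ.matrix (x none) w s₀) ?_)
    refine (NLPred.codes a _ _).and ((NLPred.and ?_ ?_).and (NLPred.codedRun _ _))
    · refine NLPred.forall_lt (Q := fun w (x : Option (Option Empty) → ℕ) s =>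
        CodedNonEdge a (x (some none)) w s s ∨ ∀ t < x (some none),
        CodedNonEdge a (x (some none)) w s t ∨ t = s) ?_ _
      refine (NLPred.codedNonEdge a _ _ _).or (NLPred.forall_lt
        (Q := fun w (x : Option (Option (Option Empty)) → ℕ) t =>
        CodedNonEdge a (x (some (some none))) w (x none) t ∨ t = x none) ?_ _)
      exact (NLPred.codedNonEdge a _ _ _).or (NLPred.eq _ _)
    · refine NLPred.countCert (R := fun w (x : Option (Option Empty) → ℕ) u v =>
        CodedEdge a (x (some none)) w u v ∧ u ≠ v)
        (R' := fun w (x : Option (Option Empty) → ℕ) u v =>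
        CodedNonEdge a (x (some none)) w u v ∨ u = v) ?_ ?_ fun w x u v h => ⟨h.1.1, h.1.2.1⟩
      · exact (NLPred.codedEdge a _ _ _).and (NLPred.ne _ _)
      · exact (NLPred.codedNonEdge a _ _ _).or (NLPred.eq _ _)
  · intro w
    have key : ∀ (n : ℕ) (K : Kripke (Fin a) (Fin n)), w = K.encode → n < numBound w ∧
        ((AcyclicFrame K.δ ∧ K.HasRepair φ) ↔
        ((∀ s < n, CodedNonEdge a n w s s ∨ ∀ t < n, CodedNonEdge a n w s t ∨ t = s) ∧
        CountCert (numBound w) n (fun u v => CodedEdge a n w u v ∧ u ≠ v)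
          (fun u v => CodedNonEdge a n w u v ∨ u = v)) ∧
          CodedRun φ.boundVars φ.matrix n w K.init) := by
      intro n K hw
      have hc : Codes a n w K.init := hw ▸ K.codes_encode
      have hn : n < numBound w := by
        have := lt_two_pow_wordLength w
        have := hc.1
        rw [numBound]
        omega
      -- An initial state exists, so there is at least one state, and `n` is below the bound.
      have h2 : 2 ≤ numBound w := by
        have := hc.2.2.2.2.1
        omega
      refine ⟨hn, ?_⟩
      rw [K.acyclicFrame_iff_countCert hw (R' := fun u v => CodedNonEdge a n w u v ∨ u = v)
        (fun u hu v hv => by rw [hc.codedNonEdge_iff hu hv]; tauto) hn]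
      have hloop : (∀ s < n, CodedNonEdge a n w s s ∨ ∀ t < n, CodedNonEdge a n w s t ∨ t = s) ↔
          (∀ s < n, ¬ CodedEdge a n w s s ∨ ∀ t < n, ¬ CodedEdge a n w s t ∨ t = s) :=
        forall₂_congr fun s hs => or_congr (hc.codedNonEdge_iff hs hs)
          (forall₂_congr fun t ht => or_congr_left (hc.codedNonEdge_iff hs ht))
      rw [hloop]
      refine and_congr_right fun hac => ?_
      have hac' : AcyclicFrame K.δ := by
        rwa [K.acyclicFrame_iff_countCert hw (R' := fun u v => CodedNonEdge a n w u v ∨ u = v)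
          (fun u hu v hv => by rw [hc.codedNonEdge_iff hu hv]; tauto) hn]
      rw [K.hasRepair_iff_models hφ, K.models_iff_exists_paths hφ, ← hw, exists_paths_iff
        (B := numBound w) (by rw [hw]; exact Kripke.eventually_constant hac') h2
        fun s t h => h.1.trans hn]
      simp only [CodedRun, hc.codedStep_iff, hc.codedFinal_iff]
      constructor
      · rintro ⟨g₀, g₁, h3, h4, h5⟩
        exact ⟨g₀, h3, g₁, h4, h5⟩
      · rintro ⟨g₀, h3, g₁, h4, h5⟩
        exact ⟨g₀, g₁, h3, h4, h5⟩
    constructor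
    · rintro ⟨n, K, h1, h2, h3⟩
      obtain ⟨h4, h5⟩ := key n K h3
      exact ⟨n, h4, K.init, K.init.2.trans h4, h3 ▸ K.codes_encode, h5.1 ⟨h1, h2⟩⟩
    · rintro ⟨n, -, s₀, -, h1, h2⟩
      obtain ⟨K, hK⟩ := Kripke.exists_eq_encode h1
      -- The indicator vector has a single one, so the guessed initial state is the encoded one.
      have hs : s₀ = K.init := by
        rcases (K.codes_encode.2.2.2.1 s₀ h1.2.2.2.2.1) with h3 | h3
        · exact h3.1
        · rcases h1.2.2.2.1 s₀ h1.2.2.2.2.1 with h4 | h4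
          · rw [hK, h3.2] at h4
            simp at h4
          · exact (h4.1 rfl).elim
      rw [hs] at h2
      have := (key n K hK).2.2 h2
      exact ⟨n, K, this.1, this.2, hK⟩

/-! ### Regular predicates of words -/

/-- Predicates of words that are decided by finite automata. -/
def RegPred {Z : Type} (P : List Z → Prop) : Prop := Language.IsRegular {l | P l}

/-- The words that lead from one state of a transition system to another one. -/
def Runs {κ Z : Type} (f : κ → Z → κ → Prop) : κ → List Z → κ → Prop
  | s, [], s' => s = s'
  | s, z :: v, s' => ∃ s₁, f s z s₁ ∧ Runs f s₁ v s'

namespace RegPred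

variable {Z Z' : Type} {P Q : List Z → Prop}

theorem and (hP : RegPred P) (hQ : RegPred Q) : RegPred fun l => P l ∧ Q l :=
  Language.IsRegular.inf hP hQ

theorem or (hP : RegPred P) (hQ : RegPred Q) : RegPred fun l => P l ∨ Q l :=
  Language.IsRegular.add hP hQ

theorem not (hP : RegPred P) : RegPred fun l => ¬ P l :=
  Language.IsRegular.compl hP

theorem comap {P : List Z' → Prop} (hP : RegPred P) (f : Z → Z') : RegPred fun l => P (l.map f) := by
  obtain ⟨σ, hσ, M, hM⟩ := hP
  refine ⟨σ, hσ, M.comap f, ?_⟩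
  rw [DFA.accepts_comap, hM]
  rfl

/-- The relation is the transition relation of a nondeterministic automaton, made deterministic by
the subset construction. -/
theorem runs {κ : Type} [Finite κ] (f : κ → Z → κ → Prop) (s s' : κ) :
    RegPred fun l => Runs f s l s' := by
  classical
  have := Fintype.ofFinite κ
  let N : NFA Z κ := ⟨fun t z => {t' | f t z t'}, {s}, {s'}⟩
  refine ⟨Set κ, Fintype.ofFinite _, N.toDFA, ?_⟩
  rw [NFA.toDFA_correct]
  have key : ∀ (l : List Z) (s : κ), s' ∈ N.evalFrom {s} l ↔ Runs f s l s' := by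
    intro l
    induction l with
    | nil => intro s; simp [Runs, eq_comm]
    | cons z l ih =>
      intro s
      rw [NFA.evalFrom_cons, NFA.stepSet_singleton, NFA.mem_evalFrom_iff_exists]
      simp only [ih]
      rfl
  ext l
  rw [NFA.mem_accepts]
  refine Iff.trans ?_ (key l s)
  simp [N]

theorem const (c : Prop) : RegPred fun _ : List Z => c := by
  by_cases hc : c
  · have : (fun _ : List Z => c) = fun l => Runs (fun _ _ _ => True) () l () := by
      funext l
      induction l with
      | nil => simp [Runs, hc]
      | cons z l ih => exact ih.trans (propext ⟨fun h => ⟨(), trivial, h⟩, fun ⟨_, _, h⟩ => h⟩)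
    rw [this]
    exact runs _ _ _
  · have : (fun _ : List Z => c) = fun l => Runs (fun _ _ _ => False) true l false := by
      funext l
      cases l <;> simp [Runs, hc]
    rw [this]
    exact runs _ _ _

theorem all (R : Z → Prop) : RegPred fun l => ∀ z ∈ l, R z := by
  have : (fun l : List Z => ∀ z ∈ l, R z) = fun l => Runs (fun _ z _ => R z) () l () := by
    funext l
    induction l with
    | nil => simp [Runs]
    | cons z l ih => simp [Runs, ← ih]
  rw [this]
  exact runs _ _ _

theorem exists_finite {ι : Type} [Finite ι] {P : ι → List Z → Prop} (hP : ∀ i, RegPred (P i)) :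
    RegPred fun l => ∃ i, P i l := by
  have := Fintype.ofFinite ι
  have key : ∀ s : Finset ι, RegPred fun l => ∃ i ∈ s, P i l := by
    classical
    intro s
    induction s using Finset.induction with
    | empty => simpa using const (Z := Z) False
    | insert i s _ ih => simpa using (hP i).or ih
  simpa using key Finset.univ

theorem forall_finite {ι : Type} [Finite ι] {P : ι → List Z → Prop} (hP : ∀ i, RegPred (P i)) :
    RegPred fun l => ∀ i, P i l := by
  simpa using (exists_finite fun i => (hP i).not).not

end RegPred

/-! ### Regular arithmetic -/

section Digits

variable {A : Type} {m : ℕ} (e : A ≃ Fin m)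

/-- Addition of a carry to a digit. -/
def CarryStep (c : Bool) (d : A × A) (c' : Bool) : Prop :=
  (e d.2 : ℕ) + m * c'.toNat = e d.1 + c.toNat

/-- The carry identity in base `m`. From `true` to `false` it says that the second number is the
successor of the first, with no overflow. -/
theorem runs_carryStep [NeZero m] {c c' : Bool} {l : List (A × A)} : Runs (CarryStep e) c l c' ↔
    numVal e (l.map Prod.snd) + m ^ l.length * c'.toNat =
      numVal e (l.map Prod.fst) + c.toNat := by
  have hm := NeZero.pos m
  induction l generalizing c with
  | nil => cases c <;> cases c' <;> simp [Runs, numVal]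
  | cons d l ih =>
    simp only [Runs, ih, List.map_cons, numVal, CarryStep, List.length_cons, pow_succ']
    have h1 := (e d.1).2
    have h2 := (e d.2).2
    generalize (e d.1 : ℕ) = x at *
    generalize (e d.2 : ℕ) = y at *
    generalize numVal e (l.map Prod.snd) = Y at *
    generalize numVal e (l.map Prod.fst) = X at *
    rw [mul_assoc]
    generalize m ^ l.length * c'.toNat = T at *
    constructor
    · rintro ⟨c₁, h3, h4⟩
      have : m * (Y + T) = m * (X + c₁.toNat) := by rw [h4]
      rw [mul_add, mul_add] at this
      omega
    · intro h
      have hc : c.toNat ≤ 1 := Bool.toNat_le c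
      -- Since x < m and the carry is at most 1, x plus the carry is either a digit or exactly m.
      -- Reducing modulo m determines y, and dividing by m gives the equation for the remaining
      -- digits.
      by_cases h3 : x + c.toNat < m
      · have h4 : y = x + c.toNat := by
          have : (y + m * (Y + T)) % m = (x + c.toNat + m * X) % m := by
            rw [mul_add]; congr 1; omega
          rwa [Nat.add_mul_mod_self_left, Nat.add_mul_mod_self_left, Nat.mod_eq_of_lt h2,
            Nat.mod_eq_of_lt h3] at this
        refine ⟨false, by simpa using h4, ?_⟩
        refine Nat.eq_of_mul_eq_mul_left hm ?_
        rw [mul_add, Bool.toNat_false, add_zero]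
        omega
      · have h5 : x + c.toNat = m := by omega
        have h4 : y = 0 := by
          have : (y + m * (Y + T)) % m = (0 + m * (X + 1)) % m := by
            rw [mul_add, mul_add]; congr 1; omega
          rwa [Nat.add_mul_mod_self_left, Nat.add_mul_mod_self_left, Nat.mod_eq_of_lt h2,
            Nat.zero_mod] at this
        refine ⟨true, by simp; omega, ?_⟩
        refine Nat.eq_of_mul_eq_mul_left hm ?_
        rw [mul_add, mul_add, Bool.toNat_true]
        omega

theorem numVal_eq_max [NeZero m] {l : List A} : (∀ d ∈ l, (e d : ℕ) + 1 = m) ↔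
    numVal e l + 1 = m ^ l.length := by
  have hm := NeZero.pos m
  induction l with
  | nil => simp [numVal]
  | cons d l ih =>
    have h1 := (e d).2
    have h2 := numVal_lt e l
    simp only [List.mem_cons, forall_eq_or_imp, ih, numVal, List.length_cons, pow_succ']
    constructor
    · rintro ⟨h3, h4⟩
      rw [← h4, mul_add]
      omega
    · intro h
      have h3 : m * (numVal e l + 1) ≤ m * m ^ l.length := Nat.mul_le_mul_left _ h2
      rw [mul_add, mul_one] at h3
      have h4 : (e d : ℕ) + 1 = m := by omega
      refine ⟨h4, Nat.eq_of_mul_eq_mul_left hm ?_⟩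
      rw [mul_add]
      omega

end Digits

/-! ### Deterministic passes -/

/-- The result of a deterministic pass over a word. -/
def sweep {S Δ : Type} (f : S → Δ → S × Δ) : S → List Δ → S × List Δ
  | s, [] => (s, [])
  | s, d :: v => ((sweep f (f s d).1 v).1, (f s d).2 :: (sweep f (f s d).1 v).2)

theorem scan_sweep {S Δ : Type} (f : S → Δ → S × Δ) (s : S) (v : List Δ) :
    Scan (fun s d => {f s d}) s v (sweep f s v).1 (sweep f s v).2 := by
  induction v generalizing s with
  | nil => exact .nil s
  | cons d v ih => exact .cons rfl (ih _)

/-- The primitive command for a deterministic pass. -/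
def Prim.ofFun {S Δ O : Type} (start : InputSymbol → S × HeadMove × Option O)
    (scan : S → Δ → S × Δ) (res : S → Bool) : Prim S Δ O where
  start x := {start x}
  scan s d := {scan s d}
  res := res

theorem Prim.det_ofFun {S Δ O : Type} (start : InputSymbol → S × HeadMove × Option O)
    (scan : S → Δ → S × Δ) (res : S → Bool) : (Prim.ofFun start scan res).Det :=
  ⟨fun _ => Set.subsingleton_singleton, fun _ _ => Set.subsingleton_singleton⟩

theorem Prim.rel_ofFun {S Δ O : Type} {w : List Bool} (start : InputSymbol → S × HeadMove × Option O)
    (scan : S → Δ → S × Δ) (res : S → Bool) (p : ℕ) (v : List Δ) (o : List O) :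
    (Prim.ofFun start scan res).Rel w ⟨p, v, o⟩
      (res (sweep scan (start (inputSymbol w p)).1 v).1)
      ⟨min ((start (inputSymbol w p)).2.1.apply p) (w.length + 1),
        (sweep scan (start (inputSymbol w p)).1 v).2,
        o ++ (start (inputSymbol w p)).2.2.toList⟩ :=
  ⟨_, _, _, _, rfl, scan_sweep _ _ _, rfl, rfl, rfl⟩

/-! ### Building blocks of transducers -/

instance : Finite InputSymbol := by
  refine Finite.of_surjective (fun o : Option (Option Bool) =>
    o.elim InputSymbol.leftEnd fun o => o.elim InputSymbol.rightEnd InputSymbol.bit) fun x => ?_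
  cases x with
  | leftEnd => exact ⟨none, rfl⟩
  | bit b => exact ⟨some (some b), rfl⟩
  | rightEnd => exact ⟨some none, rfl⟩

namespace Transducer

variable {Δ ι : Type} {D : ι → Type} (Au : ∀ i, DFA Δ (D i))

/-- The states of passes: a flag, or a state of one of the automata. -/
abbrev PassState (D : ι → Type) : Type := Bool ⊕ (Σ i, D i)

/-- A pass that runs an automaton and does not change the word. -/
def passScan : PassState D → Δ → PassState D × Δ
  | .inl b, d => (.inl b, d)
  | .inr ⟨i, q⟩, d => (.inr ⟨i, (Au i).step q d⟩, d)

theorem sweep_passScan_inl (b : Bool) (v : List Δ) :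
    sweep (passScan Au) (.inl b) v = (.inl b, v) := by
  induction v with
  | nil => rfl
  | cons d v ih => simp [sweep, passScan, ih]

theorem sweep_passScan_inr (i : ι) (q : D i) (v : List Δ) :
    sweep (passScan Au) (.inr ⟨i, q⟩) v = (.inr ⟨i, (Au i).evalFrom q v⟩, v) := by
  induction v generalizing q with
  | nil => rfl
  | cons d v ih => simp [sweep, passScan, ih]

/-- Writing a bit on the output tape. -/
def emitPrim (b : Bool) : Prim (PassState D) Δ Bool :=
  .ofFun (fun _ => (.inl true, .stay, some b)) (passScan Au) fun _ => true

open Classical in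
/-- Running an automaton that depends on the input symbol. -/
noncomputable def testPrim (g : InputSymbol → ι) : Prim (PassState D) Δ Bool :=
  .ofFun (fun x => (.inr ⟨g x, (Au (g x)).start⟩, .stay, none)) (passScan Au)
    fun s => s.elim id fun q => decide (q.2 ∈ (Au q.1).accept)

/-- Whether a symbol is different from the left end marker. -/
def notLeftEnd : InputSymbol → Bool
  | .leftEnd => false
  | _ => true

/-- Moving the input head to the left, until it is on the left end marker. -/
def backPrim : Prim (PassState D) Δ Bool :=
  .ofFun (fun x => (.inl (notLeftEnd x), .left, none)) (passScan Au)
    fun s => s.elim id fun _ => true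

/-- Moving the input head to the right. -/
def forwardPrim : Prim (PassState D) Δ Bool :=
  .ofFun (fun _ => (.inl true, .right, none)) (passScan Au) fun _ => true

/-- Rewriting every letter. -/
def mapPrim (D : ι → Type) (h : Δ → Δ) : Prim (PassState D) Δ Bool :=
  .ofFun (fun _ => (.inl true, .stay, none)) (fun s d => (s, h d)) fun _ => true

section Inc

variable {A B : Type} {m : ℕ} [NeZero m] (e : A ≃ Fin m) (τ : Δ ≃ A × B)

/-- The pass that increments the number on the track `τ`. -/
def incScan (D : ι → Type) : PassState D → Δ → PassState D × Δ
  | .inl true, d => if (e (τ d).1 : ℕ) + 1 = m then (.inl true, τ.symm (e.symm 0, (τ d).2))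
      else (.inl false, τ.symm (e.symm (Fin.ofNat m (e (τ d).1 + 1)), (τ d).2))
  | s, d => (s, d)

/-- Incrementing the number on the track `τ`. -/
def incPrim (D : ι → Type) : Prim (PassState D) Δ Bool :=
  .ofFun (fun _ => (.inl true, .stay, none)) (incScan e τ D) fun s => s.elim (fun b => !b) fun _ => true

theorem sweep_incScan (c : Bool) (v : List Δ) : ∃ c' : Bool,
    (sweep (incScan e τ D) (.inl c) v).1 = .inl c' ∧
    (sweep (incScan e τ D) (.inl c) v).2.length = v.length ∧
    (sweep (incScan e τ D) (.inl c) v).2.map (fun d => (τ d).2) = v.map (fun d => (τ d).2) ∧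
    numVal e ((sweep (incScan e τ D) (.inl c) v).2.map fun d => (τ d).1) + m ^ v.length * c'.toNat =
      numVal e (v.map fun d => (τ d).1) + c.toNat := by
  induction v generalizing c with
  | nil => exact ⟨c, rfl, rfl, rfl, by simp [sweep, numVal]⟩
  | cons d v ih =>
    rcases c with _ | _
    · obtain ⟨c', h1, h2, h3, h4⟩ := ih false
      refine ⟨c', h1, ?_, ?_, ?_⟩
      · simpa [sweep, incScan] using h2
      · simpa [sweep, incScan] using h3
      · simp only [sweep, incScan, List.map_cons, numVal, List.length_cons, pow_succ']
        rw [add_assoc, mul_assoc, ← mul_add, h4]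
        simp
    · by_cases h : (e (τ d).1 : ℕ) + 1 = m
      · obtain ⟨c', h1, h2, h3, h4⟩ := ih true
        refine ⟨c', ?_, ?_, ?_, ?_⟩
        · simpa [sweep, incScan, h] using h1
        · simpa [sweep, incScan, h] using h2
        · simpa [sweep, incScan, h] using h3
        · simp only [sweep, incScan, if_pos h, List.map_cons, numVal, List.length_cons, pow_succ',
            Equiv.apply_symm_apply]
          rw [add_assoc, mul_assoc, ← mul_add, h4, mul_add]
          simp
          omega
      · obtain ⟨c', h1, h2, h3, h4⟩ := ih false
        refine ⟨c', ?_, ?_, ?_, ?_⟩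
        · simpa [sweep, incScan, h] using h1
        · simpa [sweep, incScan, h] using h2
        · simpa [sweep, incScan, h] using h3
        · have h5 : (e (τ d).1 : ℕ) + 1 < m := by have := (e (τ d).1).2; omega
          simp only [sweep, incScan, if_neg h, List.map_cons, numVal, List.length_cons, pow_succ',
            Equiv.apply_symm_apply, Fin.val_ofNat, Nat.mod_eq_of_lt h5]
          rw [add_assoc, mul_assoc, ← mul_add, h4]
          simp
          omega

/-- The word with `a` on the track `τ` and `c` on the rest. -/
def trackWord (a : List A) (c : List B) : List Δ := (a.zip c).map τ.symm

theorem map_trackWord {a : List A} {c : List B} (h : a.length = c.length) :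
    ((trackWord τ a c).map fun d => (τ d).1) = a ∧ ((trackWord τ a c).map fun d => (τ d).2) = c := by
  constructor
  · simp only [trackWord, List.map_map, Function.comp_def, Equiv.apply_symm_apply]
    exact List.map_fst_zip h.le
  · simp only [trackWord, List.map_map, Function.comp_def, Equiv.apply_symm_apply]
    exact List.map_snd_zip h.ge

theorem trackWord_map (v : List Δ) :
    trackWord τ (v.map fun d => (τ d).1) (v.map fun d => (τ d).2) = v := by
  simp [trackWord, List.zip_map', Function.comp_def]

/-- The increment is cyclic and reports whether it stayed below the maximum. A counter is therefore
back at 0 when its loop ends, ready for the next round of an enclosing loop. -/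
theorem rel_incPrim {w : List Bool} {c : List B} {i : ℕ} (hi : i < m ^ c.length) (p : ℕ)
    (o : List Bool) : (incPrim e τ D).Rel w ⟨p, trackWord τ (numStr e c.length i) c, o⟩
      (decide (i + 1 < m ^ c.length))
      ⟨min p (w.length + 1), trackWord τ (numStr e c.length ((i + 1) % m ^ c.length)) c, o⟩ := by
  have hv := map_trackWord τ (length_numStr e c.length i)
  have hl : (trackWord τ (numStr e c.length i) c).length = c.length := by
    simp [trackWord, length_numStr]
  have := Prim.rel_ofFun (w := w) (O := Bool) (fun _ => (.inl true, .stay, none)) (incScan e τ D)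
    (fun s => s.elim (fun b => !b) fun _ => true) p (trackWord τ (numStr e c.length i) c) o
  obtain ⟨c', h1, h2, h3, h4⟩ := sweep_incScan (D := D) e τ true (trackWord τ (numStr e c.length i) c)
  rw [hv.1, hl, numVal_numStr e hi] at h4
  rw [hv.2] at h3
  generalize sweep (incScan e τ D) (.inl true) (trackWord τ (numStr e c.length i) c) = r at *
  have h5 : r.2 = trackWord τ (numStr e c.length ((i + 1) % m ^ c.length)) c := by
    rw [← trackWord_map τ r.2, h3]
    congr 1
    refine eq_of_numVal_eq e (by rw [List.length_map, h2, hl, length_numStr]) ?_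
    have h6 := numVal_lt e (r.2.map fun d => (τ d).1)
    rw [List.length_map, h2, hl] at h6
    rw [numVal_numStr e (Nat.mod_lt _ (by omega))]
    cases c' with
    | false =>
      simp at h4
      rw [← h4, Nat.mod_eq_of_lt h6]
    | true =>
      simp at h4
      have : i + 1 = m ^ c.length := by omega
      rw [this, Nat.mod_self]
      omega
  have h7 : (!c') = decide (i + 1 < m ^ c.length) := by
    have h6 := numVal_lt e (r.2.map fun d => (τ d).1)
    rw [List.length_map, h2, hl] at h6
    cases c' with
    | false => simp at h4; symm; simpa using by omega
    | true => simp at h4; symm; simpa using by omega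
  rw [h1, h5] at this
  unfold incPrim
  simpa [h7, HeadMove.apply] using this

end Inc

/-- Running a primitive command for its effect. -/
def run {S : Type} (a : Prim S Δ Bool) : Cmd S Δ Bool := .ite a .skip .skip

theorem exec_run {S : Type} {w : List Bool} {a : Prim S Δ Bool} {b : Bool} {s s' : Store Δ Bool}
    (h : a.Rel w s b s') : (run a).Exec w s s' := by
  cases b
  · exact .iteFalse h (.skip _)
  · exact .iteTrue h (.skip _)

/-- The program writes the word `l` and leaves the work tape as it is. -/
def Emits {S : Type} (w : List Bool) (c : Cmd S Δ Bool) (v : List Δ) (l : List Bool) : Prop :=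
  ∀ p o, ∃ p', c.Exec w ⟨p, v, o⟩ ⟨p', v, o ++ l⟩

theorem Emits.seq {S : Type} {w : List Bool} {c c' : Cmd S Δ Bool} {v : List Δ} {l l' : List Bool}
    (h : Emits w c v l) (h' : Emits w c' v l') : Emits w (.seq c c') v (l ++ l') := by
  intro p o
  obtain ⟨p₁, h1⟩ := h p o
  obtain ⟨p₂, h2⟩ := h' p₁ (o ++ l)
  exact ⟨p₂, .seq h1 (by rwa [List.append_assoc] at h2)⟩

/-- Executing a program for all values of a counter. -/
def forAll {S : Type} (inc : Prim S Δ Bool) (c : Cmd S Δ Bool) : Cmd S Δ Bool :=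
  .seq c (.loop inc c)

/-- The body runs once before the first increment, since the loop test increments. The last
increment wraps around, so the work word is restored as `Emits` demands. -/
theorem emits_forAll {S : Type} {w : List Bool} {inc : Prim S Δ Bool} {c : Cmd S Δ Bool} {N : ℕ}
    (hN : 0 < N) (u : ℕ → List Δ) (f : ℕ → List Bool)
    (hinc : ∀ i < N, ∀ p o, ∃ p', inc.Rel w ⟨p, u i, o⟩ (decide (i + 1 < N))
      ⟨p', u ((i + 1) % N), o⟩)
    (hc : ∀ i < N, Emits w c (u i) (f i)) :
    Emits w (forAll inc c) (u 0) ((List.range N).flatMap f) := by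
  have key : ∀ k i, i + k + 1 = N → ∀ p o, ∃ p', (Cmd.loop inc c).Exec w ⟨p, u i, o⟩
      ⟨p', u 0, o ++ (List.range' (i + 1) k).flatMap f⟩ := by
    intro k
    induction k with
    | zero =>
      intro i hi p o
      obtain ⟨p', h⟩ := hinc i (by omega) p o
      rw [show i + 1 = N by omega, Nat.mod_self] at h
      exact ⟨p', by simpa using Cmd.Exec.loopFalse (by simpa using h)⟩
    | succ k ih =>
      intro i hi p o
      obtain ⟨p₁, h1⟩ := hinc i (by omega) p o
      rw [Nat.mod_eq_of_lt (by omega), decide_eq_true (by omega)] at h1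
      obtain ⟨p₂, h2⟩ := hc (i + 1) (by omega) p₁ o
      obtain ⟨p₃, h3⟩ := ih (i + 1) (by omega) p₂ (o ++ f (i + 1))
      refine ⟨p₃, .loopTrue h1 h2 ?_⟩
      simpa [List.range'_succ] using h3
  intro p o
  obtain ⟨p₁, h1⟩ := hc 0 hN p o
  obtain ⟨p₂, h2⟩ := key (N - 1) 0 (by omega) p₁ (o ++ f 0)
  refine ⟨p₂, .seq h1 ?_⟩
  obtain ⟨N, rfl⟩ : ∃ N', N = N' + 1 := ⟨N - 1, by omega⟩
  simpa [List.range_eq_range', List.range'_succ] using h2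

theorem emits_emitPrim (w : List Bool) (b : Bool) (v : List Δ) :
    Emits w (run (emitPrim Au b)) v [b] := by
  intro p o
  have := Prim.rel_ofFun (w := w) (fun _ => (.inl true, .stay, some b)) (passScan Au)
    (fun _ => true) p v o
  rw [sweep_passScan_inl] at this
  exact ⟨_, exec_run this⟩

open Classical in
theorem rel_testPrim (w : List Bool) (g : InputSymbol → ι) (p : ℕ) (v : List Δ) (o : List Bool) :
    (testPrim Au g).Rel w ⟨p, v, o⟩ (decide (v ∈ (Au (g (inputSymbol w p))).accepts))
      ⟨min p (w.length + 1), v, o⟩ := by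
  have := Prim.rel_ofFun (w := w) (O := Bool)
    (fun x => (.inr ⟨g x, (Au (g x)).start⟩, .stay, none)) (passScan Au)
    (fun s => s.elim id fun q => decide (q.2 ∈ (Au q.1).accept)) p v o
  rw [sweep_passScan_inr] at this
  unfold testPrim
  simp only [Sum.elim_inr, Option.toList_none, List.append_nil] at this
  exact this

/-- Writing the result of a test. -/
noncomputable def outTest (g : InputSymbol → ι) : Cmd (PassState D) Δ Bool :=
  .ite (testPrim Au g) (run (emitPrim Au true)) (run (emitPrim Au false))

open Classical in
theorem exec_outTest (w : List Bool) (g : InputSymbol → ι) (p : ℕ) (v : List Δ) (o : List Bool) :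
    ∃ p', (outTest Au g).Exec w ⟨p, v, o⟩
      ⟨p', v, o ++ [decide (v ∈ (Au (g (inputSymbol w p))).accepts)]⟩ := by
  have h := rel_testPrim Au w g p v o
  by_cases h' : v ∈ (Au (g (inputSymbol w p))).accepts
  · rw [decide_eq_true h'] at h ⊢
    obtain ⟨p', h2⟩ := emits_emitPrim Au w true v (min p (w.length + 1)) o
    exact ⟨p', .iteTrue h h2⟩
  · rw [decide_eq_false h'] at h ⊢
    obtain ⟨p', h2⟩ := emits_emitPrim Au w false v (min p (w.length + 1)) o
    exact ⟨p', .iteFalse h h2⟩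

/-- The command moves left in any case and reports the symbol seen before the move; on cell 0 that
move has no effect, so the head ends there. -/
theorem exec_back (w : List Bool) (p : ℕ) (v : List Δ) (o : List Bool) :
    (Cmd.loop (backPrim Au) .skip).Exec w ⟨p, v, o⟩ ⟨0, v, o⟩ := by
  induction p using Nat.strong_induction_on with
  | _ p ih =>
    have := Prim.rel_ofFun (w := w) (O := Bool)
      (fun x => (.inl (notLeftEnd x), .left, none)) (passScan Au)
      (fun s => s.elim id fun _ => true) p v o
    rw [sweep_passScan_inl] at this
    rcases p with _ | p
    · refine .loopFalse ?_
      unfold backPrim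
      simpa [inputSymbol, notLeftEnd, HeadMove.apply] using this
    · have h1 : notLeftEnd (inputSymbol w (p + 1)) = true := by
        cases h : inputSymbol w (p + 1) with
        | leftEnd => exact absurd (NProg.inputSymbol_eq_leftEnd.1 h) (Nat.succ_ne_zero p)
        | bit b => rfl
        | rightEnd => rfl
      simp only [h1, HeadMove.apply, Sum.elim_inl, id, Option.toList_none, List.append_nil] at this
      exact .loopTrue this (.skip _) (ih _ (by omega))

theorem rel_forwardPrim (w : List Bool) (p : ℕ) (v : List Δ) (o : List Bool) :
    (forwardPrim Au).Rel w ⟨p, v, o⟩ true ⟨min (p + 1) (w.length + 1), v, o⟩ := by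
  have := Prim.rel_ofFun (w := w) (O := Bool) (fun _ => (.inl true, .right, none)) (passScan Au)
    (fun _ => true) p v o
  rw [sweep_passScan_inl] at this
  unfold forwardPrim
  simpa [HeadMove.apply] using this

theorem rel_mapPrim (w : List Bool) (h : Δ → Δ) (p : ℕ) (v : List Δ) (o : List Bool) :
    (mapPrim D h).Rel w ⟨p, v, o⟩ true ⟨min p (w.length + 1), v.map h, o⟩ := by
  have := Prim.rel_ofFun (w := w) (O := Bool) (fun _ => ((.inl true : PassState D), .stay, none))
    (fun s d => (s, h d)) (fun _ => true) p v o
  have key : ∀ (s : PassState D) (v : List Δ), (sweep (fun s d => (s, h d)) s v).2 = v.map h := by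
    intro s v
    induction v with
    | nil => rfl
    | cons d v ih => simp [sweep, ih]
  rw [key] at this
  unfold mapPrim
  simpa [HeadMove.apply] using this

end Transducer

/-! ### Transducers for automatic structures -/

namespace Transducer

section Words

variable {A : Type}

/-- The word with three given tracks. -/
def word₃ (s t : List A) (b : List Bool) : List (A × A × Bool) := s.zip (t.zip b)

/-- The first track. -/
def track₁ : A × A × Bool ≃ A × A × Bool := Equiv.refl _

/-- The second track. -/
def track₂ : A × A × Bool ≃ A × A × Bool where
  toFun d := (d.2.1, d.1, d.2.2)
  invFun d := (d.2.1, d.1, d.2.2)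
  left_inv _ := rfl
  right_inv _ := rfl

/-- The third track. -/
def track₃ : A × A × Bool ≃ Bool × A × A where
  toFun d := (d.2.2, d.1, d.2.1)
  invFun d := (d.2.1, d.2.2, d.1)
  left_inv _ := rfl
  right_inv _ := rfl

theorem word₃_eq₁ (s t : List A) (b : List Bool) : word₃ s t b = trackWord track₁ s (t.zip b) := by
  simp [word₃, trackWord, track₁]

theorem word₃_eq₂ (s t : List A) (b : List Bool) : word₃ s t b = trackWord track₂ t (s.zip b) := by
  induction s generalizing t b with
  | nil => cases t <;> simp [word₃, trackWord]
  | cons x s ih =>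
    rcases t with _ | ⟨y, t⟩
    · simp [word₃, trackWord]
    · rcases b with _ | ⟨z, b⟩
      · simp [word₃, trackWord]
      · have := ih t b
        simp only [word₃, trackWord, List.zip_cons_cons, List.map_cons] at this ⊢
        rw [this]
        rfl

theorem word₃_eq₃ (s t : List A) (b : List Bool) : word₃ s t b = trackWord track₃ b (s.zip t) := by
  induction s generalizing t b with
  | nil => cases b <;> simp [word₃, trackWord]
  | cons x s ih =>
    rcases t with _ | ⟨y, t⟩
    · cases b <;> simp [word₃, trackWord]
    · rcases b with _ | ⟨z, b⟩
      · simp [word₃, trackWord]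
      · have := ih t b
        simp only [word₃, trackWord, List.zip_cons_cons, List.map_cons] at this ⊢
        rw [this]
        rfl

theorem map_word₃ {s t : List A} {b : List Bool} (h1 : t.length = s.length)
    (h2 : b.length = s.length) : (word₃ s t b).map (fun d => d.1) = s ∧
      (word₃ s t b).map (fun d => (d.1, d.2.1)) = s.zip t ∧
      (word₃ s t b).map (fun d => (d.2.2, d.1)) = b.zip s := by
  induction s generalizing t b with
  | nil => simp_all [word₃]
  | cons x s ih =>
    rcases t with _ | ⟨y, t⟩
    · simp at h1
    · rcases b with _ | ⟨z, b⟩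
      · simp at h2
      · obtain ⟨h3, h4, h5⟩ := ih (t := t) (b := b) (by simpa using h1) (by simpa using h2)
        simp only [word₃, List.zip_cons_cons, List.map_cons] at h3 h4 h5 ⊢
        simp [h3, h4, h5]

end Words

variable {A : Type} {m : ℕ} [NeZero m] (e : A ≃ Fin m)

/-- The tests of the transducer. -/
def tests (pbit : A → Bool) (Init Lab : List A → Prop) (Edge : InputSymbol → List (A × A) → Prop) :
    Fin 3 ⊕ InputSymbol → List (A × A × Bool) → Prop
  | .inl i, v => ![Init (v.map fun d => d.1), Lab (v.map fun d => d.1),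
      ¬ ∀ z ∈ v.map fun d => (d.2.2, d.1), z.1 = pbit z.2] i
  | .inr x, v => Edge x (v.map fun d => (d.1, d.2.1))

theorem regPred_tests {pbit : A → Bool} {Init Lab : List A → Prop}
    {Edge : InputSymbol → List (A × A) → Prop} (hI : RegPred Init) (hL : RegPred Lab)
    (hE : ∀ x, RegPred (Edge x)) (i : Fin 3 ⊕ InputSymbol) :
    RegPred (tests pbit Init Lab Edge i) := by
  rcases i with i | x
  · fin_cases i
    · exact hI.comap _
    · exact hL.comap _
    · exact ((RegPred.all fun z : Bool × A => z.1 = pbit z.2).comap fun d : A × A × Bool =>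
        (d.2.2, d.1)).not
  · exact (hE x).comap _

theorem forall_mem_zip_iff {pbit : A → Bool} {b : List Bool} {s : List A}
    (h : b.length = s.length) : (∀ z ∈ b.zip s, z.1 = pbit z.2) ↔ b = s.map pbit := by
  induction s generalizing b with
  | nil => simp_all
  | cons x s ih =>
    rcases b with _ | ⟨y, b⟩
    · simp at h
    · simp only [List.zip_cons_cons, List.mem_cons, forall_eq_or_imp, List.map_cons,
        List.cons.injEq]
      rw [ih (by simpa using h)]

theorem map_word₃_clear (pbit : A → Bool) {s t : List A} (ht : t.length = s.length) :
    (word₃ s t (s.map pbit)).map (fun d => (d.1, d.2.1, false)) =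
      word₃ s t (numStr boolDigit s.length 0) := by
  induction s generalizing t with
  | nil => simp [word₃]
  | cons x s ih =>
    rcases t with _ | ⟨y, t⟩
    · simp at ht
    · have := ih (t := t) (by simpa using ht)
      simp only [word₃, List.map_cons, List.zip_cons_cons, List.length_cons, numStr] at this ⊢
      rw [Nat.zero_div, this]
      rfl

section Program

variable {D : Fin 3 ⊕ InputSymbol → Type} (Au : ∀ i, DFA (A × A × Bool) (D i))

/-- Moving the input head to the position given by the third track. -/
noncomputable def seek : Cmd (PassState D) (A × A × Bool) Bool :=
  .seq (.loop (backPrim Au) .skip) (.loop (testPrim Au fun _ => .inl 2)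
    (.seq (run (incPrim boolDigit track₃ D)) (run (forwardPrim Au))))

/-- Writing the bit of the adjacency matrix for the states on the first two tracks. -/
noncomputable def edgeCmd : Cmd (PassState D) (A × A × Bool) Bool :=
  .seq (seek Au) (.seq (outTest Au .inr) (run (mapPrim D fun d => (d.1, d.2.1, false))))

/-- The transducer that writes the encoding of a structure. -/
noncomputable def encodeCmd : Cmd (PassState D) (A × A × Bool) Bool :=
  .seq (forAll (incPrim e track₁ D) (run (emitPrim Au true))) (.seq (run (emitPrim Au false))
    (.seq (forAll (incPrim e track₁ D) (outTest Au fun _ => .inl 0))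
    (.seq (forAll (incPrim e track₁ D) (outTest Au fun _ => .inl 1))
      (forAll (incPrim e track₁ D) (forAll (incPrim e track₂ D) (edgeCmd Au))))))

theorem det_encodeCmd : (encodeCmd e Au).Det := by
  simp only [encodeCmd, edgeCmd, seek, forAll, run, outTest, Cmd.Det, emitPrim, testPrim, backPrim,
    forwardPrim, mapPrim, incPrim, Prim.det_ofFun, and_self]

variable {Au} {pbit : A → Bool} {Init Lab : List A → Prop}
  {Edge : InputSymbol → List (A × A) → Prop}

-- The third track counts the moves of the head. An automaton compares it with the bits coded on the
-- first track, and the loop ends when they agree; the head is then on the coded position, or on the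
-- right end marker if that position is too large.
open Classical in
theorem exec_seek
    (hAu : ∀ i v, v ∈ (Au i).accepts ↔ tests pbit Init Lab Edge i v)
    {w : List Bool} {s t : List A} (ht : t.length = s.length) (p : ℕ)
    (o : List Bool) : (seek Au).Exec w ⟨p, word₃ s t (numStr boolDigit s.length 0), o⟩
      ⟨min (numVal boolDigit (s.map pbit)) (w.length + 1), word₃ s t (s.map pbit), o⟩ := by
  refine .seq (exec_back Au w p _ o) ?_
  set P := numVal boolDigit (s.map pbit) with hP
  have hPlt : P < 2 ^ s.length := by
    have := numVal_lt boolDigit (s.map pbit)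
    rwa [List.length_map] at this
  have key : ∀ j k, k + j = P → (Cmd.loop (testPrim Au fun _ => .inl 2)
      (.seq (run (incPrim boolDigit track₃ D)) (run (forwardPrim Au)))).Exec w
      ⟨min k (w.length + 1), word₃ s t (numStr boolDigit s.length k), o⟩
      ⟨min P (w.length + 1), word₃ s t (s.map pbit), o⟩ := by
    intro j
    induction j with
    | zero =>
      intro k hk
      obtain rfl : k = P := by omega
      have h1 : numStr boolDigit s.length P = s.map pbit := by
        have := numStr_numVal boolDigit (s.map pbit)
        rwa [List.length_map, ← hP] at this
      have h2 := rel_testPrim Au w (fun _ => .inl 2) (min P (w.length + 1))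
        (word₃ s t (numStr boolDigit s.length P)) o
      rw [decide_eq_false, min_eq_left (min_le_right _ _)] at h2
      · rw [h1] at h2 ⊢
        exact .loopFalse h2
      · rw [hAu]
        simp only [tests, Matrix.cons_val, not_not]
        rw [(map_word₃ ht (length_numStr _ _ _)).2.2, forall_mem_zip_iff (length_numStr _ _ _)]
        exact h1
    | succ j ih =>
      intro k hk
      have h2 := rel_testPrim Au w (fun _ => .inl 2) (min k (w.length + 1))
        (word₃ s t (numStr boolDigit s.length k)) o
      rw [decide_eq_true, min_eq_left (min_le_right _ _)] at h2
      · refine .loopTrue h2 (.seq (s₁ := ⟨min k (w.length + 1),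
          word₃ s t (numStr boolDigit s.length (k + 1)), o⟩)
          (exec_run (b := decide (k + 1 < 2 ^ s.length)) ?_) (exec_run (b := true) ?_))
          (ih (k + 1) (by omega))
        · have hl : (s.zip t).length = s.length := by simp [ht]
          have h3 := rel_incPrim (D := D) (w := w) boolDigit track₃ (c := s.zip t) (i := k)
            (by rw [hl]; omega) (min k (w.length + 1)) o
          rw [hl, Nat.mod_eq_of_lt (by omega), min_eq_left (min_le_right _ _)] at h3
          rw [word₃_eq₃, word₃_eq₃]
          exact h3
        · have h3 := rel_forwardPrim Au w (min k (w.length + 1))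
            (word₃ s t (numStr boolDigit s.length (k + 1))) o
          rwa [show min (min k (w.length + 1) + 1) (w.length + 1) = min (k + 1) (w.length + 1) by
            omega] at h3
      · rw [hAu]
        simp only [tests, Matrix.cons_val]
        rw [(map_word₃ ht (length_numStr _ _ _)).2.2, forall_mem_zip_iff (length_numStr _ _ _)]
        intro h
        have := congrArg (numVal boolDigit) h
        rw [numVal_numStr boolDigit (by omega)] at this
        omega
  have := key P 0 (zero_add P)
  rwa [Nat.zero_min] at this

open Classical in
theorem emits_edgeCmd
    (hAu : ∀ i v, v ∈ (Au i).accepts ↔ tests pbit Init Lab Edge i v)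
    {w : List Bool} {s t : List A} (ht : t.length = s.length) :
    Emits w (edgeCmd Au) (word₃ s t (numStr boolDigit s.length 0))
      [decide (Edge (inputSymbol w (numVal boolDigit (s.map pbit))) (s.zip t))] := by
  intro p o
  have h1 := exec_seek hAu (w := w) ht p o
  obtain ⟨p₂, h2⟩ := exec_outTest Au w .inr (min (numVal boolDigit (s.map pbit)) (w.length + 1))
    (word₃ s t (s.map pbit)) o
  -- Clipping is harmless: all positions beyond the input read as the right end marker. So states
  -- that code no proper configuration are treated consistently as well.
  have hsym : ∀ q, inputSymbol w (min q (w.length + 1)) = inputSymbol w q := by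
    intro q
    rcases Nat.lt_or_ge w.length q with h | h
    · rw [min_eq_right (by omega), SweepMachine.inputSymbol_rightEnd.2 h,
        SweepMachine.inputSymbol_rightEnd.2 (Nat.lt_succ_self _)]
    · rw [min_eq_left (by omega)]
  have h3 : (word₃ s t (s.map pbit) ∈
      (Au (.inr (inputSymbol w (numVal boolDigit (s.map pbit))))).accepts) ↔
      Edge (inputSymbol w (numVal boolDigit (s.map pbit))) (s.zip t) := by
    rw [hAu]
    simp only [tests]
    rw [(map_word₃ ht (List.length_map _)).2.1]
  rw [hsym, decide_eq_decide.2 h3] at h2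
  have h4 := rel_mapPrim (D := D) w (fun d : A × A × Bool => (d.1, d.2.1, false)) p₂
    (word₃ s t (s.map pbit)) (o ++ [decide (Edge (inputSymbol w (numVal boolDigit (s.map pbit)))
      (s.zip t))])
  rw [map_word₃_clear pbit ht] at h4
  exact ⟨_, .seq h1 (.seq h2 (exec_run h4))⟩

theorem emits_forAll₁ {w : List Bool} {c : Cmd (PassState D) (A × A × Bool) Bool} {L : ℕ}
    {t : List A} {b : List Bool} (ht : t.length = L) (hb : b.length = L) (f : ℕ → List Bool)
    (hc : ∀ i < m ^ L, Emits w c (word₃ (numStr e L i) t b) (f i)) :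
    Emits w (forAll (incPrim e track₁ D) c) (word₃ (numStr e L 0) t b)
      ((List.range (m ^ L)).flatMap f) := by
  refine emits_forAll (pow_pos (NeZero.pos m) L) (fun i => word₃ (numStr e L i) t b) f
    (fun i hi p o => ?_) hc
  have hl : (t.zip b).length = L := by simp [ht, hb]
  have := rel_incPrim (D := D) (w := w) e track₁ (c := t.zip b) (i := i) (by rwa [hl]) p o
  rw [hl] at this
  rw [word₃_eq₁, word₃_eq₁]
  exact ⟨_, this⟩

theorem emits_forAll₂ {w : List Bool} {c : Cmd (PassState D) (A × A × Bool) Bool} {L : ℕ}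
    {s : List A} {b : List Bool} (hs : s.length = L) (hb : b.length = L) (f : ℕ → List Bool)
    (hc : ∀ i < m ^ L, Emits w c (word₃ s (numStr e L i) b) (f i)) :
    Emits w (forAll (incPrim e track₂ D) c) (word₃ s (numStr e L 0) b)
      ((List.range (m ^ L)).flatMap f) := by
  refine emits_forAll (pow_pos (NeZero.pos m) L) (fun i => word₃ s (numStr e L i) b) f
    (fun i hi p o => ?_) hc
  have hl : (s.zip b).length = L := by simp [hs, hb]
  have := rel_incPrim (D := D) (w := w) e track₂ (c := s.zip b) (i := i) (by rwa [hl]) p o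
  rw [hl] at this
  rw [word₃_eq₂, word₃_eq₂]
  exact ⟨_, this⟩

end Program

theorem ofFn_eq_map_range {α : Type*} {N : ℕ} (f : Fin N → α) (g : ℕ → α)
    (h : ∀ i : Fin N, f i = g i) : List.ofFn f = (List.range N).map g := by
  refine List.ext_getElem (by simp) fun i h1 h2 => ?_
  simp [h]

open Classical in
theorem encode_eq_flatMap {N : ℕ} (K : Kripke (Fin 1) (Fin N)) (Init Lab : ℕ → Prop)
    (Edge : ℕ → ℕ → Prop) (hI : ∀ s : Fin N, s = K.init ↔ Init s)
    (hL : ∀ s : Fin N, 0 ∈ K.label s ↔ Lab s) (hE : ∀ s t : Fin N, K.δ s t ↔ Edge s t) :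
    K.encode = (List.range N).flatMap (fun _ => [true]) ++ ([false] ++
      ((List.range N).flatMap (fun i => [decide (Init i)]) ++
      ((List.range N).flatMap (fun i => [decide (Lab i)]) ++
      (List.range N).flatMap fun i => (List.range N).flatMap fun j => [decide (Edge i j)]))) := by
  unfold Kripke.encode
  simp only [List.append_assoc]
  congr 1
  · rw [← List.map_eq_flatMap, List.map_const', List.length_range]
  congr 2
  · rw [← List.map_eq_flatMap]
    exact ofFn_eq_map_range _ _ fun i => decide_eq_decide.2 (hI i)
  congr 1
  · rw [List.flatMap_def]
    congr 1
    refine ofFn_eq_map_range _ _ fun i => ?_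
    simp only [List.ofFn_succ, List.ofFn_zero, List.cons.injEq, and_true]
    exact decide_eq_decide.2 (hL i)
  · rw [List.flatMap_def]
    congr 1
    refine ofFn_eq_map_range _ _ fun i => ?_
    rw [← List.map_eq_flatMap]
    exact ofFn_eq_map_range _ _ fun j => decide_eq_decide.2 (hE i j)

/-- Structures whose states are words of logarithmic length and that are defined by finite automata
can be computed in logarithmic space; an automaton may see an input symbol at a position that is
given on a track of the first of the two states. -/
theorem logSpaceComputable_encode [Finite A] {pbit : A → Bool} {Init Lab : List A → Prop}
    {Edge : InputSymbol → List (A × A) → Prop} (hI : RegPred Init) (hL : RegPred Lab)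
    (hE : ∀ x, RegPred (Edge x))
    (K : ∀ w : List Bool, Kripke (Fin 1) (Fin (m ^ wordLength w)))
    (hKI : ∀ w s, s = (K w).init ↔ Init (numStr e (wordLength w) s))
    (hKL : ∀ w s, 0 ∈ (K w).label s ↔ Lab (numStr e (wordLength w) s))
    (hKE : ∀ w s t, (K w).δ s t ↔ Edge (inputSymbol w (numVal boolDigit
      ((numStr e (wordLength w) s).map pbit)))
      ((numStr e (wordLength w) s).zip (numStr e (wordLength w) t))) :
    LogSpaceComputable fun w => (K w).encode := by
  classical
  choose D hD Au hAu using regPred_tests (pbit := pbit) hI hL hE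
  have hAu' : ∀ i v, v ∈ (Au i).accepts ↔ tests pbit Init Lab Edge i v := by
    intro i v
    rw [hAu i]
    rfl
  have : ∀ i, Finite (D i) := fun i => Fintype.finite (hD i)
  refine logSpaceComputable_of_cmd (encodeCmd e Au) (e.symm 0, e.symm 0, false)
    (det_encodeCmd e Au) _ fun w => ?_
  set L := wordLength w
  -- The padding letter is zero on all three tracks, so the initial word already has every counter
  -- at 0.
  have hpad : Cmd.initStore Bool (e.symm 0, e.symm 0, false) w =
      ⟨w.length + 1, word₃ (numStr e L 0) (numStr e L 0) (numStr boolDigit L 0), []⟩ := by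
    unfold Cmd.initStore
    congr 1
    change List.replicate L _ = _
    induction L with
    | zero => rfl
    | succ L ih =>
      rw [List.replicate_succ, ih]
      simp [word₃, numStr]
      rfl
  have h1 := emits_forAll₁ (w := w) (D := D) e (length_numStr e L 0) (length_numStr boolDigit L 0) _
    fun i _ => emits_emitPrim Au w true (word₃ (numStr e L i) (numStr e L 0) (numStr boolDigit L 0))
  have h2 := emits_emitPrim Au w false (word₃ (numStr e L 0) (numStr e L 0) (numStr boolDigit L 0))
  have htest : ∀ (k : Fin 3) (R : List A → Prop),
      (∀ v, tests pbit Init Lab Edge (.inl k) v ↔ R (v.map fun d => d.1)) →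
      Emits w (forAll (incPrim e track₁ D) (outTest Au fun _ => .inl k))
        (word₃ (numStr e L 0) (numStr e L 0) (numStr boolDigit L 0))
        ((List.range (m ^ L)).flatMap fun i => [decide (R (numStr e L i))]) := by
    intro k R hR
    refine emits_forAll₁ e (length_numStr e L 0) (length_numStr boolDigit L 0) _ fun i _ p o => ?_
    obtain ⟨p', h⟩ := exec_outTest Au w (fun _ => .inl k) p
      (word₃ (numStr e L i) (numStr e L 0) (numStr boolDigit L 0)) o
    refine ⟨p', ?_⟩
    have h3 : (word₃ (numStr e L i) (numStr e L 0) (numStr boolDigit L 0) ∈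
        (Au (.inl k)).accepts) ↔ R (numStr e L i) := by
      rw [hAu', hR, (map_word₃ (by simp only [length_numStr]) (by simp only [length_numStr])).1]
    rwa [decide_eq_decide.2 h3] at h
  have h3 := htest 0 Init fun v => Iff.rfl
  have h4 := htest 1 Lab fun v => Iff.rfl
  have h5 := emits_forAll₁ (w := w) (D := D) (c := forAll (incPrim e track₂ D) (edgeCmd Au)) e
    (length_numStr e L 0) (length_numStr boolDigit L 0) _ fun i _ =>
    emits_forAll₂ (w := w) (D := D) e (length_numStr e L i) (length_numStr boolDigit L 0) _
      fun j _ => by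
        have := emits_edgeCmd hAu' (w := w) (s := numStr e L i) (t := numStr e L j)
          (by simp only [length_numStr])
        rwa [length_numStr] at this
  obtain ⟨p', h⟩ := (h1.seq (h2.seq (h3.seq (h4.seq h5)))) (w.length + 1) []
  rw [hpad]
  refine ⟨_, h, ?_⟩
  rw [encode_eq_flatMap (K w) (fun i => Init (numStr e L i)) (fun i => Lab (numStr e L i))
    (fun i j => Edge (inputSymbol w (numVal boolDigit ((numStr e L i).map pbit)))
      ((numStr e L i).zip (numStr e L j))) (hKI w) (hKL w) (hKE w)]
  exact List.nil_append _

end Transducer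

/-! ### Configurations as words -/

instance : Finite HeadMove := by
  refine Finite.of_surjective (fun i : Fin 3 => ![HeadMove.left, HeadMove.stay, HeadMove.right] i)
    fun x => ?_
  cases x with
  | left => exact ⟨0, rfl⟩
  | stay => exact ⟨1, rfl⟩
  | right => exact ⟨2, rfl⟩

instance {k : ℕ} {Q Γ O : Type} [Finite Q] [Finite Γ] [Finite O] :
    Finite (OfflineTM.Action k Q Γ O) := by
  refine Finite.of_injective (fun α => (α.state, α.inMove, α.write, α.workMove, α.output)) ?_
  rintro ⟨⟩ ⟨⟩ h
  simpa using h

/-! #### Relations between tracks -/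

/-- Shifting a block of bits by one position. -/
def ShiftStep {C : ℕ} (c : Bool) (z : (Fin C → Bool) × (Fin C → Bool)) (c' : Bool) : Prop :=
  c :: List.ofFn z.1 = List.ofFn z.2 ++ [c']

/-- The state remembers the bit that crosses the border between two blocks, so that blockwise
shifting glues to a shift of the flat bit list. -/
theorem runs_shiftStep {C : ℕ} {c c' : Bool} {l : List ((Fin C → Bool) × (Fin C → Bool))} :
    Runs ShiftStep c l c' ↔ c :: (l.flatMap fun z => List.ofFn z.1) =
      (l.flatMap fun z => List.ofFn z.2) ++ [c'] := by
  induction l generalizing c with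
  | nil => simp [Runs]
  | cons z l ih =>
    simp only [Runs, ih, ShiftStep, List.flatMap_cons]
    constructor
    · rintro ⟨c₁, h1, h2⟩
      rw [← List.cons_append, h1, List.append_assoc, List.singleton_append, h2, List.append_assoc]
    · intro h
      have hl : (c :: List.ofFn z.1).length = (List.ofFn z.2).length + 1 := by simp
      rw [← List.cons_append] at h
      obtain ⟨d, c₁, hd⟩ := List.eq_nil_or_concat' (c :: List.ofFn z.1) |>.resolve_left (by simp)
      rw [hd, List.append_assoc, List.append_assoc] at h
      obtain ⟨h1, h2⟩ := List.append_inj h (by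
        rw [hd, List.length_append, List.length_singleton] at hl; omega)
      exact ⟨c₁, by rw [hd, h1], h2⟩

/-- The flat list of the entries of a table of blocks. -/
def flat {α : Type} {L C : ℕ} (F : Fin L → Fin C → α) : List α :=
  (List.ofFn fun i => List.ofFn fun j => F i j).flatten

theorem flat_injective {α : Type} {L C : ℕ} : Function.Injective (flat (α := α) (L := L) (C := C)) := by
  intro F G h
  funext i j
  have h1 := List.getElem?_flatten_ofFn F i j
  have h2 := List.getElem?_flatten_ofFn G i j
  rw [show (List.ofFn fun s => List.ofFn fun t => F s t).flatten = flat F from rfl, h] at h1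
  rw [show (List.ofFn fun s => List.ofFn fun t => G s t).flatten = flat G from rfl, h1] at h2
  exact Option.some_inj.1 h2

/-- The block table that marks position `h`. -/
def markTable (L C h : ℕ) (i : Fin L) (j : Fin C) : Bool := decide (h = i * C + j)

theorem flat_markTable (L C h : ℕ) :
    flat (markTable L C h) = List.ofFn fun t : Fin (L * C) => decide (h = t) := by
  rw [List.ofFn_mul]
  rfl

/-- Moving a head to the right shifts its mark. The bound on `h` ensures that the mark does not fall
off the end, so the bit shifted out is `false`. -/
theorem cons_flat_markTable {L C h : ℕ} (hh : h + 1 < L * C) :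
    false :: flat (markTable L C h) = flat (markTable L C (h + 1)) ++ [false] := by
  rw [flat_markTable, flat_markTable]
  have h1 := List.ofFn_succ (f := fun t : Fin (L * C + 1) => decide (h + 1 = t))
  have h2 := List.ofFn_succ_last (f := fun t : Fin (L * C + 1) => decide (h + 1 = t))
  rw [h1] at h2
  simpa [Fin.val_succ, hh.ne] using h2

/-- The relation between the marks of a head before and after a movement. -/
def HeadRel {C : ℕ} (m : HeadMove) (l : List ((Fin C → Bool) × (Fin C → Bool))) : Prop :=
  match m with
  | .stay => ∀ z ∈ l, z.1 = z.2
  | .right => Runs ShiftStep false l false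
  | .left => Runs ShiftStep false (l.map Prod.swap) false ∨
      (∀ z ∈ l, z.1 = z.2) ∧
        Runs (fun c z c' => c' = false ∧ (c = true → ∃ h : 0 < C, z.1 ⟨0, h⟩ = true)) true l false

theorem regPred_headRel {C : ℕ} (m : HeadMove) : RegPred (HeadRel (C := C) m) := by
  cases m with
  | stay => exact RegPred.all _
  | right => exact RegPred.runs _ _ _
  | left => exact ((RegPred.runs _ _ _).comap _).or ((RegPred.all _).and (RegPred.runs _ _ _))

theorem flatMap_ofFn {β : Type} {L C : ℕ} (z : Fin L → β) (f : β → Fin C → Bool) :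
    (List.ofFn z).flatMap (fun z => List.ofFn (f z)) = flat fun i => f (z i) := by
  rw [List.flatMap_def, List.map_ofFn]
  rfl

/-- A right move is a shift, a left move is the inverse shift, except on cell 0, where a left move
stays. The inverse shift is impossible there because it would drop the mark, so the two alternatives
for left do not interfere. -/
theorem headRel_iff {L C h : ℕ} (hL : 0 < L) {m : HeadMove} (hh : h < L * C)
    (hh' : m.apply h < L * C) {Y : Fin L → Fin C → Bool} :
    HeadRel m (List.ofFn fun i => (markTable L C h i, Y i)) ↔ Y = markTable L C (m.apply h) := by
  have hC : 0 < C := Nat.pos_of_ne_zero fun h => by simp [h] at hh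
  have heq : (∀ z ∈ List.ofFn fun i => (markTable L C h i, Y i), z.1 = z.2) ↔
      Y = markTable L C h := by
    rw [List.forall_mem_ofFn_iff, funext_iff]
    exact forall_congr' fun i => eq_comm
  cases m with
  | stay => exact heq
  | right =>
    simp only [HeadRel, runs_shiftStep]
    rw [flatMap_ofFn _ fun z : (Fin C → Bool) × (Fin C → Bool) => z.1,
      flatMap_ofFn _ fun z : (Fin C → Bool) × (Fin C → Bool) => z.2]
    dsimp only [HeadMove.apply] at hh' ⊢
    rw [cons_flat_markTable hh', List.append_cancel_right_eq, flat_injective.eq_iff, eq_comm]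
  | left =>
    simp only [HeadRel, runs_shiftStep, heq]
    rw [List.map_ofFn, flatMap_ofFn _ fun z : (Fin C → Bool) × (Fin C → Bool) => z.1,
      flatMap_ofFn _ fun z : (Fin C → Bool) × (Fin C → Bool) => z.2]
    simp only [Function.comp_apply, Prod.swap, HeadMove.apply] at hh' ⊢
    -- The flag is true at the first letter only, so this automaton checks that the mark is in the
    -- first cell of the first block.
    have hfirst : Runs (fun c (z : (Fin C → Bool) × (Fin C → Bool)) c' => c' = false ∧
        (c = true → ∃ h : 0 < C, z.1 ⟨0, h⟩ = true)) true
        (List.ofFn fun i => (markTable L C h i, Y i)) false ↔ h = 0 := by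
      obtain ⟨L, rfl⟩ : ∃ L', L = L' + 1 := ⟨L - 1, by omega⟩
      rw [List.ofFn_succ, Runs]
      have hrest : ∀ l : List ((Fin C → Bool) × (Fin C → Bool)),
          Runs (fun c (z : (Fin C → Bool) × (Fin C → Bool)) c' => c' = false ∧
            (c = true → ∃ h : 0 < C, z.1 ⟨0, h⟩ = true)) false l false := by
        intro l
        induction l with
        | nil => rfl
        | cons z l ih => exact ⟨false, ⟨rfl, by simp⟩, ih⟩
      constructor
      · rintro ⟨_, ⟨rfl, h1⟩, -⟩
        obtain ⟨_, h2⟩ := h1 rfl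
        simpa [markTable] using h2
      · rintro rfl
        exact ⟨false, ⟨rfl, fun _ => ⟨hC, by simp [markTable]⟩⟩, hrest _⟩
    rw [hfirst]
    rcases h with _ | h
    · constructor
      · rintro (h1 | h1)
        · exfalso
          have h2 : flat (markTable L C 0) = true :: List.ofFn fun t : Fin (L * C - 1) => false := by
            rw [flat_markTable]
            obtain ⟨N, hN⟩ : ∃ N, L * C = N + 1 := ⟨L * C - 1, by omega⟩
            rw [hN]
            simp [List.ofFn_succ]
          change false :: flat Y = flat (markTable L C 0) ++ [false] at h1
          rw [h2] at h1
          simp at h1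
        · exact h1.1
      · exact fun h1 => .inr ⟨h1, rfl⟩
    · rw [Nat.add_sub_cancel]
      constructor
      · rintro (h1 | h1)
        · change false :: flat Y = flat (markTable L C (h + 1)) ++ [false] at h1
          rw [← cons_flat_markTable hh] at h1
          exact flat_injective (List.cons.inj h1).2
        · exact absurd h1.2 (Nat.succ_ne_zero h)
      · rintro rfl
        exact .inl (cons_flat_markTable hh)

open Classical in
/-- The relation between the positions of the input head before and after a movement. -/
def InRel (x : InputSymbol) (m : HeadMove) (l : List (Bool × Bool)) : Prop :=
  match m with
  | .stay => ∀ z ∈ l, z.1 = z.2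
  | .right => if x = .rightEnd then ∀ z ∈ l, z.1 = z.2 else Runs (CarryStep boolDigit) true l false
  | .left => if x = .leftEnd then ∀ z ∈ l, z.1 = z.2
      else Runs (CarryStep boolDigit) true (l.map Prod.swap) false

theorem regPred_inRel (x : InputSymbol) (m : HeadMove) : RegPred (InRel x m) := by
  have heq : RegPred fun l : List (Bool × Bool) => ∀ z ∈ l, z.1 = z.2 := RegPred.all _
  have hinc := RegPred.runs (CarryStep boolDigit) true false
  cases m with
  | stay => exact heq
  | right =>
    change RegPred fun l => InRel x .right l
    by_cases h : x = .rightEnd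
    · simpa only [InRel, h, if_true] using heq
    · simpa only [InRel, h, if_false] using hinc
  | left =>
    change RegPred fun l => InRel x .left l
    by_cases h : x = .leftEnd
    · simpa only [InRel, h, if_true] using heq
    · simpa only [InRel, h, if_false] using hinc.comap Prod.swap

/-- The scanned symbol reveals whether the move is cut off at an end marker; otherwise the move is
an increment or decrement of the binary position, which cannot overflow because `L` digits suffice.
-/
theorem inRel_iff {w : List Bool} {p L : ℕ} (hL : w.length + 1 < 2 ^ L) (hp : p ≤ w.length + 1)
    {m : HeadMove} {b : List Bool} (hb : b.length = L) :
    InRel (inputSymbol w p) m ((numStr boolDigit L p).zip b) ↔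
      b = numStr boolDigit L (min (m.apply p) (w.length + 1)) := by
  have heq : (∀ z ∈ (numStr boolDigit L p).zip b, z.1 = z.2) ↔ b = numStr boolDigit L p := by
    have := Transducer.forall_mem_zip_iff (pbit := id) (b := numStr boolDigit L p) (s := b)
      (by rw [length_numStr, hb])
    rw [List.map_id] at this
    exact this.trans eq_comm
  have hval : ∀ q < 2 ^ L, (numVal boolDigit b = q ↔ b = numStr boolDigit L q) := by
    intro q hq
    constructor
    · rintro rfl
      rw [← hb, numStr_numVal]
    · rintro rfl
      exact numVal_numStr boolDigit hq
  have hfst : ((numStr boolDigit L p).zip b).map Prod.fst = numStr boolDigit L p :=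
    List.map_fst_zip (by rw [length_numStr, hb])
  have hsnd : ((numStr boolDigit L p).zip b).map Prod.snd = b :=
    List.map_snd_zip (by rw [length_numStr, hb])
  cases m with
  | stay =>
    simp only [InRel, HeadMove.apply, min_eq_left hp]
    exact heq
  | right =>
    simp only [InRel, HeadMove.apply]
    split
    · rename_i h
      rw [SweepMachine.inputSymbol_rightEnd] at h
      rw [show min (p + 1) (w.length + 1) = p by omega]
      exact heq
    · rename_i h
      rw [SweepMachine.inputSymbol_rightEnd] at h
      rw [min_eq_left (by omega), runs_carryStep, hfst, hsnd, numVal_numStr _ (by omega),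
        ← hval _ (by omega)]
      simp
  | left =>
    simp only [InRel, HeadMove.apply]
    split
    · rename_i h
      rw [NProg.inputSymbol_eq_leftEnd] at h
      subst h
      exact heq
    · rename_i h
      rw [NProg.inputSymbol_eq_leftEnd] at h
      rw [min_eq_left (by omega), runs_carryStep, List.map_map, List.map_map,
        show Prod.snd ∘ Prod.swap = (Prod.fst : Bool × Bool → Bool) from rfl,
        show Prod.fst ∘ Prod.swap = (Prod.snd : Bool × Bool → Bool) from rfl, hfst, hsnd,
        numVal_numStr _ (by omega), ← hval _ (by omega)]
      simp
      omega

/-! ### Codes of configurations -/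

namespace OfflineTM

variable (M : OfflineTM Empty) (C : ℕ)

/-- A block of `C` cells of every work tape, together with the state. -/
abbrev Block : Type := M.Q × (Fin M.k → Fin C → M.Γ × Bool)

/-- The letters of words that code configurations; the bit belongs to the position of the input
head. -/
abbrev CodeLetter : Type := Bool × M.Block C

variable {M}

open Classical in
/-- A block of a configuration. -/
def block (c : M.Config) (i : ℕ) : M.Block C :=
  (c.state, fun κ j => (c.tape κ (i * C + j), decide (c.head κ = i * C + j)))

/-- The word of length `L` that codes a configuration. -/
def code (L : ℕ) (c : M.Config) : List (M.CodeLetter C) :=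
  (numStr boolDigit L c.inHead).zip (List.ofFn fun i : Fin L => block C c i)

theorem length_code (L : ℕ) (c : M.Config) : (code C L c).length = L := by
  simp [code, length_numStr]

variable {C}

/-- A letter agrees with the state and with the symbols under the heads. -/
def Source (q : M.Q) (g : Fin M.k → M.Γ) (z : M.CodeLetter C) : Prop :=
  z.2.1 = q ∧ ∀ κ j, (z.2.2 κ j).2 = true → (z.2.2 κ j).1 = g κ

open Classical in
/-- The new state and the new symbols agree with an action. -/
def Target (α : Action M.k M.Q M.Γ Empty) (z : M.CodeLetter C × M.CodeLetter C) : Prop :=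
  z.2.2.1 = α.state ∧
    ∀ κ j, (z.2.2.2 κ j).1 = if (z.1.2.2 κ j).2 = true then α.write κ else (z.1.2.2 κ j).1

/-- The step relation on codes. -/
def StepRel (x : InputSymbol) (v : List (M.CodeLetter C × M.CodeLetter C)) : Prop :=
  ∃ (q : M.Q) (g : Fin M.k → M.Γ) (α : Action M.k M.Q M.Γ Empty), α ∈ M.trans q x g ∧
    (∀ z ∈ v, Source q g z.1) ∧ (∀ z ∈ v, Target α z) ∧
    InRel x α.inMove (v.map fun z => (z.1.1, z.2.1)) ∧
    ∀ κ, HeadRel (α.workMove κ)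
      (v.map fun z => (fun j => (z.1.2.2 κ j).2, fun j => (z.2.2.2 κ j).2))

theorem regPred_stepRel (x : InputSymbol) : RegPred (StepRel (M := M) (C := C) x) := by
  have := M.finiteQ
  have := M.finiteΓ
  refine RegPred.exists_finite fun q => RegPred.exists_finite fun g => RegPred.exists_finite fun α =>
    (RegPred.const _).and ((RegPred.all fun z : M.CodeLetter C × M.CodeLetter C =>
      Source q g z.1).and ((RegPred.all _).and
      (((regPred_inRel x α.inMove).comap fun z : M.CodeLetter C × M.CodeLetter C =>
        (z.1.1, z.2.1)).and (RegPred.forall_finite fun κ => (regPred_headRel (α.workMove κ)).comap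
      fun z : M.CodeLetter C × M.CodeLetter C =>
        (fun j => (z.1.2.2 κ j).2, fun j => (z.2.2.2 κ j).2)))))

theorem map_zip_zip {α β α' β' : Type} {a : List α} {b : List β} {a' : List α'} {b' : List β'}
    (h1 : b.length = a.length) (h2 : a'.length = a.length) (h3 : b'.length = a.length) :
    (((a.zip b).zip (a'.zip b')).map fun z => (z.1.1, z.2.1)) = a.zip a' ∧
      (((a.zip b).zip (a'.zip b')).map fun z => (z.1.2, z.2.2)) = b.zip b' := by
  induction a generalizing b a' b' with
  | nil => simp_all
  | cons x a ih =>
    rcases b with _ | ⟨y, b⟩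
    · simp at h1
    rcases a' with _ | ⟨x', a'⟩
    · simp at h2
    rcases b' with _ | ⟨y', b'⟩
    · simp at h3
    obtain ⟨h4, h5⟩ := ih (b := b) (a' := a') (b' := b') (by simpa using h1) (by simpa using h2)
      (by simpa using h3)
    exact ⟨by simp [h4], by simp [h5]⟩

section StepCode

variable {w : List Bool} {L : ℕ} {c : M.Config}

/-- Each head lies within the coded cells, so its mark occurs in the table and determines the
scanned symbol; the state is repeated in every block, of which there is at least one. -/
theorem source_block_iff {q : M.Q} {g : Fin M.k → M.Γ} (hL : 0 < L)
    (hc : ∀ κ, c.head κ < L * C) :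
    (∀ i : Fin L, (block C c i).1 = q ∧ ∀ κ j, ((block C c i).2 κ j).2 = true →
      ((block C c i).2 κ j).1 = g κ) ↔ q = c.state ∧ g = fun κ => c.tape κ (c.head κ) := by
  constructor
  · intro h
    refine ⟨((h ⟨0, hL⟩).1).symm, funext fun κ => ?_⟩
    have hκ := hc κ
    have hC : 0 < C := Nat.pos_of_ne_zero fun h => by simp [h] at hκ
    have h1 := (h ⟨c.head κ / C, Nat.div_lt_of_lt_mul (by rwa [mul_comm])⟩).2 κ
      ⟨c.head κ % C, Nat.mod_lt _ hC⟩
    simp only [block, Nat.div_add_mod', decide_true, forall_const] at h1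
    exact h1.symm
  · rintro ⟨rfl, rfl⟩ i
    refine ⟨rfl, fun κ j h => ?_⟩
    simp only [block, decide_eq_true_eq] at h ⊢
    rw [h]

/-- Locality of computation: a step changes only the scanned cells, the marks next to them, the
state and the input position, all of which letterwise conditions with finite memory control. Cells
beyond `L * C` are not coded, but no head gets there. -/
theorem stepRel_code {x' : List (M.CodeLetter C)} (hx : x'.length = L)
    (hw : w.length + 1 < 2 ^ L) (hp : c.inHead ≤ w.length + 1) (hc : ∀ κ, c.head κ < L * C)
    (hc' : ∀ c', M.Step w c c' → ∀ κ, c'.head κ < L * C) :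
    StepRel (inputSymbol w c.inHead) ((code C L c).zip x') ↔
      ∃ c', M.Step w c c' ∧ x' = code C L c' := by
  have hL : 0 < L := Nat.pos_of_ne_zero fun h => by simp [h] at hw
  obtain ⟨b, Y, hb, rfl⟩ : ∃ (b : List Bool) (Y : Fin L → M.Block C), b.length = L ∧
      x' = b.zip (List.ofFn Y) := by
    subst hx
    refine ⟨x'.map Prod.fst, fun i => (x'.get i).2, List.length_map _, ?_⟩
    have h1 : (List.ofFn fun i => (x'.get i).2) = x'.map Prod.snd := by
      have := List.map_ofFn (f := x'.get) (g := Prod.snd)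
      rw [List.ofFn_get] at this
      exact this.symm
    rw [h1]
    exact List.zip_of_prod rfl rfl
  have hmap := map_zip_zip (a := numStr boolDigit L c.inHead)
    (b := List.ofFn fun i : Fin L => block C c i) (a' := b) (b' := List.ofFn Y)
    (by simp [length_numStr]) (by simp [length_numStr, hb]) (by simp [length_numStr])
  have hz : (List.ofFn fun i : Fin L => block C c i).zip (List.ofFn Y) =
      List.ofFn fun i => (block C c i, Y i) := by
    refine List.ext_getElem (by simp) fun i h1 h2 => by simp
  rw [hz] at hmap
  have hall : ∀ P : M.Block C × M.Block C → Prop,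
      (∀ z ∈ (code C L c).zip (b.zip (List.ofFn Y)), P (z.1.2, z.2.2)) ↔
      ∀ i : Fin L, P (block C c i, Y i) := by
    intro P
    rw [← List.forall_mem_ofFn_iff (P := P), ← hmap.2, List.forall_mem_map]
    rfl
  have hhead : ∀ κ, ((code C L c).zip (b.zip (List.ofFn Y))).map
      (fun z => ((fun j => (z.1.2.2 κ j).2, fun j => (z.2.2.2 κ j).2) :
        (Fin C → Bool) × (Fin C → Bool))) =
      List.ofFn fun i => (markTable L C (c.head κ) i, fun j => ((Y i).2 κ j).2) := by
    intro κ
    have := congrArg (List.map fun z : M.Block C × M.Block C =>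
      ((fun j => (z.1.2 κ j).2, fun j => (z.2.2 κ j).2) :
        (Fin C → Bool) × (Fin C → Bool))) hmap.2
    rw [List.map_map, List.map_ofFn] at this
    exact this
  have hcode : ∀ c', b.zip (List.ofFn Y) = code C L c' ↔
      b = numStr boolDigit L c'.inHead ∧ ∀ i : Fin L, Y i = block C c' i := by
    intro c'
    constructor
    · intro h
      have h1 := congrArg (List.map Prod.fst) h
      have h2 := congrArg (List.map Prod.snd) h
      simp only [code] at h1 h2
      rw [List.map_fst_zip (by simp [hb]), List.map_fst_zip (by simp [length_numStr])] at h1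
      rw [List.map_snd_zip (by simp [hb]), List.map_snd_zip (by simp [length_numStr])] at h2
      exact ⟨h1, fun i => congrFun (List.ofFn_injective h2) i⟩
    · rintro ⟨rfl, h⟩
      rw [show Y = fun i : Fin L => block C c' i from funext h]
      rfl
  -- For a fixed action the conditions determine every component of the new word, so it must be the
  -- code of the resulting configuration.
  have key : ∀ α : Action M.k M.Q M.Γ Empty, (∀ κ, (α.workMove κ).apply (c.head κ) < L * C) →
      (((∀ z ∈ (code C L c).zip (b.zip (List.ofFn Y)), Target α z) ∧
        InRel (inputSymbol w c.inHead) α.inMove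
          (((code C L c).zip (b.zip (List.ofFn Y))).map fun z => (z.1.1, z.2.1)) ∧
        ∀ κ, HeadRel (α.workMove κ) (((code C L c).zip (b.zip (List.ofFn Y))).map
          fun z => (fun j => (z.1.2.2 κ j).2, fun j => (z.2.2.2 κ j).2))) ↔
      b.zip (List.ofFn Y) = code C L (M.perform w c α)) := by
    intro α hα
    rw [hcode, show (((code C L c).zip (b.zip (List.ofFn Y))).map fun z => (z.1.1, z.2.1)) = _ from
      hmap.1, inRel_iff hw hp hb]
    have h1 := hall fun z => z.2.1 = α.state ∧
      ∀ κ j, (z.2.2 κ j).1 = if (z.1.2 κ j).2 = true then α.write κ else (z.1.2 κ j).1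
    unfold Target
    rw [h1]
    simp only [hhead, headRel_iff hL (hc _) (hα _)]
    constructor
    · rintro ⟨h2, h3, h4⟩
      refine ⟨h3, fun i => Prod.ext (h2 i).1 (funext fun κ => funext fun j => Prod.ext ?_ ?_)⟩
      · rw [(h2 i).2 κ j]
        simp only [block, perform, decide_eq_true_eq, Function.update_apply]
        simp only [eq_comm]
      · exact congrFun (congrFun (h4 κ) i) j
    · rintro ⟨h2, h3⟩
      refine ⟨fun i => ?_, h2, fun κ => funext fun i => funext fun j => ?_⟩
      · rw [h3 i]
        refine ⟨rfl, fun κ j => ?_⟩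
        simp only [block, perform, decide_eq_true_eq, Function.update_apply]
        simp only [eq_comm]
      · rw [h3 i]
        rfl
  have hsrc : ∀ q g, (∀ z ∈ (code C L c).zip (b.zip (List.ofFn Y)), Source q g z.1) ↔
      q = c.state ∧ g = fun κ => c.tape κ (c.head κ) := by
    intro q g
    rw [← source_block_iff hL hc]
    exact hall fun z => z.1.1 = q ∧ ∀ κ j, (z.1.2 κ j).2 = true → (z.1.2 κ j).1 = g κ
  constructor
  · rintro ⟨q, g, α, hα, h1, h2⟩
    obtain ⟨rfl, rfl⟩ := (hsrc q g).1 h1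
    have hs : M.Step w c (M.perform w c α) := ⟨α, hα, rfl⟩
    exact ⟨_, hs, (key α (hc' _ hs)).1 h2⟩
  · rintro ⟨_, ⟨α, hα, rfl⟩, h2⟩
    have hs : M.Step w c (M.perform w c α) := ⟨α, hα, rfl⟩
    exact ⟨_, _, α, hα, (hsrc _ _).2 ⟨rfl, rfl⟩, (key α (hc' _ hs)).2 h2⟩

end StepCode

end OfflineTM

/-! ### Layered frames -/

/-- In a finite graph, reachable nodes are reachable by short walks. -/
theorem exists_short_walk {Y : Type} [Finite Y] {G : Y → Y → Prop} {T : ℕ} (hT : Nat.card Y ≤ T)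
    {x y : Y} (h : Relation.ReflTransGen G x y) :
    ∃ k < T, ∃ p : ℕ → Y, p 0 = x ∧ p k = y ∧ ∀ i < k, G (p i) (p (i + 1)) := by
  classical
  have hex : ∃ k, ∃ p : ℕ → Y, p 0 = x ∧ p k = y ∧ ∀ i < k, G (p i) (p (i + 1)) := by
    induction h with
    | refl => exact ⟨0, fun _ => x, rfl, rfl, fun i hi => by omega⟩
    | @tail y z _ h1 ih =>
      obtain ⟨k, p, h2, h3, h4⟩ := ih
      refine ⟨k + 1, Function.update p (k + 1) z, ?_, by simp, fun i hi => ?_⟩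
      · rw [Function.update_of_ne (by omega), h2]
      · rw [Function.update_of_ne (by omega)]
        rcases Nat.lt_or_ge i k with h5 | h5
        · rw [Function.update_of_ne (by omega)]
          exact h4 i h5
        · obtain rfl : i = k := by omega
          rw [h3]
          simpa using h1
  refine ⟨Nat.find hex, ?_, Nat.find_spec hex⟩
  by_contra hlt
  obtain ⟨p, h1, h2, h3⟩ := Nat.find_spec hex
  set k := Nat.find hex with hk
  have := Fintype.ofFinite Y
  -- If the shortest walk had `T` or more edges it would visit more vertices than there are, so one
  -- recurs.
  obtain ⟨i, j, hij, hp⟩ : ∃ i j : ℕ, i < j ∧ j ≤ k ∧ p i = p j := by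
    obtain ⟨i, j, hij, hp⟩ := Fintype.exists_ne_map_eq_of_card_lt (fun i : Fin (k + 1) => p i) (by
      rw [Fintype.card_fin, ← Nat.card_eq_fintype_card]; omega)
    rcases Nat.lt_or_gt_of_ne (Fin.val_ne_of_ne hij) with h | h
    · exact ⟨i, j, h, by omega, hp⟩
    · exact ⟨j, i, h, by omega, hp.symm⟩
  -- Cutting out the segment between the two visits contradicts minimality.
  refine Nat.find_min hex (m := k - (j - i)) (by omega)
    ⟨fun l => if l ≤ i then p l else p (l + (j - i)), by simp [h1], ?_, fun l hl => ?_⟩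
  · dsimp only
    by_cases h4 : k - (j - i) ≤ i
    · have h5 : j = k := by omega
      rw [if_pos h4, show k - (j - i) = i by omega, hp.2, h5, h2]
    · rw [if_neg h4, show k - (j - i) + (j - i) = k by omega, h2]
  · dsimp only
    rcases lt_trichotomy l i with h4 | rfl | h4
    · rw [if_pos h4.le, if_pos (show l + 1 ≤ i from h4)]
      exact h3 l (by omega)
    · rw [if_pos le_rfl, if_neg (by omega), hp.2, show l + 1 + (j - l) = j + 1 by omega]
      exact h3 j (by omega)
    · rw [if_neg (by omega), if_neg (by omega), show l + 1 + (j - i) = l + (j - i) + 1 by omega]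
      exact h3 _ (by omega)

/-- A frame whose states consist of a time less than `T` and a node of a graph; a transition either
follows an edge of the graph, or stays in the same node and proceeds to the last point in time. -/
structure Layered {S Y : Type} (δ : S → S → Prop) (T : ℕ) (G : Y → Y → Prop) (time : S → ℕ)
    (node : S → Y) : Prop where
  time_lt : ∀ s, time s < T
  ext : ∀ s t, time s = time t → node s = node t → s = t
  exists_state : ∀ i < T, ∀ y, ∃ s, time s = i ∧ node s = y
  iff : ∀ s t, δ s t ↔ time t = time s + 1 ∧ G (node s) (node t) ∨
    time t + 1 = T ∧ node t = node s

namespace Layered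

variable {S Y : Type} {δ : S → S → Prop} {T : ℕ} {G : Y → Y → Prop} {time : S → ℕ} {node : S → Y}

/-- Time never decreases, so it is constant along a loop. A transition that keeps the time is a jump
within the last layer and hence a self-loop; and no other transition leaves the last layer. -/
theorem acyclic (h : Layered δ T G time node) : AcyclicFrame δ := by
  intro n s hs
  have hmono : ∀ {s t}, δ s t → time s ≤ time t := by
    intro s t hst
    have := h.time_lt s
    rcases (h.iff s t).1 hst with h1 | h1 <;> omega
  have hlast : ∀ {s t}, δ s t → time s = time t → time s + 1 = T ∧ t = s := by
    intro s t hst h1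
    rcases (h.iff s t).1 hst with h2 | h2
    · omega
    · exact ⟨by omega, h.ext _ _ h1.symm h2.2⟩
  have hge : ∀ i ≤ n, time (s 0) ≤ time (s i) := by
    intro i hi
    induction i with
    | zero => exact le_rfl
    | succ i ih => exact (ih (by omega)).trans (hmono (hs.1 i (by omega)))
  -- The closing transition bounds the time of the last state by that of the first; the bound is
  -- carried backwards along the loop.
  have hle : ∀ k ≤ n, time (s (n - k)) ≤ time (s 0) := by
    intro k hk
    induction k with
    | zero => exact hmono hs.2
    | succ k ih =>
      have := hmono (hs.1 (n - (k + 1)) (by omega))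
      rw [show n - (k + 1) + 1 = n - k by omega] at this
      exact this.trans (ih (by omega))
  have htime : ∀ i ≤ n, time (s i) = time (s 0) := fun i hi => by
    have h1 := hle (n - i) (by omega)
    rw [show n - (n - i) = i by omega] at h1
    exact le_antisymm h1 (hge i hi)
  have heq : ∀ i ≤ n, s i = s 0 := by
    intro i hi
    induction i with
    | zero => rfl
    | succ i ih =>
      rw [← ih (by omega)]
      exact (hlast (hs.1 i (by omega)) (by rw [htime i (by omega), htime (i + 1) hi])).2
  refine ⟨heq, fun t ht => ?_⟩
  have h1 := hs.2
  rw [heq n le_rfl] at h1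
  have h2 := (hlast h1 rfl).1
  have h3 := hmono ht
  have h4 := h.time_lt t
  exact (hlast ht (by omega)).2

/-- Forgetting the time maps walks to walks, as jumps keep the node. Conversely, a shortest walk in
the graph has fewer than `T` edges, so the clock suffices to follow it step by step. -/
theorem reachable_iff (h : Layered δ T G time node) [Finite Y] (hT : Nat.card Y ≤ T) {s₀ : S} (h0 : time s₀ = 0)
    (P : Y → Prop) : (∃ s, Relation.ReflTransGen δ s₀ s ∧ P (node s)) ↔
      ∃ y, Relation.ReflTransGen G (node s₀) y ∧ P y := by
  constructor
  · rintro ⟨s, h1, h2⟩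
    refine ⟨_, ?_, h2⟩
    clear h2
    induction h1 with
    | refl => exact .refl
    | @tail s t _ h1 ih =>
      rcases (h.iff s t).1 h1 with h2 | h2
      · exact ih.tail h2.2
      · rwa [h2.2]
  · rintro ⟨y, h1, h2⟩
    obtain ⟨k, hk, p, h3, h4, h5⟩ := exists_short_walk hT h1
    have key : ∀ i ≤ k, ∃ s, Relation.ReflTransGen δ s₀ s ∧ time s = i ∧ node s = p i := by
      intro i hi
      induction i with
      | zero => exact ⟨s₀, .refl, h0, h3.symm⟩
      | succ i ih =>
        obtain ⟨s, h6, h7, h8⟩ := ih (by omega)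
        obtain ⟨t, h9, h10⟩ := h.exists_state (i + 1) (by omega) (p (i + 1))
        refine ⟨t, h6.tail ((h.iff s t).2 (.inl ⟨by omega, ?_⟩)), h9, h10⟩
        rw [h8, h10]
        exact h5 i (by omega)
    obtain ⟨s, h6, -, h7⟩ := key k le_rfl
    exact ⟨s, h6, by rwa [h7, h4]⟩

end Layered

/-! ### Reachability as a formula -/

/-- The formula `∃ π. F p` over a single atomic proposition `p`. -/
def reachFormula : HyperLTL (Fin 1) := .ex 0 (.body (.until .tt (.atom 0 0)))

theorem closed_reachFormula : reachFormula.Closed := by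
  simp [HyperLTL.Closed, reachFormula, HyperLTL.freeVars, HyperBody.vars]

theorem isEStar_reachFormula : reachFormula.IsEStar := trivial

theorem Kripke.models_reachFormula {S : Type} (K : Kripke (Fin 1) S) :
    K.Models reachFormula ↔ ∃ s, Relation.ReflTransGen K.δ K.init s ∧ 0 ∈ K.label s := by
  constructor
  · rintro ⟨t, ⟨p, h1, h2, h3⟩, i, ⟨t', h4, h5⟩, -⟩
    simp only [Assignment.suffix, Function.update_self, Option.map_some, Option.some.injEq] at h4
    subst h4
    refine ⟨p i, ?_, by rw [← h3]; exact h5⟩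
    rw [← h1]
    clear h5
    induction i with
    | zero => exact .refl
    | succ i ih => exact ih.tail (h2 i)
  · rintro ⟨s, h1, h2⟩
    suffices ∃ p : ℕ → S, p 0 = K.init ∧ (∀ i, K.δ (p i) (p (i + 1))) ∧ ∃ i, 0 ∈ K.label (p i) by
      obtain ⟨p, h3, h4, i, h5⟩ := this
      refine ⟨fun i => K.label (p i), ⟨p, h3, h4, fun _ => rfl⟩, i,
        ⟨fun j => K.label (p (i + j)), ?_, h5⟩, fun _ _ => trivial⟩
      simp [Assignment.suffix]
    generalize K.init = s₀ at h1 ⊢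
    induction h1 using Relation.ReflTransGen.head_induction_on with
    | refl =>
      -- A finite path to the labelled state extends to an infinite one because every state has a
      -- successor.
      choose g hg using K.total
      exact ⟨fun i => g^[i] s, rfl, fun i => by
        dsimp only; rw [Function.iterate_succ_apply']; exact hg _, 0, h2⟩
    | @head a b h3 _ ih =>
      obtain ⟨p, h4, h5, i, h6⟩ := ih
      refine ⟨fun i => Nat.casesOn i a p, rfl, fun i => ?_, i + 1, h6⟩
      cases i with
      | zero =>
        change K.δ a (p 0)
        rwa [h4]
      | succ i => exact h5 i

/-- The encoding is injective: the number of states is the position of the first `false`, and then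
all other components sit at known positions. -/
theorem Kripke.hasRepair_iff_of_encode_eq {a n n' : ℕ} {K : Kripke (Fin a) (Fin n)}
    {K' : Kripke (Fin a) (Fin n')} (h : K.encode = K'.encode) (φ : HyperLTL (Fin a)) :
    K.HasRepair φ ↔ K'.HasRepair φ := by
  have hn : n = n' := by
    rcases lt_trichotomy n n' with h1 | h1 | h1
    · have := K'.encode_getElem?_unary h1
      rw [← h, K.encode_getElem?_sep] at this
      simp at this
    · exact h1
    · have := K.encode_getElem?_unary h1
      rw [h, K'.encode_getElem?_sep] at this
      simp at this
  subst hn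
  have h1 : K.init = K'.init := by
    have := K.encode_getElem?_init K.init
    rw [h, K'.encode_getElem?_init] at this
    simpa using this
  have h2 : K.δ = K'.δ := by
    funext s t
    rw [← propext (K.codedEdge_encode s t), h, propext (K'.codedEdge_encode s t)]
  have h3 : K.label = K'.label := by
    funext s
    rw [← K.codedLabel_encode, h, K'.codedLabel_encode]
  obtain ⟨i, d, l, t⟩ := K
  obtain ⟨i', d', l', t'⟩ := K'
  obtain rfl : i = i' := h1
  obtain rfl : d = d' := h2
  obtain rfl : l = l' := h3
  exact Iff.rfl

/-! ### Hardness -/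

namespace OfflineTM

variable {M : OfflineTM Empty} {C : ℕ}

theorem numVal_inHead_code {w : List Bool} {L : ℕ} (hw : w.length + 1 < 2 ^ L) {c : M.Config}
    (hp : c.inHead ≤ w.length + 1) :
    numVal boolDigit ((code C L c).map Prod.fst) = c.inHead := by
  rw [code, List.map_fst_zip (by simp [length_numStr]), numVal_numStr _ (by omega)]

theorem Reachable.inHead_le {w : List Bool} {c : M.Config} (h : M.Reachable w c) :
    c.inHead ≤ w.length + 1 := by
  induction h with
  | refl => exact Nat.zero_le _
  | tail _ h1 _ =>
    obtain ⟨α, -, rfl⟩ := h1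
    exact min_le_right _ _

/-- The step relation on words of a given length. -/
def CodeStep (M : OfflineTM Empty) (C : ℕ) (w : List Bool) (L : ℕ)
    (x x' : {x : List (M.CodeLetter C) // x.length = L}) : Prop :=
  StepRel (inputSymbol w (numVal boolDigit (x.1.map Prod.fst))) (x.1.zip x'.1)

/-- Starting from the code of the initial configuration one never leaves the codes of reachable
configurations, so the behaviour of `StepRel` on meaningless words is irrelevant. -/
theorem reachable_code_iff {w : List Bool} {L : ℕ} (hw : w.length + 1 < 2 ^ L)
    (hC : ∀ c, M.Reachable w c → ∀ κ, c.head κ < L * C)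
    (x : {x : List (M.CodeLetter C) // x.length = L}) :
    Relation.ReflTransGen (CodeStep M C w L) ⟨code C L M.initial, length_code _ _ _⟩ x ↔
      ∃ c, M.Reachable w c ∧ x.1 = code C L c := by
  have key : ∀ c, M.Reachable w c → ∀ x' : {x : List (M.CodeLetter C) // x.length = L},
      CodeStep M C w L ⟨code C L c, length_code _ _ _⟩ x' ↔
        ∃ c', M.Step w c c' ∧ x'.1 = code C L c' := by
    intro c hc x'
    unfold CodeStep
    rw [numVal_inHead_code hw hc.inHead_le]
    exact stepRel_code x'.2 hw hc.inHead_le (hC c hc) fun c' h => hC c' (hc.tail h)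
  constructor
  · intro h
    induction h with
    | refl => exact ⟨_, .refl, rfl⟩
    | @tail y z _ h1 ih =>
      obtain ⟨c, h2, h3⟩ := ih
      obtain rfl : y = ⟨code C L c, length_code _ _ _⟩ := Subtype.ext h3
      obtain ⟨c', h4, h5⟩ := (key c h2 z).1 h1
      exact ⟨c', h2.tail h4, h5⟩
  · rintro ⟨c, h1, h2⟩
    obtain rfl : x = ⟨code C L c, length_code _ _ _⟩ := Subtype.ext h2
    clear h2
    induction h1 with
    | refl => exact .refl
    | @tail c c' h1 h2 ih => exact ih.tail ((key c h1 _).2 ⟨c', h2, rfl⟩)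

/-- A word all of whose letters contain the accepting state. -/
def AcceptingWord (x : List (M.CodeLetter C)) : Prop := ∀ z ∈ x, z.2.1 = M.accept

theorem acceptingWord_code {L : ℕ} (hL : 0 < L) (c : M.Config) :
    AcceptingWord (code C L c) ↔ c.state = M.accept := by
  have h : AcceptingWord (code C L c) ↔ ∀ z ∈ (code C L c).map Prod.snd, z.1 = M.accept := by
    rw [List.forall_mem_map]
    rfl
  rw [h, code, List.map_snd_zip (by simp [length_numStr]), List.forall_mem_ofFn_iff]
  exact ⟨fun h => h ⟨0, hL⟩, fun h _ => h⟩

theorem accepts_iff_code {w : List Bool} {L : ℕ} (hw : w.length + 1 < 2 ^ L)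
    (hC : ∀ c, M.Reachable w c → ∀ κ, c.head κ < L * C) :
    M.Accepts w ↔ ∃ x, Relation.ReflTransGen (CodeStep M C w L)
      ⟨code C L M.initial, length_code _ _ _⟩ x ∧ AcceptingWord x.1 := by
  have hL : 0 < L := Nat.pos_of_ne_zero fun h => by simp [h] at hw
  constructor
  · rintro ⟨c, h1, h2⟩
    exact ⟨⟨code C L c, length_code _ _ _⟩, (reachable_code_iff hw hC _).2 ⟨c, h1, rfl⟩,
      (acceptingWord_code hL c).2 h2⟩
  · rintro ⟨x, h1, h2⟩
    obtain ⟨c, h3, h4⟩ := (reachable_code_iff hw hC _).1 h1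
    rw [h4, acceptingWord_code hL] at h2
    exact ⟨c, h3, h2⟩

variable (M C) in
/-- The letters of the code of the initial configuration after the first one. -/
def padLetter : M.CodeLetter C := (false, M.start, fun _ _ => (M.blank, false))

variable (M C) in
open Classical in
/-- The first letter of the code of the initial configuration. -/
noncomputable def headLetter : M.CodeLetter C :=
  (false, M.start, fun _ j => (M.blank, decide ((j : ℕ) = 0)))

theorem code_initial (L : ℕ) :
    code C (L + 1) M.initial = headLetter M C :: List.replicate L (padLetter M C) := by
  have hz : ∀ L, numStr boolDigit L 0 = List.replicate L false := by
    intro L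
    induction L with
    | zero => rfl
    | succ L ih => rw [List.replicate_succ, ← ih]; rfl
  rw [code, List.ofFn_succ]
  refine List.ext_getElem (by simp [length_numStr]) fun i h1 h2 => ?_
  rcases i with _ | i
  · simp [initial, hz, block, headLetter, eq_comm]
  · simp only [initial, hz, block, padLetter]
    simp
    funext κ j
    have : 0 < C := j.pos
    have h3 : 0 < (i + 1) * C := by positivity
    exact congrArg (Prod.mk M.blank) (decide_eq_false (by omega))

end OfflineTM

/-! ### The reduction -/

section Timed

variable {X : Type} {R m L : ℕ} (eX : X ≃ Fin R) (e : X × X ≃ Fin m)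

/-- The edges between words that consist of a time and a node. -/
def TimedRel (P : List (X × X) → Prop) (v : List ((X × X) × (X × X))) : Prop :=
  (Runs (CarryStep eX) true (v.map fun z => (z.1.1, z.2.1)) false ∧
    P (v.map fun z => (z.1.2, z.2.2))) ∨
  (∀ z ∈ v, (eX z.2.1 : ℕ) + 1 = R) ∧ ∀ z ∈ v, z.2.2 = z.1.2

theorem regPred_timedRel {P : List (X × X) → Prop} (hP : RegPred P) :
    RegPred (TimedRel eX P) :=
  (((RegPred.runs (CarryStep eX) true false).comap fun z : (X × X) × (X × X) =>
    (z.1.1, z.2.1)).and (hP.comap fun z : (X × X) × (X × X) => (z.1.2, z.2.2))).or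
  ((RegPred.all fun z : (X × X) × (X × X) => (eX z.2.1 : ℕ) + 1 = R).and (RegPred.all _))

variable [NeZero m]

/-- The time of a state. -/
def stateTime (s : Fin (m ^ L)) : ℕ := numVal eX ((numStr e L s).map Prod.fst)

/-- The node of a state. -/
def stateNode (s : Fin (m ^ L)) : {x : List X // x.length = L} :=
  ⟨(numStr e L s).map Prod.snd, by rw [List.length_map, length_numStr]⟩

variable (L) in
/-- The transition relation of the frame of times and nodes. -/
def TimedStep (P : {x : List X // x.length = L} → List (X × X) → Prop)
    (s t : Fin (m ^ L)) : Prop :=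
  TimedRel eX (P (stateNode e s)) ((numStr e L s).zip (numStr e L t))

theorem exists_numStr_eq {A : Type} (e : A ≃ Fin m) {l : List A} (hl : l.length = L) :
    ∃ s : Fin (m ^ L), numStr e L s = l := by
  subst hl
  exact ⟨⟨numVal e l, numVal_lt e l⟩, numStr_numVal e l⟩

theorem numStr_injective {A : Type} (e : A ≃ Fin m) {s t : Fin (m ^ L)}
    (h : numStr e L s = numStr e L t) : s = t := by
  have := congrArg (numVal e) h
  rw [numVal_numStr e s.2, numVal_numStr e t.2] at this
  exact Fin.ext this

/-- The number of a word. -/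
def wordVal (x : {x : List X // x.length = L}) : Fin (R ^ L) :=
  ⟨numVal eX x.1, by have := numVal_lt eX x.1; rwa [x.2] at this⟩

theorem wordVal_injective [NeZero R] : Function.Injective (wordVal (L := L) eX) := fun x y h =>
  Subtype.ext (eq_of_numVal_eq eX (x.2.trans y.2.symm) (congrArg Fin.val h))

theorem forall_mem_zip_eq_iff {A : Type} {l l' : List A} (h : l.length = l'.length) :
    (∀ z ∈ l.zip l', z.2 = z.1) ↔ l' = l := by
  induction l generalizing l' with
  | nil => simp [List.eq_nil_of_length_eq_zero h.symm]
  | cons x l ih =>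
    rcases l' with _ | ⟨y, l'⟩
    · simp at h
    · rw [List.zip_cons_cons, List.forall_mem_cons, ih (by simpa using h), List.cons.injEq]

theorem exists_state [NeZero R] {i : ℕ} (hi : i < R ^ L) (y : {x : List X // x.length = L}) :
    ∃ s : Fin (m ^ L), stateTime eX e s = i ∧ stateNode e s = y := by
  obtain ⟨s, hs⟩ := exists_numStr_eq (L := L) e (l := (numStr eX L i).zip y.1)
    (by simp [length_numStr, y.2])
  refine ⟨s, ?_, Subtype.ext ?_⟩
  · rw [stateTime, hs, List.map_fst_zip (by simp [length_numStr, y.2]), numVal_numStr _ hi]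
  · change (numStr e L s).map Prod.snd = y.1
    rw [hs]
    exact List.map_snd_zip (by simp [length_numStr, y.2])

/-- Each letter carries a digit of the time and a letter of the node. A carry run without overflow
is the successor of the time, and maximal digits throughout mean the last time. -/
theorem layered_timedStep [NeZero R]
    (P : {x : List X // x.length = L} → List (X × X) → Prop) :
    Layered (TimedStep L eX e P) (R ^ L) (fun x y => P x (x.1.zip y.1)) (stateTime eX e)
      (stateNode e) where
  time_lt s := by
    have := numVal_lt eX ((numStr e L s).map Prod.fst)
    rwa [List.length_map, length_numStr] at this
  ext s t h1 h2 := by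
    refine numStr_injective e ?_
    have h3 := eq_of_numVal_eq eX (by simp [length_numStr]) h1
    have h4 := congrArg Subtype.val h2
    exact (List.zip_of_prod h3 h4).trans (List.zip_of_prod rfl rfl).symm
  exists_state i hi y := exists_state eX e hi y
  iff s t := by
    have hs : numStr e L s = ((numStr e L s).map Prod.fst).zip ((numStr e L s).map Prod.snd) :=
      List.zip_of_prod rfl rfl
    have ht : numStr e L t = ((numStr e L t).map Prod.fst).zip ((numStr e L t).map Prod.snd) :=
      List.zip_of_prod rfl rfl
    obtain ⟨h1, h2⟩ := OfflineTM.map_zip_zip (a := (numStr e L s).map Prod.fst)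
      (b := (numStr e L s).map Prod.snd) (a' := (numStr e L t).map Prod.fst)
      (b' := (numStr e L t).map Prod.snd) (by simp) (by simp [length_numStr])
      (by simp [length_numStr])
    rw [← hs, ← ht] at h1 h2
    unfold TimedStep TimedRel
    rw [h1, h2, runs_carryStep, List.map_fst_zip (by simp [length_numStr]),
      List.map_snd_zip (by simp [length_numStr])]
    have h3 : (∀ z ∈ (numStr e L s).zip (numStr e L t), (eX z.2.1 : ℕ) + 1 = R) ↔
        stateTime eX e t + 1 = R ^ L := by
      have h4 := numVal_eq_max eX (l := (numStr e L t).map Prod.fst)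
      rw [List.length_map, length_numStr] at h4
      rw [stateTime, ← h4, ← List.map_snd_zip (l₁ := numStr e L s) (l₂ := numStr e L t)
        (by simp [length_numStr]), List.map_map, List.forall_mem_map,
        List.map_snd_zip (by simp [length_numStr])]
      rfl
    have h5 : (∀ z ∈ (numStr e L s).zip (numStr e L t), z.2.2 = z.1.2) ↔
        stateNode e t = stateNode e s := by
      have h6 := forall_mem_zip_eq_iff (l := (numStr e L s).map Prod.snd)
        (l' := (numStr e L t).map Prod.snd) (by simp [length_numStr])
      rw [← h2, List.forall_mem_map] at h6
      exact h6.trans ⟨fun h => Subtype.ext h, fun h => congrArg Subtype.val h⟩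
    rw [h3, h5]
    simp only [Bool.toNat_false, Bool.toNat_true, mul_zero, add_zero]
    rfl

/-- The jump to the last time is always available; it provides totality even where the machine has
no step. -/
theorem exists_timedStep [NeZero R] (P : {x : List X // x.length = L} → List (X × X) → Prop)
    (s : Fin (m ^ L)) : ∃ t, TimedStep L eX e P s t := by
  have hR : 0 < R ^ L := Nat.pow_pos (NeZero.pos R)
  obtain ⟨t, h1, h2⟩ := exists_state eX e (i := R ^ L - 1) (by omega) (stateNode e s)
  exact ⟨t, ((layered_timedStep eX e P).iff s t).2 (.inr ⟨by omega, h2⟩)⟩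

end Timed

/-- Words with a given first letter, followed by copies of another letter. -/
def HeadPad {A : Type} (a b : A) (l : List A) : Prop :=
  Runs (fun c z c' => c' = false ∧ z = if c = true then a else b) true l false

theorem headPad_iff {A : Type} {a b : A} {l : List A} :
    HeadPad a b l ↔ ∃ n, l = a :: List.replicate n b := by
  have key : ∀ l : List A, Runs (fun (c : Bool) z c' => c' = false ∧
      z = if c = true then a else b) false l false ↔ ∃ n, l = List.replicate n b := by
    intro l
    induction l with
    | nil => exact ⟨fun _ => ⟨0, rfl⟩, fun _ => rfl⟩
    | cons z l ih =>
      constructor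
      · rintro ⟨_, ⟨rfl, rfl⟩, h⟩
        obtain ⟨n, rfl⟩ := ih.1 h
        exact ⟨n + 1, rfl⟩
      · rintro ⟨n, h⟩
        rcases n with _ | n
        · simp at h
        rw [List.replicate_succ, List.cons.injEq] at h
        exact ⟨false, ⟨rfl, h.1⟩, ih.2 ⟨n, h.2⟩⟩
  cases l with
  | nil => simp [HeadPad, Runs]
  | cons z l =>
    constructor
    · rintro ⟨_, ⟨rfl, rfl⟩, h⟩
      obtain ⟨n, rfl⟩ := (key l).1 h
      exact ⟨n, rfl⟩
    · rintro ⟨n, h⟩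
      rw [List.cons.injEq] at h
      exact ⟨false, ⟨rfl, h.1⟩, (key l).2 ⟨n, h.2⟩⟩

/-! ### The unravelled configuration graph and the reduction -/

namespace OfflineTM

variable {M : OfflineTM Empty} {C R m : ℕ} [NeZero R] [NeZero m]
  (eX : M.CodeLetter C ≃ Fin R) (e : M.CodeLetter C × M.CodeLetter C ≃ Fin m) (w : List Bool)

/-- The initial word of the reduction. -/
noncomputable def initialWord (L : ℕ) : List (M.CodeLetter C × M.CodeLetter C) :=
  (eX.symm 0, headLetter M C) :: List.replicate (L - 1) (eX.symm 0, padLetter M C)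

theorem length_initialWord : (initialWord eX (wordLength w)).length = wordLength w := by
  have := wordLength_pos w
  simp [initialWord]
  omega

/-- The unravelling of the configuration graph of a machine on a given input. -/
noncomputable def unravelling : Kripke (Fin 1) (Fin (m ^ wordLength w)) where
  init := (exists_numStr_eq e (length_initialWord eX w)).choose
  δ := TimedStep (wordLength w) eX e fun x =>
    StepRel (inputSymbol w (numVal boolDigit (x.1.map Prod.fst)))
  label s := {_p | AcceptingWord (stateNode e s).1}
  total := exists_timedStep eX e _

theorem numStr_init_unravelling :
    numStr e (wordLength w) (unravelling eX e w).init = initialWord eX (wordLength w) :=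
  (exists_numStr_eq e (length_initialWord eX w)).choose_spec

theorem layered_unravelling : Layered (unravelling eX e w).δ (R ^ wordLength w)
    (CodeStep M C w (wordLength w)) (stateTime eX e) (stateNode e) :=
  layered_timedStep eX e fun x => StepRel (inputSymbol w (numVal boolDigit (x.1.map Prod.fst)))

theorem logSpaceComputable_unravelling :
    LogSpaceComputable fun w => (unravelling eX e w).encode := by
  have : Finite (M.CodeLetter C) := Finite.of_equiv _ eX.symm
  -- A letter of a state is a pair of a time digit and a code letter; `pbit` selects the bit of the
  -- code letter that belongs to the input position, where the transducer looks up the scanned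
  -- symbol.
  refine Transducer.logSpaceComputable_encode e (pbit := fun a => a.2.1)
    (Init := HeadPad (eX.symm 0, headLetter M C) (eX.symm 0, padLetter M C))
    (Lab := fun l => ∀ z ∈ l, z.2.2.1 = M.accept)
    (Edge := fun x => TimedRel eX (StepRel x)) (RegPred.runs _ _ _) (RegPred.all _)
    (fun x => regPred_timedRel eX (regPred_stepRel x)) _ (fun w s => ?_) (fun w s => ?_)
    fun w s t => ?_
  · rw [headPad_iff]
    constructor
    · rintro rfl
      exact ⟨_, numStr_init_unravelling eX e w⟩
    · rintro ⟨n, h⟩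
      refine numStr_injective e ?_
      have hl := congrArg List.length h
      rw [length_numStr, List.length_cons, List.length_replicate] at hl
      rw [h, numStr_init_unravelling, initialWord, hl, Nat.add_sub_cancel]
  · change AcceptingWord ((numStr e (wordLength w) s).map Prod.snd) ↔ _
    rw [AcceptingWord, List.forall_mem_map]
  · change TimedRel eX (StepRel (inputSymbol w (numVal boolDigit
      (((numStr e (wordLength w) s).map Prod.snd).map Prod.fst)))) _ ↔ _
    rw [List.map_map]
    rfl

theorem numVal_replicate_zero (n : ℕ) : numVal eX (List.replicate n (eX.symm 0)) = 0 := by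
  induction n with
  | zero => rfl
  | succ n ih => simp [List.replicate_succ, numVal, ih]

theorem stateTime_init_unravelling : stateTime eX e (unravelling eX e w).init = 0 := by
  rw [stateTime, numStr_init_unravelling, initialWord, List.map_cons, List.map_replicate,
    ← List.replicate_succ, numVal_replicate_zero]

theorem stateNode_init_unravelling : stateNode e (unravelling eX e w).init =
    ⟨code C (wordLength w) M.initial, length_code _ _ _⟩ := by
  refine Subtype.ext ?_
  change (numStr e (wordLength w) (unravelling eX e w).init).map Prod.snd =
    code C (wordLength w) M.initial
  rw [numStr_init_unravelling, initialWord, List.map_cons, List.map_replicate]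
  obtain ⟨L, hL⟩ : ∃ L, wordLength w = L + 1 :=
    ⟨wordLength w - 1, by have := wordLength_pos w; omega⟩
  rw [hL, code_initial, Nat.add_sub_cancel]

/-- With `R` letters there are at most `R ^ wordLength w` nodes, and this is also the number of
points in time, so the unravelling has room for a shortest accepting computation. -/
theorem accepts_iff_models_unravelling
    (hC : ∀ c, M.Reachable w c → ∀ κ, c.head κ < wordLength w * C) :
    M.Accepts w ↔ (unravelling eX e w).Models reachFormula := by
  have : Finite (M.CodeLetter C) := Finite.of_equiv _ eX.symm
  have : Finite {x : List (M.CodeLetter C) // x.length = wordLength w} :=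
    Finite.of_injective _ (wordVal_injective eX)
  have hcard := Nat.card_le_card_of_injective _ (wordVal_injective (L := wordLength w) eX)
  rw [Nat.card_fin] at hcard
  rw [accepts_iff_code (lt_two_pow_wordLength w) hC, Kripke.models_reachFormula,
    ← stateNode_init_unravelling eX e w]
  exact ((layered_unravelling eX e w).reachable_iff hcard
    (stateTime_init_unravelling eX e w) fun x => AcceptingWord x.1).symm

end OfflineTM

/-- The reduction maps an input to the encoding of its unravelling, which is acyclic in every case;
acceptance becomes satisfaction of the reachability formula, hence existence of a repair. -/
theorem nlHard_acyclicRepair_reachFormula :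
    NLHard (AcyclicStructures 1) (AcyclicRepair reachFormula) := by
  rintro A ⟨M, ⟨C, hC⟩, hA⟩
  have := M.finiteQ
  have := M.finiteΓ
  have : Nonempty (M.CodeLetter C) := ⟨M.padLetter C⟩
  have : NeZero (Nat.card (M.CodeLetter C)) := ⟨Nat.card_pos.ne'⟩
  have : NeZero (Nat.card (M.CodeLetter C × M.CodeLetter C)) := ⟨Nat.card_pos.ne'⟩
  let eX := Finite.equivFin (M.CodeLetter C)
  let e := Finite.equivFin (M.CodeLetter C × M.CodeLetter C)
  have hacyclic : ∀ w, AcyclicFrame (OfflineTM.unravelling eX e w).δ := fun w =>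
    (OfflineTM.layered_unravelling eX e w).acyclic
  refine ⟨fun w => (OfflineTM.unravelling eX e w).encode,
    OfflineTM.logSpaceComputable_unravelling eX e, fun w => ⟨_, _, hacyclic w, rfl⟩, fun w => ?_⟩
  -- The constant of the space bound serves as the block size: `wordLength w` blocks of `C` cells
  -- contain all head positions.
  rw [hA, OfflineTM.accepts_iff_models_unravelling eX e w fun c hc κ => (hC w c hc κ).trans_le (by
    rw [mul_comm]
    exact Nat.mul_le_mul_right _ (log_lt_wordLength w)),
    ← Kripke.hasRepair_iff_models _ isEStar_reachFormula]
  constructor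
  · exact fun h => ⟨_, _, hacyclic w, h, rfl⟩
  · rintro ⟨n, K, -, h1, h2⟩
    exact (Kripke.hasRepair_iff_of_encode_eq h2 _).2 h1

theorem mainTheorem9 :
    -- membership in NL, for every fixed formula of the fragment
    (∀ (a : ℕ) (φ : HyperLTL (Fin a)), φ.Closed → φ.IsEStar → AcyclicRepair φ ∈ NL) ∧
    -- NL-hardness, for some fixed formula of the fragment
    (∃ (a : ℕ) (φ : HyperLTL (Fin a)), φ.Closed ∧ φ.IsEStar ∧
      NLHard (AcyclicStructures a) (AcyclicRepair φ)) ∧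
    -- for existential formulas, repair is equivalent to model checking
    (∀ (AP S : Type) [Finite AP] [Finite S] (K : Kripke AP S) (φ : HyperLTL AP),
      φ.Closed → φ.IsEStar → (K.HasRepair φ ↔ K.Models φ)) :=
  ⟨fun _ _ _ h => acyclicRepair_mem_NL h,
    ⟨1, reachFormula, closed_reachFormula, isEStar_reachFormula,
      nlHard_acyclicRepair_reachFormula⟩,
    fun _ _ _ _ K _ _ h => K.hasRepair_iff_models h⟩
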